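/- **Setting.** Let $d\ge 1$, $R>0$, $\Omega=(-R,R)^d$, write $\mathbf x=(x_1,\dots,x_{d-1},z)$, and let $\Gamma^+=\{\mathbf x: |x_i|\le R\ (1\le i\le d-1),\ z=R\}$. Let $r>R+1$, $b>R+r$, $\epsilon_0>0$, $M>0$, $\beta>1$, and let $p>\lceil d/2\rceil+2$ be an integer, so that $H^p(\Omega)\hookrightarrow C^2(\overline\Omega)$; $H^p(\Omega)$ carries the inner product $\langle u,v\rangle_{H^p(\Omega)}=\sum_{|\alpha|\le p}\int_\Omega D^\alpha u\,D^\alpha v\,d\mathbf x$. Let $F:\overline\Omega\times\mathbb R\times\mathbb R^d\to\mathbb R$, $F=F(\mathbf x,s,\mathbf p)$, be of class $C^2$. For real functions $f$ on $\partial\Omega$ and $g$ on $\Gamma^+$ put $$H=\{u\in H^p(\Omega): u|_{\partial\Omega}=f,\ u_z|_{\Gamma^+}=g\},\quad H_0=\{u\in H^p(\Omega): u|_{\partial\Omega}=0,\ u_z|_{\Gamma^+}=0\},$$ $B(\rho)=\{u\in H^p(\Omega):\|u\|_{H^p(\Omega)}<\rho\}$. For $\lambda>1$, $\eta>0$ and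 $u\in H^p(\Omega)$ let $$J_{\lambda,\beta,\eta}(u)=\int_\Omega e^{2\lambda(\frac{z+r}{b})^\beta}\big|-\epsilon_0\Delta u+F(\mathbf x,u,\nabla u)\big|^2d\mathbf x+\eta\|u\|_{H^p(\Omega)}^2,$$ and for $h\in H_0$ let $$DJ_{\lambda,\beta,\eta}(u)h=2\int_\Omega e^{2\lambda(\frac{z+r}{b})^\beta}\big[-\epsilon_0\Delta u+F(\mathbf x,u,\nabla u)\big]\big[-\epsilon_0\Delta h+\partial_sF(\mathbf x,u,\nabla u)h+\nabla_{\mathbf p}F(\mathbf x,u,\nabla u)\cdot\nabla h\big]d\mathbf x+2\eta\langle u,h\rangle_{H^p(\Omega)}.$$ **Theorem (convergence of the gradient descent method).** There are a number $\lambda_0>1$ depending only on $\epsilon_0,M,b,d,r,R,p,\beta$ and $F$, and for all $\lambda>\lambda_0$ and $\eta>0$ a number $\kappa_0\in(0,1)$ depending only on $\lambda,\beta,\eta,R,r,b,d,p,M$ and $\epsilon_0$, such that the following holds for all $\lambda>\lambda_0$ and $\eta>0$. 1. For every $u\in H^p(\Omega)$ there is a unique $J'_{\lambda,\beta,\eta}(u)\in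 H_0$ with $\langle J'_{\lambda,\beta,\eta}(u),h\rangle_{H^p(\Omega)}=DJ_{\lambda,\beta,\eta}(u)h$ for all $h\in H_0$. 2. For every $\kappa\in(0,\kappa_0)$ there is $\theta\in(0,1)$, depending only on $\kappa,\lambda,\beta,\eta,R,r,b,d,p,M,F$ and $\epsilon_0$, such that for all $f,g$: if a minimizer $u_{\min}$ of $J_{\lambda,\beta,\eta}$ on $H\cap\overline{B(M)}$ lies in $H\cap B(M/3)$, then for every $u^{(0)}\in H\cap B(M/3)$ the sequence $$u^{(k)}=u^{(k-1)}-\kappa J'_{\lambda,\beta,\eta}(u^{(k-1)}),\qquad k\ge1,$$ satisfies $$\|u^{(k)}-u_{\min}\|_{H^p(\Omega)}\le\theta^{k/2}\|u^{(0)}-u_{\min}\|_{H^p(\Omega)}\qquad\text{for all }k\ge1.$$ -/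

import Mathlib

open MeasureTheory Set
open scoped ContDiff

noncomputable section

namespace Convexification

/-- The space `ℝ^d` with `d = n + 1 ≥ 1`; a point is `x = (x₁, …, x_{d-1}, z)`. -/
abbrev E (n : ℕ) : Type := EuclideanSpace ℝ (Fin (n + 1))

/-- The last coordinate `z` of `x`. -/
def zCoord {n : ℕ} (x : E n) : ℝ := x (Fin.last n)

/-- The open cube `Ω = (-R, R)^d`. -/
def cube (n : ℕ) (R : ℝ) : Set (E n) := {x | ∀ i, x i ∈ Ioo (-R) R}

/-- The face `Γ⁺ = {x : z = R, |x_i| ≤ R}` of the cube. -/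
def gammaPlus (n : ℕ) (R : ℝ) : Set (E n) := {x | (∀ i, |x i| ≤ R) ∧ zCoord x = R}

/-- Lebesgue measure on `Ω`. -/
abbrev cubeMeasure (n : ℕ) (R : ℝ) : Measure (E n) := volume.restrict (cube n R)

/-! ### Classical partial derivatives and test functions -/

/-- The `i`-th partial derivative. -/
def partialD {n : ℕ} (i : Fin (n + 1)) (φ : E n → ℝ) : E n → ℝ :=
  fun x => fderiv ℝ φ x (EuclideanSpace.single i 1)

/-- The partial derivative `∂^α φ` for a multi-index `α`. -/
def iterPartial {n : ℕ} (α : Fin (n + 1) → ℕ) (φ : E n → ℝ) : E n → ℝ :=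
  (List.finRange (n + 1)).foldr (fun i ψ => (partialD i)^[α i] ψ) φ

/-- Test functions: `φ ∈ C_c^∞(Ω)`. -/
structure IsTest (n : ℕ) (R : ℝ) (φ : E n → ℝ) : Prop where
  smooth : ContDiff ℝ ∞ φ
  compact : HasCompactSupport φ
  supp : tsupport φ ⊆ cube n R

/-! ### The Sobolev space `H^p(Ω)` -/

/-- The multi-indices `α` with `|α| ≤ p`. -/
def multiIdx (n p : ℕ) : Finset (Fin (n + 1) → ℕ) :=
  (Fintype.piFinset fun _ => Finset.range (p + 1)).filter fun α => ∑ i, α i ≤ p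

theorem mem_multiIdx {n p : ℕ} {α : Fin (n + 1) → ℕ} :
    α ∈ multiIdx n p ↔ ∑ i, α i ≤ p := by
  simp only [multiIdx, Finset.mem_filter, Fintype.mem_piFinset, Finset.mem_range,
    and_iff_right_iff_imp]
  intro h i
  exact Nat.lt_succ_of_le
    ((Finset.single_le_sum (f := α) (fun _ _ => Nat.zero_le _) (Finset.mem_univ i)).trans h)

theorem zero_mem_multiIdx (n p : ℕ) : (0 : Fin (n + 1) → ℕ) ∈ multiIdx n p := by
  simp [mem_multiIdx]

/-- Families `(u_α)_{|α| ≤ p}` in `L²(Ω)` with the norm `(∑_α ‖u_α‖²)^{1/2}`. -/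
abbrev JetSpace (n p : ℕ) (R : ℝ) : Type :=
  PiLp 2 fun _ : multiIdx n p => Lp ℝ 2 (cubeMeasure n R)

theorem smooth_partialD {n : ℕ} (i : Fin (n + 1)) {φ : E n → ℝ}
    (h : ContDiff ℝ ∞ φ ∧ HasCompactSupport φ) :
    ContDiff ℝ ∞ (partialD i φ) ∧ HasCompactSupport (partialD i φ) := by
  refine ⟨(h.1.fderiv_right (m := ∞) (by simp)).clm_apply contDiff_const, ?_⟩
  exact h.2.fderiv_apply ℝ (EuclideanSpace.single i 1)

theorem smooth_iterPartial {n : ℕ} (α : Fin (n + 1) → ℕ) {φ : E n → ℝ}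
    (h : ContDiff ℝ ∞ φ ∧ HasCompactSupport φ) :
    ContDiff ℝ ∞ (iterPartial α φ) ∧ HasCompactSupport (iterPartial α φ) := by
  have key : ∀ (i : Fin (n + 1)) (k : ℕ) (ψ : E n → ℝ),
      (ContDiff ℝ ∞ ψ ∧ HasCompactSupport ψ) →
      (ContDiff ℝ ∞ ((partialD i)^[k] ψ) ∧ HasCompactSupport ((partialD i)^[k] ψ)) := by
    intro i k
    induction k with
    | zero => intro ψ hψ; exact hψ
    | succ k ih => intro ψ hψ; exact ih _ (smooth_partialD i hψ)
  unfold iterPartial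
  induction List.finRange (n + 1) with
  | nil => exact h
  | cons i l ih => exact key i (α i) _ ih

theorem integrable_mul_of_smooth {n : ℕ} {R : ℝ} (v : Lp ℝ 2 (cubeMeasure n R)) {ψ : E n → ℝ}
    (h : ContDiff ℝ ∞ ψ ∧ HasCompactSupport ψ) :
    Integrable (fun x => v x * ψ x) (cubeMeasure n R) :=
  MemLp.integrable_mul (p := 2) (q := 2) (Lp.memLp v)
    (h.1.continuous.memLp_of_hasCompactSupport h.2)

/-- The Sobolev space `H^p(Ω)`, a function being given together with its weak derivatives:
families `(u_α)_{|α| ≤ p}` in `L²(Ω)` such that `u_α` is the weak derivative `D^α u` of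
`u = u_0`. The inner product is `⟨u, v⟩ = ∑_{|α| ≤ p} ∫_Ω D^α u D^α v`. -/
def sobolev (n p : ℕ) (R : ℝ) : Submodule ℝ (JetSpace n p R) where
  carrier := {u | ∀ (α : multiIdx n p) (φ : E n → ℝ), IsTest n R φ →
    ∫ x, u ⟨0, zero_mem_multiIdx n p⟩ x * iterPartial α.1 φ x ∂(cubeMeasure n R)
      = (-1) ^ (∑ i, α.1 i) * ∫ x, u α x * φ x ∂(cubeMeasure n R)}
  zero_mem' := by
    intro α φ _
    have h0 : ∀ (ψ : E n → ℝ), ∫ x, (0 : Lp ℝ 2 (cubeMeasure n R)) x * ψ x ∂(cubeMeasure n R)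
        = 0 := by
      intro ψ
      rw [← integral_zero (E n) ℝ (μ := cubeMeasure n R)]
      refine integral_congr_ae ?_
      filter_upwards [Lp.coeFn_zero ℝ 2 (cubeMeasure n R)] with x hx
      rw [hx, Pi.zero_apply, zero_mul]
    simp only [PiLp.zero_apply]
    rw [h0, h0, mul_zero]
  add_mem' := by
    intro u v hu hv α φ hφ
    have hadd : ∀ (a b : Lp ℝ 2 (cubeMeasure n R)) (ψ : E n → ℝ),
        (ContDiff ℝ ∞ ψ ∧ HasCompactSupport ψ) →
        ∫ x, (a + b) x * ψ x ∂(cubeMeasure n R)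
          = ∫ x, a x * ψ x ∂(cubeMeasure n R) + ∫ x, b x * ψ x ∂(cubeMeasure n R) := by
      intro a b ψ hψ
      rw [← integral_add (integrable_mul_of_smooth a hψ) (integrable_mul_of_smooth b hψ)]
      refine integral_congr_ae ?_
      filter_upwards [Lp.coeFn_add a b] with x hx
      rw [hx, Pi.add_apply, add_mul]
    simp only [PiLp.add_apply]
    rw [hadd _ _ _ (smooth_iterPartial α.1 ⟨hφ.smooth, hφ.compact⟩),
      hadd _ _ _ ⟨hφ.smooth, hφ.compact⟩, hu α φ hφ, hv α φ hφ, mul_add]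
  smul_mem' := by
    intro c u hu α φ hφ
    have hsmul : ∀ (a : Lp ℝ 2 (cubeMeasure n R)) (ψ : E n → ℝ),
        ∫ x, (c • a) x * ψ x ∂(cubeMeasure n R) = c * ∫ x, a x * ψ x ∂(cubeMeasure n R) := by
      intro a ψ
      rw [← integral_const_mul]
      refine integral_congr_ae ?_
      filter_upwards [Lp.coeFn_smul c a] with x hx
      rw [hx, Pi.smul_apply, smul_eq_mul, mul_assoc]
    simp only [PiLp.smul_apply]
    rw [hsmul, hsmul, hu α φ hφ]
    ring

/-- The Hilbert space `H^p(Ω)`. -/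
abbrev Hp (n p : ℕ) (R : ℝ) : Type := sobolev n p R

variable {n p : ℕ} {R : ℝ}

/-- The weak derivative `D^α u` of `u ∈ H^p(Ω)` (meaningful for `|α| ≤ p`). -/
def wD (α : Fin (n + 1) → ℕ) (u : Hp n p R) : E n → ℝ :=
  if h : α ∈ multiIdx n p then (u : JetSpace n p R) ⟨α, h⟩ else 0

/-- The function `u` itself. -/
def val (u : Hp n p R) : E n → ℝ := wD 0 u

/-- The gradient `∇u`. -/
def grad (u : Hp n p R) (x : E n) : E n :=
  WithLp.toLp 2 fun i => wD (Pi.single i 1) u x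

/-- The Laplacian `Δu`. -/
def lap (u : Hp n p R) (x : E n) : ℝ := ∑ i, wD (Pi.single i 2) u x

/-- The set `H = {u ∈ H^p(Ω) : u = f on ∂Ω, u_z = g on Γ⁺}`. The boundary values are those of the
representative of `u` of class `C²` on `closure Ω` (unique, and existing for every `u ∈ H^p(Ω)`
when `p > ⌈d/2⌉ + 2`). -/
def bdrySet (n p : ℕ) (R : ℝ) (f g : E n → ℝ) : Set (Hp n p R) :=
  {u | ∃ U : E n → ℝ, ContDiffOn ℝ 2 U (closure (cube n R)) ∧
    U =ᵐ[cubeMeasure n R] val u ∧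
    (∀ x ∈ frontier (cube n R), U x = f x) ∧
    ∀ x ∈ gammaPlus n R,
      fderivWithin ℝ U (closure (cube n R)) x (EuclideanSpace.single (Fin.last n) 1) = g x}

/-- The Carleman weight `e^{2λ((z + r)/b)^β}`. -/
def weight (r b lam β : ℝ) (x : E n) : ℝ :=
  Real.exp (2 * lam * ((zCoord x + r) / b) ^ β)

/-- `F : closure Ω × ℝ × ℝ^d → ℝ` is of class `C²`. -/
def IsC2 (R : ℝ) (F : E n → ℝ → E n → ℝ) : Prop :=
  ContDiffOn ℝ 2 (fun q : E n × ℝ × E n => F q.1 q.2.1 q.2.2) (closure (cube n R) ×ˢ univ)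

/-- The residual `-ε₀ Δu + F(x, u, ∇u)`. -/
def residual (ε₀ : ℝ) (F : E n → ℝ → E n → ℝ) (u : Hp n p R) (x : E n) : ℝ :=
  -ε₀ * lap u x + F x (val u x) (grad u x)

/-- The linearized operator
`-ε₀ Δh + ∂_s F(x, u, ∇u) h + ∇_p F(x, u, ∇u) · ∇h`. -/
def linResidual (ε₀ : ℝ) (F : E n → ℝ → E n → ℝ) (u h : Hp n p R) (x : E n) : ℝ :=
  -ε₀ * lap h x + deriv (fun s => F x s (grad u x)) (val u x) * val h x
    + fderiv ℝ (fun q => F x (val u x) q) (grad u x) (grad h x)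

/-- The functional
`J(u) = ∫_Ω e^{2λ((z + r)/b)^β} |-ε₀ Δu + F(x, u, ∇u)|² dx + η ‖u‖²_{H^p}`. -/
def J (r b ε₀ : ℝ) (F : E n → ℝ → E n → ℝ) (lam β η : ℝ) (u : Hp n p R) : ℝ :=
  ∫ x, weight r b lam β x * |residual ε₀ F u x| ^ 2 ∂(cubeMeasure n R) + η * ‖u‖ ^ 2

/-- The differential `DJ(u)h`. -/
def DJ (r b ε₀ : ℝ) (F : E n → ℝ → E n → ℝ) (lam β η : ℝ) (u h : Hp n p R) : ℝ :=
  2 * ∫ x, weight r b lam β x * residual ε₀ F u x * linResidual ε₀ F u h x ∂(cubeMeasure n R)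
    + 2 * η * inner ℝ u h

/-- `G ∈ H₀` represents `DJ(u)` on
`H₀ = {h ∈ H^p(Ω) : h = 0 on ∂Ω, h_z = 0 on Γ⁺}` in the inner product of `H^p(Ω)`. -/
def IsRieszGradient (r b ε₀ : ℝ) (F : E n → ℝ → E n → ℝ) (lam β η : ℝ) (u G : Hp n p R) : Prop :=
  G ∈ bdrySet n p R 0 0 ∧ ∀ h ∈ bdrySet n p R 0 0, inner ℝ G h = DJ r b ε₀ F lam β η u h

open Classical in
/-- The gradient `J'(u) ∈ H₀`, the Riesz representative of `DJ(u)`. -/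
def gradJ (r b ε₀ : ℝ) (F : E n → ℝ → E n → ℝ) (lam β η : ℝ) (u : Hp n p R) : Hp n p R :=
  if h : ∃ G, IsRieszGradient r b ε₀ F lam β η u G then h.choose else 0

end Convexification

end

/-! For large λ the differential `DJ` is strongly monotone and Lipschitz on the ball of radius M, so
a small gradient step contracts. If G represents `DJ` at u, v is critical, ⟨G, u − v⟩ ≥ 2η‖u − v‖²,
‖G‖ ≤ L‖u − v‖ and κL² ≤ η, then ‖u − κG − v‖² ≤ (1 − κη)‖u − v‖² (`norm_sub_smul_le_of_monotone`);
hence θ = 1 − κη.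

Monotonicity is `le_DJ_sub_DJ`. With h = u − v, the integrand of DJ(u)h − DJ(v)h is at least the
weight times ε₀²(Δh)²/2 − const (|∇h|² + h²). The Carleman estimate `exists_carleman` bounds kλ
times the weighted integral of |∇h|² + h² by that of (Δh)², so the negative part is absorbed for
large λ and the regularization leaves 2η‖h‖². The estimate comes from integrating the divergence of
an explicit quadratic field: its boundary flux has a sign because h = 0 on ∂Ω and h_z = 0 on Γ⁺, and
its bulk terms have a sign because β > 1 makes the exponent of the weight strictly convex.

The pointwise arguments need H^p(Ω) ⊂ C² on the closed cube. Elements are approximated by smooth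
jets through dilation and convolution (`exists_jet_approx`), a Sobolev inequality for jets comes
from averaging along segments (`exists_enorm_jet_le`), and uniform limits give the representatives
(`exists_isRep`). The boundary conditions then become pointwise, H₀ is closed, and the Riesz theorem
yields the gradient.

A minimizer v with ‖v‖ < M is critical along H₀ (`DJ_eq_zero_of_isMinOn`). The radius M/3 keeps the
iterates in the ball of radius M, as ‖u_k‖ ≤ ‖u₀ − v‖ + ‖v‖ < M. To make κ₀ independent of F, λ₀ is
taken above the C² bound of F, so that λ itself can serve as that bound in L. -/

noncomputable section

namespace Convexification

/-! ### Geometry of the cube -/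

theorem cube_eq_preimage (n : ℕ) (R : ℝ) :
    cube n R = EuclideanSpace.equiv (Fin (n + 1)) ℝ ⁻¹' (Set.pi univ fun _ => Ioo (-R) R) := by
  ext x; simp [cube, EuclideanSpace.equiv]

theorem isOpen_cube (n : ℕ) (R : ℝ) : IsOpen (cube n R) := by
  rw [cube_eq_preimage]
  exact (isOpen_set_pi finite_univ fun _ _ => isOpen_Ioo).preimage
    (EuclideanSpace.equiv (Fin (n + 1)) ℝ).continuous

theorem convex_cube (n : ℕ) (R : ℝ) : Convex ℝ (cube n R) := by
  rw [cube_eq_preimage]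
  exact (convex_pi fun _ _ => convex_Ioo _ _).linear_preimage
    (EuclideanSpace.equiv (Fin (n + 1)) ℝ).toLinearEquiv.toLinearMap

theorem mem_closure_cube {n : ℕ} {R : ℝ} (hR : 0 < R) {x : E n} :
    x ∈ closure (cube n R) ↔ ∀ i, x i ∈ Icc (-R) R := by
  have := (EuclideanSpace.equiv (Fin (n + 1)) ℝ).toHomeomorph.preimage_closure
    (Set.pi univ fun _ => Ioo (-R) R)
  rw [cube_eq_preimage]
  change x ∈ closure ((EuclideanSpace.equiv (Fin (n + 1)) ℝ).toHomeomorph ⁻¹' _) ↔ _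
  rw [← this, closure_pi_set]
  simp only [mem_preimage, mem_univ_pi]
  rw [closure_Ioo (by linarith)]
  rfl

theorem isCompact_closure_cube (n : ℕ) (R : ℝ) : IsCompact (closure (cube n R)) := by
  rw [cube_eq_preimage]
  have : IsCompact (EuclideanSpace.equiv (Fin (n + 1)) ℝ ⁻¹'
      (Set.pi univ fun _ => Icc (-R) R)) :=
    (EuclideanSpace.equiv (Fin (n + 1)) ℝ).toHomeomorph.isCompact_preimage.2
      (isCompact_univ_pi fun _ => isCompact_Icc)
  exact this.closure_of_subset (preimage_mono (pi_mono fun _ _ => Ioo_subset_Icc_self))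

theorem convex_closure_cube (n : ℕ) (R : ℝ) : Convex ℝ (closure (cube n R)) :=
  (convex_cube n R).closure

theorem zero_mem_cube (n : ℕ) {R : ℝ} (hR : 0 < R) : (0 : E n) ∈ cube n R := by
  intro i; simp [hR]

theorem uniqueDiffOn_closure_cube (n : ℕ) {R : ℝ} (hR : 0 < R) :
    UniqueDiffOn ℝ (closure (cube n R)) :=
  uniqueDiffOn_convex (convex_closure_cube n R)
    ⟨0, interior_mono subset_closure ((isOpen_cube n R).interior_eq.symm ▸ zero_mem_cube n hR)⟩

theorem measurableSet_cube (n : ℕ) (R : ℝ) : MeasurableSet (cube n R) :=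
  (isOpen_cube n R).measurableSet

theorem volume_cube_lt_top (n : ℕ) (R : ℝ) : volume (cube n R) < ⊤ :=
  (measure_mono subset_closure).trans_lt (isCompact_closure_cube n R).measure_lt_top

instance isFiniteMeasure_cubeMeasure (n : ℕ) (R : ℝ) : IsFiniteMeasure (cubeMeasure n R) :=
  ⟨by rw [Measure.restrict_apply_univ]; exact volume_cube_lt_top n R⟩

theorem volume_cube_ne_zero (n : ℕ) {R : ℝ} (hR : 0 < R) : volume (cube n R) ≠ 0 :=
  ((isOpen_cube n R).measure_pos volume ⟨0, zero_mem_cube n hR⟩).ne'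

theorem segment_mem_cube {n : ℕ} {R : ℝ} {x y : E n} (hx : x ∈ closure (cube n R))
    (hy : y ∈ cube n R) {s : ℝ} (hs : s ∈ Ioc (0 : ℝ) 1) : x + s • (y - x) ∈ cube n R := by
  have := (convex_cube n R).add_smul_sub_mem_interior' hx
    ((isOpen_cube n R).interior_eq.symm ▸ hy) hs
  rwa [(isOpen_cube n R).interior_eq] at this

theorem segment_mem_closure_cube {n : ℕ} {R : ℝ} {x y : E n} (hx : x ∈ closure (cube n R))
    (hy : y ∈ closure (cube n R)) {s : ℝ} (hs : s ∈ Icc (0 : ℝ) 1) :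
    x + s • (y - x) ∈ closure (cube n R) :=
  (convex_closure_cube n R).add_smul_sub_mem hx hy hs

/-- A continuous linear functional is determined by the standard basis. -/
theorem clm_apply_eq_sum {n : ℕ} (L : E n →L[ℝ] ℝ) (v : E n) :
    L v = ∑ i, v i * L (EuclideanSpace.single i 1) := by
  conv_lhs => rw [← (EuclideanSpace.basisFun (Fin (n + 1)) ℝ).sum_repr v]
  simp

/-! ### A Sobolev inequality for smooth jets -/

/-- The integral of `|f|` over the cube shrunk towards `x` by the factor `s`. -/
def segMean {n : ℕ} (R : ℝ) (f : E n → ℝ) (x : E n) (s : ℝ) : ENNReal :=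
  ∫⁻ y in cube n R, ‖f (x + s • (y - x))‖ₑ

/-- Convexity keeps the contracted cube inside Ω, so only the Jacobian s^(n+1) of the contraction
enters. -/
theorem map_segment_le {n : ℕ} {R : ℝ} {x : E n} (hx : x ∈ closure (cube n R)) {s : ℝ}
    (hs : s ∈ Ioc (0 : ℝ) 1) :
    (cubeMeasure n R).map (fun y => x + s • (y - x))
      ≤ ENNReal.ofReal (s ^ (-((n : ℝ) + 1))) • cubeMeasure n R := by
  have hT : Measurable fun y : E n => x + s • (y - x) := by fun_prop
  refine Measure.le_iff.2 fun A hA => ?_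
  rw [Measure.map_apply hT hA, Measure.restrict_apply (hT hA), Measure.smul_apply,
    Measure.restrict_apply hA]
  have h1 : (fun y : E n => x + s • (y - x)) ⁻¹' A ∩ cube n R ⊆
      (fun y => s • y) ⁻¹' ((fun y => y + (x - s • x)) ⁻¹' (A ∩ cube n R)) := by
    rintro y ⟨hyA, hy⟩
    have h2 : s • y + (x - s • x) = x + s • (y - x) := by rw [smul_sub]; abel
    simp only [mem_preimage, h2]
    exact ⟨hyA, segment_mem_cube hx hy hs⟩
  refine (measure_mono h1).trans ?_
  rw [Measure.addHaar_preimage_smul _ hs.1.ne', measure_preimage_add_right, smul_eq_mul]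
  gcongr
  rw [abs_of_nonneg (by have := hs.1.le; positivity), Real.rpow_neg hs.1.le]
  simp only [finrank_euclideanSpace, Fintype.card_fin]
  rw [← Real.rpow_natCast]
  push_cast
  rfl

/-- Cauchy–Schwarz on Ω passes from L¹ to L², and the square root of the Jacobian factor leaves half
the dimension as the singularity at s = 0. -/
theorem segMean_le_eLpNorm {n : ℕ} {R : ℝ} {f : E n → ℝ} (hf : Continuous f) {x : E n}
    (hx : x ∈ closure (cube n R)) {s : ℝ} (hs : s ∈ Ioc (0 : ℝ) 1) :
    segMean R f x s ≤ volume (cube n R) ^ (1 / 2 : ℝ) *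
      ENNReal.ofReal (s ^ (-(((n : ℝ) + 1) / 2))) * eLpNorm f 2 (cubeMeasure n R) := by
  have hT : Measurable fun y : E n => x + s • (y - x) := by fun_prop
  have h1 : segMean R f x s = eLpNorm (f ∘ fun y => x + s • (y - x)) 1 (cubeMeasure n R) := by
    rw [eLpNorm_one_eq_lintegral_enorm]; rfl
  rw [h1]
  refine (eLpNorm_le_eLpNorm_mul_rpow_measure_univ (q := 2) (by norm_num)
    (hf.comp_aestronglyMeasurable (by fun_prop))).trans ?_
  change eLpNorm (f ∘ fun y => x + s • (y - x)) 2 _ * _ ≤ _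
  rw [← eLpNorm_map_measure hf.aestronglyMeasurable hT.aemeasurable, Measure.restrict_apply_univ]
  have h2 : eLpNorm f 2 ((cubeMeasure n R).map fun y => x + s • (y - x)) ≤
      ENNReal.ofReal (s ^ (-(((n : ℝ) + 1) / 2))) * eLpNorm f 2 (cubeMeasure n R) := by
    refine (eLpNorm_mono_measure _ (map_segment_le hx hs)).trans ?_
    rw [eLpNorm_smul_measure_of_ne_top (by norm_num)]
    rw [ENNReal.ofReal_rpow_of_nonneg (by have := hs.1.le; positivity) (by norm_num),
      ← Real.rpow_mul hs.1.le, smul_eq_mul]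
    refine mul_le_mul' (le_of_eq ?_) le_rfl
    congr 2
    rw [ENNReal.toReal_div, ENNReal.toReal_one, ENNReal.toReal_ofNat]
    ring
  calc _ ≤ (ENNReal.ofReal (s ^ (-(((n : ℝ) + 1) / 2))) * eLpNorm f 2 (cubeMeasure n R)) *
        volume (cube n R) ^ (1 / 2 : ℝ) := by
        refine mul_le_mul' h2 (le_of_eq ?_)
        congr 1
        rw [ENNReal.toReal_one, ENNReal.toReal_ofNat]
        norm_num
    _ = _ := by ring

/-- Fundamental theorem of calculus along the segment from parameter t to 1; the components of y − x
are at most the side length 2R. -/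
theorem enorm_segment_le {n : ℕ} {R : ℝ} (hR : 0 < R) {f : E n → ℝ}
    {g : Fin (n + 1) → E n → ℝ} (hf : ContDiff ℝ 1 f)
    (hfg : ∀ i, ∀ z ∈ closure (cube n R), fderiv ℝ f z (EuclideanSpace.single i 1) = g i z)
    {x : E n} (hx : x ∈ closure (cube n R)) {t : ℝ} (ht : t ∈ Icc (0 : ℝ) 1)
    {y : E n} (hy : y ∈ cube n R) :
    ‖f (x + t • (y - x))‖ₑ ≤ ‖f (x + (1 : ℝ) • (y - x))‖ₑ +
      ∫⁻ s in Ioc t 1, ENNReal.ofReal (2 * R) * ∑ i, ‖g i (x + s • (y - x))‖ₑ := by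
  have hd : ∀ s ∈ uIcc t 1, HasDerivAt (fun s : ℝ => f (x + s • (y - x)))
      (fderiv ℝ f (x + s • (y - x)) (y - x)) s := by
    intro s _
    have h1 : HasDerivAt (fun s : ℝ => x + s • (y - x)) (y - x) s := by
      simpa using ((hasDerivAt_id s).smul_const (y - x)).const_add x
    exact ((hf.differentiable (by norm_num)) _).hasFDerivAt.comp_hasDerivAt s h1
  have hc : Continuous fun s : ℝ => fderiv ℝ f (x + s • (y - x)) (y - x) :=
    ((hf.continuous_fderiv (by norm_num)).comp (by fun_prop)).clm_apply continuous_const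
  have hftc := intervalIntegral.integral_eq_sub_of_hasDerivAt hd (hc.intervalIntegrable _ _)
  have h2 : f (x + t • (y - x)) = f (x + (1 : ℝ) • (y - x)) -
      ∫ s in t..1, fderiv ℝ f (x + s • (y - x)) (y - x) := by
    rw [hftc, sub_sub_cancel]
  rw [h2]
  refine (enorm_sub_le).trans (add_le_add le_rfl ?_)
  rw [intervalIntegral.integral_of_le ht.2]
  refine (enorm_integral_le_lintegral_enorm _).trans ?_
  refine setLIntegral_mono' measurableSet_Ioc fun s hs => ?_
  have hmem := segment_mem_closure_cube hx (subset_closure hy)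
    (s := s) ⟨ht.1.trans hs.1.le, hs.2⟩
  rw [clm_apply_eq_sum, Finset.mul_sum]
  refine (enorm_sum_le _ _).trans (Finset.sum_le_sum fun i _ => ?_)
  rw [hfg i _ hmem, enorm_mul]
  refine mul_le_mul' ?_ le_rfl
  rw [Real.enorm_eq_ofReal_abs]
  apply ENNReal.ofReal_le_ofReal
  have h3 := (mem_closure_cube hR).1 hx i
  have h4 := hy i
  rw [PiLp.sub_apply, abs_le]
  constructor <;> linarith [h3.1, h3.2, h4.1, h4.2]

/-- Integrating over y and exchanging the integrals trades the average at t for averages of first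
derivatives integrated in s, which gains one power of s. -/
theorem segMean_le_segMean_one_add {n : ℕ} {R : ℝ} (hR : 0 < R) {f : E n → ℝ}
    {g : Fin (n + 1) → E n → ℝ} (hf : ContDiff ℝ 1 f) (hg : ∀ i, Continuous (g i))
    (hfg : ∀ i, ∀ z ∈ closure (cube n R), fderiv ℝ f z (EuclideanSpace.single i 1) = g i z)
    {x : E n} (hx : x ∈ closure (cube n R)) {t : ℝ} (ht : t ∈ Icc (0 : ℝ) 1) :
    segMean R f x t ≤ segMean R f x 1 +
      ENNReal.ofReal (2 * R) * ∫⁻ s in Ioc t 1, ∑ i, segMean R (g i) x s := by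
  have hmeas : ∀ i, Measurable fun q : E n × ℝ => ‖g i (x + q.2 • (q.1 - x))‖ₑ := fun i =>
    ((hg i).comp (by fun_prop : Continuous fun q : E n × ℝ => x + q.2 • (q.1 - x))).enorm.measurable
  have hmf : Measurable fun y : E n => ‖f (x + (1 : ℝ) • (y - x))‖ₑ :=
    (hf.continuous.comp (by fun_prop : Continuous fun y : E n => x + (1 : ℝ) • (y - x))).enorm.measurable
  calc segMean R f x t ≤ ∫⁻ y in cube n R, (‖f (x + (1 : ℝ) • (y - x))‖ₑ +
        ∫⁻ s in Ioc t 1, ENNReal.ofReal (2 * R) * ∑ i, ‖g i (x + s • (y - x))‖ₑ) :=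
        setLIntegral_mono' (measurableSet_cube n R) fun y hy => enorm_segment_le hR hf hfg hx ht hy
    _ = segMean R f x 1 + ∫⁻ y in cube n R, ∫⁻ s in Ioc t 1,
          ENNReal.ofReal (2 * R) * ∑ i, ‖g i (x + s • (y - x))‖ₑ := lintegral_add_left hmf _
    _ = segMean R f x 1 + ∫⁻ s in Ioc t 1, ∫⁻ y in cube n R,
          ENNReal.ofReal (2 * R) * ∑ i, ‖g i (x + s • (y - x))‖ₑ := by
        rw [lintegral_lintegral_swap]
        exact ((Finset.measurable_fun_sum _ fun i _ => hmeas i).const_mul _).aemeasurable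
    _ = _ := by
        rw [← lintegral_const_mul' _ _ ENNReal.ofReal_ne_top]
        congr 1
        refine lintegral_congr fun s => ?_
        rw [lintegral_const_mul' _ _ ENNReal.ofReal_ne_top, lintegral_finsetSum]
        · rfl
        · intro i _
          exact (hmeas i).comp measurable_prodMk_right

theorem lintegral_rpow_le {a t : ℝ} (ha : a < -1) (ht : t ∈ Ioc (0 : ℝ) 1) :
    ∫⁻ s in Ioc t 1, ENNReal.ofReal (s ^ a) ≤ ENNReal.ofReal (t ^ (a + 1) / (-(a + 1))) := by
  have h0 : ∀ s ∈ Ioc t 1, 0 ≤ s ^ a := fun s hs => Real.rpow_nonneg (ht.1.trans hs.1).le _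
  have hnm : (0 : ℝ) ∉ uIcc t 1 := by
    rw [uIcc_of_le ht.2]; exact fun h => absurd h.1 (not_le.2 ht.1)
  have hint : IntegrableOn (fun s : ℝ => s ^ a) (Ioc t 1) :=
    (intervalIntegrable_iff_integrableOn_Ioc_of_le ht.2).1
      (intervalIntegral.intervalIntegrable_rpow (Or.inr hnm))
  rw [← ofReal_integral_eq_lintegral_ofReal hint
    ((ae_restrict_iff' measurableSet_Ioc).2 (Filter.Eventually.of_forall h0)),
    ← intervalIntegral.integral_of_le ht.2, integral_rpow (Or.inr ⟨ha.ne, hnm⟩)]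
  apply ENNReal.ofReal_le_ofReal
  have : a + 1 < 0 := by linarith
  rw [Real.one_rpow, ← neg_div_neg_eq]
  gcongr
  · linarith
  · linarith

theorem lintegral_rpow_neg_half : ∫⁻ s in Ioc (0 : ℝ) 1, ENNReal.ofReal (s ^ (-(1 / 2) : ℝ)) = 2 := by
  have hint : IntegrableOn (fun s : ℝ => s ^ (-(1 / 2) : ℝ)) (Ioc 0 1) :=
    (intervalIntegrable_iff_integrableOn_Ioc_of_le zero_le_one).1
      (intervalIntegral.intervalIntegrable_rpow' (by norm_num))
  rw [← ofReal_integral_eq_lintegral_ofReal hint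
    ((ae_restrict_iff' measurableSet_Ioc).2 (Filter.Eventually.of_forall fun s hs =>
      Real.rpow_nonneg hs.1.le _)),
    ← intervalIntegral.integral_of_le zero_le_one, integral_rpow (Or.inl (by norm_num))]
  norm_num

/-- A family `(f_α)_{|α| ≤ p}` of `C¹` functions with `∂_i f_α = f_{α + e_i}` on the closed cube. -/
structure IsJet (n p : ℕ) (R : ℝ) (f : (Fin (n + 1) → ℕ) → E n → ℝ) : Prop where
  smooth : ∀ α, ContDiff ℝ 1 (f α)
  deriv_eq : ∀ α, ∑ i, α i + 1 ≤ p → ∀ i, ∀ x ∈ closure (cube n R),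
    fderiv ℝ (f α) x (EuclideanSpace.single i 1) = f (α + Pi.single i 1) x

theorem IsJet.sub {n p : ℕ} {R : ℝ} {f g : (Fin (n + 1) → ℕ) → E n → ℝ} (hf : IsJet n p R f)
    (hg : IsJet n p R g) : IsJet n p R (fun α x => f α x - g α x) where
  smooth α := (hf.smooth α).sub (hg.smooth α)
  deriv_eq α hα i x hx := by
    rw [fderiv_fun_sub ((hf.smooth α).differentiable (by norm_num) x)
      ((hg.smooth α).differentiable (by norm_num) x)]
    rw [sub_apply, hf.deriv_eq α hα i x hx, hg.deriv_eq α hα i x hx]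

/-- The sum of the `L²(Ω)` norms of the members of a jet. -/
def jetNorm (n p : ℕ) (R : ℝ) (f : (Fin (n + 1) → ℕ) → E n → ℝ) : ENNReal :=
  ∑ α ∈ multiIdx n p, eLpNorm (f α) 2 (cubeMeasure n R)

theorem sum_add_single {n : ℕ} (α : Fin (n + 1) → ℕ) (i : Fin (n + 1)) :
    ∑ j, (α + Pi.single i 1 : Fin (n + 1) → ℕ) j = ∑ j, α j + 1 := by
  simp [Finset.sum_add_distrib]

/-- The exponent (n+1)/2 is weakened to D + 1/2 so that the induction on derivatives meets only
half-integer exponents and never the logarithm of ∫ ds/s. -/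
theorem segMean_jet_zero {n p D : ℕ} {R : ℝ} (hD : ((n : ℝ) + 1) / 2 ≤ D)
    {f : (Fin (n + 1) → ℕ) → E n → ℝ} (hf : IsJet n p R f) {α : Fin (n + 1) → ℕ}
    (hα : ∑ i, α i ≤ p) {x : E n} (hx : x ∈ closure (cube n R)) {s : ℝ}
    (hs : s ∈ Ioc (0 : ℝ) 1) :
    segMean R (f α) x s ≤ volume (cube n R) ^ (1 / 2 : ℝ) *
      ENNReal.ofReal (s ^ (-((D : ℝ) + 1 / 2))) * jetNorm n p R f := by
  refine (segMean_le_eLpNorm (hf.smooth α).continuous hx hs).trans ?_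
  refine mul_le_mul' (mul_le_mul_right (ENNReal.ofReal_le_ofReal
      (Real.rpow_le_rpow_of_exponent_ge hs.1 hs.2 (by linarith))) _) ?_
  · exact Finset.single_le_sum (f := fun α => eLpNorm (f α) 2 (cubeMeasure n R))
      (fun _ _ => zero_le) (mem_multiIdx.2 hα)

/-- Each available derivative lowers the exponent by one; at j = D it is 1/2, which is integrable at
0. -/
theorem exists_segMean_le {n p D : ℕ} {R : ℝ} (hR : 0 < R) (hD : ((n : ℝ) + 1) / 2 ≤ D) (j : ℕ) :
    j ≤ D → ∃ C : NNReal, ∀ f : (Fin (n + 1) → ℕ) → E n → ℝ, IsJet n p R f →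
      ∀ α : Fin (n + 1) → ℕ, ∑ i, α i + j ≤ p → ∀ x ∈ closure (cube n R),
        ∀ s ∈ Ioc (0 : ℝ) 1, segMean R (f α) x s ≤
          C * ENNReal.ofReal (s ^ (-((D : ℝ) - j + 1 / 2))) * jetNorm n p R f := by
  have hV : volume (cube n R) ^ (1 / 2 : ℝ) ≠ ⊤ :=
    ENNReal.rpow_ne_top_of_nonneg (by norm_num) (volume_cube_lt_top n R).ne
  induction j with
  | zero =>
    intro _
    refine ⟨(volume (cube n R) ^ (1 / 2 : ℝ)).toNNReal, fun f hf α hα x hx s hs => ?_⟩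
    rw [ENNReal.coe_toNNReal hV]
    simpa using segMean_jet_zero hD hf (by simpa using hα) hx hs
  | succ j ih =>
    intro hj
    obtain ⟨C, hC⟩ := ih (by omega)
    have hjD : (j : ℝ) + 1 ≤ D := by exact_mod_cast hj
    set V := (volume (cube n R) ^ (1 / 2 : ℝ)).toNNReal with hVdef
    refine ⟨V + (2 * R).toNNReal * ((n + 1) * (C * 2)), fun f hf α hα x hx t ht => ?_⟩
    set N := jetNorm n p R f
    set σ : ℝ := (D : ℝ) - ↑(j + 1) + 1 / 2 with hσ
    have hσ' : σ = D - j - 1 + 1 / 2 := by rw [hσ]; push_cast; ring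
    have h1 := segMean_le_segMean_one_add hR (hf.smooth α)
      (fun i => (hf.smooth (α + Pi.single i 1)).continuous)
      (fun i z hz => hf.deriv_eq α (by omega) i z hz) hx ⟨ht.1.le, ht.2⟩
    refine h1.trans ?_
    have hone : (1 : ENNReal) ≤ ENNReal.ofReal (t ^ (-σ)) := by
      rw [← ENNReal.ofReal_one]
      exact ENNReal.ofReal_le_ofReal
        (Real.one_le_rpow_of_pos_of_le_one_of_nonpos ht.1 ht.2 (by linarith))
    have h2 : segMean R (f α) x 1 ≤ V * ENNReal.ofReal (t ^ (-σ)) * N := by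
      refine (segMean_jet_zero hD hf (by omega) hx ⟨one_pos, le_rfl⟩).trans ?_
      rw [Real.one_rpow, ENNReal.ofReal_one, hVdef, ENNReal.coe_toNNReal hV]
      gcongr
    have h3 : ∫⁻ s in Ioc t 1, ∑ i, segMean R (f (α + Pi.single i 1)) x s ≤
        (n + 1) * (C * 2) * ENNReal.ofReal (t ^ (-σ)) * N := by
      calc _ ≤ ∫⁻ s in Ioc t 1, ((n + 1) * C * N) *
            ENNReal.ofReal (s ^ (-((D : ℝ) - j + 1 / 2))) := by
            refine setLIntegral_mono' measurableSet_Ioc fun s hs => ?_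
            calc _ ≤ ∑ _i : Fin (n + 1), C *
                  ENNReal.ofReal (s ^ (-((D : ℝ) - j + 1 / 2))) * N :=
                  Finset.sum_le_sum fun i _ => hC f hf _ (by rw [sum_add_single]; omega) x hx s
                    ⟨ht.1.trans hs.1, hs.2⟩
              _ = _ := by
                  rw [Finset.sum_const, Finset.card_univ, Fintype.card_fin, nsmul_eq_mul]
                  push_cast; ring
        _ = ((n + 1) * C * N) *
            ∫⁻ s in Ioc t 1, ENNReal.ofReal (s ^ (-((D : ℝ) - j + 1 / 2))) := by
            rw [lintegral_const_mul]
            fun_prop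
        _ ≤ ((n + 1) * C * N) * (2 * ENNReal.ofReal (t ^ (-σ))) := by
            gcongr
            refine (lintegral_rpow_le (by linarith) ht).trans ?_
            rw [show (2 : ENNReal) = ENNReal.ofReal 2 by simp,
              ← ENNReal.ofReal_mul (by norm_num)]
            apply ENNReal.ofReal_le_ofReal
            have h5 : -((D : ℝ) - j + 1 / 2) + 1 = -σ := by rw [hσ']; ring
            -- The factor 2 bounds 1/σ: from j + 1 ≤ D one has σ ≥ 1/2.
            rw [h5, neg_neg, div_le_iff₀ (by linarith)]
            nlinarith [Real.rpow_nonneg ht.1.le (-σ)]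
        _ = _ := by ring
    calc _ ≤ V * ENNReal.ofReal (t ^ (-σ)) * N + ENNReal.ofReal (2 * R) *
          ((n + 1) * (C * 2) * ENNReal.ofReal (t ^ (-σ)) * N) := by gcongr
      _ = _ := by
          push_cast
          rw [show ENNReal.ofReal (2 * R) = ((2 * R).toNNReal : ENNReal) from rfl]
          ring

/-- **Sobolev inequality** on the cube, for smooth jets. -/
theorem exists_enorm_jet_le {n p D : ℕ} {R : ℝ} (hR : 0 < R) (hD : ((n : ℝ) + 1) / 2 ≤ D) :
    ∃ C : NNReal, ∀ f : (Fin (n + 1) → ℕ) → E n → ℝ, IsJet n p R f →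
      ∀ α : Fin (n + 1) → ℕ, ∑ i, α i + (D + 1) ≤ p → ∀ x ∈ closure (cube n R),
        ‖f α x‖ₑ ≤ C * jetNorm n p R f := by
  obtain ⟨C, hC⟩ := exists_segMean_le (p := p) hR hD D le_rfl
  have hV : volume (cube n R) ^ (1 / 2 : ℝ) ≠ ⊤ :=
    ENNReal.rpow_ne_top_of_nonneg (by norm_num) (volume_cube_lt_top n R).ne
  have hV0 := volume_cube_ne_zero n hR
  have hVt := (volume_cube_lt_top n R).ne
  set V := (volume (cube n R) ^ (1 / 2 : ℝ)).toNNReal with hVdef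
  refine ⟨(volume (cube n R)).toNNReal⁻¹ * (V + (2 * R).toNNReal * ((n + 1) * (C * 2))),
    fun f hf α hα x hx => ?_⟩
  set N := jetNorm n p R f
  -- The last of the D + 1 derivatives: with exponent 1/2 one may start at t = 0, where the average
  -- is |Ω| |f(x)|.
  have h1 := segMean_le_segMean_one_add hR (hf.smooth α)
    (fun i => (hf.smooth (α + Pi.single i 1)).continuous)
    (fun i z hz => hf.deriv_eq α (by omega) i z hz) hx (t := 0) ⟨le_rfl, zero_le_one⟩
  have h0 : segMean R (f α) x 0 = volume (cube n R) * ‖f α x‖ₑ := by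
    simp [segMean, mul_comm]
  have h2 : segMean R (f α) x 1 ≤ V * N := by
    refine (segMean_jet_zero hD hf (by omega) hx ⟨one_pos, le_rfl⟩).trans ?_
    rw [Real.one_rpow, ENNReal.ofReal_one, hVdef, ENNReal.coe_toNNReal hV, mul_one]
  have h3 : ∫⁻ s in Ioc (0 : ℝ) 1, ∑ i, segMean R (f (α + Pi.single i 1)) x s ≤
      (n + 1) * (C * 2) * N := by
    calc _ ≤ ∫⁻ s in Ioc (0 : ℝ) 1, ((n + 1) * C * N) * ENNReal.ofReal (s ^ (-(1 / 2) : ℝ)) := by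
          refine setLIntegral_mono' measurableSet_Ioc fun s hs => ?_
          calc _ ≤ ∑ _i : Fin (n + 1), C * ENNReal.ofReal (s ^ (-(1 / 2) : ℝ)) * N :=
                Finset.sum_le_sum fun i _ => by
                  simpa using hC f hf (α + Pi.single i 1) (by rw [sum_add_single]; omega) x hx s hs
            _ = _ := by
                rw [Finset.sum_const, Finset.card_univ, Fintype.card_fin, nsmul_eq_mul]
                push_cast; ring
      _ = ((n + 1) * C * N) * 2 := by
          rw [lintegral_const_mul _ (by fun_prop), lintegral_rpow_neg_half]
      _ = _ := by ring
  have h4 : volume (cube n R) * ‖f α x‖ₑ ≤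
      (V + (2 * R).toNNReal * ((n + 1) * (C * 2)) : NNReal) * N := by
    rw [← h0]
    refine h1.trans ?_
    calc _ ≤ V * N + ENNReal.ofReal (2 * R) * ((n + 1) * (C * 2) * N) := by gcongr
      _ = _ := by
          push_cast
          rw [show ENNReal.ofReal (2 * R) = ((2 * R).toNNReal : ENNReal) from rfl]
          ring
  have h5 : ‖f α x‖ₑ = (volume (cube n R))⁻¹ * (volume (cube n R) * ‖f α x‖ₑ) := by
    rw [← mul_assoc, ENNReal.inv_mul_cancel hV0 hVt, one_mul]
  rw [h5, ENNReal.coe_mul, ENNReal.coe_inv (by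
    rw [Ne, ENNReal.toNNReal_eq_zero_iff]; tauto), ENNReal.coe_toNNReal hVt, mul_assoc]
  gcongr

/-! ### Iterated partial derivatives and weak derivatives -/

theorem partialD_comm {n : ℕ} (i j : Fin (n + 1)) {φ : E n → ℝ} (h : ContDiff ℝ ∞ φ) :
    partialD i (partialD j φ) = partialD j (partialD i φ) := by
  have key : ∀ (i j : Fin (n + 1)) (x : E n), partialD i (partialD j φ) x =
      fderiv ℝ (fderiv ℝ φ) x (EuclideanSpace.single i 1) (EuclideanSpace.single j 1) := by
    intro i j x
    have hd : DifferentiableAt ℝ (fderiv ℝ φ) x :=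
      ((h.fderiv_right (m := ∞) (by simp)).differentiable (by simp)) x
    unfold partialD
    rw [fderiv_clm_apply hd (differentiableAt_const _)]
    simp
  funext x
  rw [key, key]
  exact (h.contDiffAt.isSymmSndFDerivAt (by
    rw [minSmoothness_of_isRCLikeNormedField]
    exact WithTop.coe_le_coe.2 le_top)) _ _

theorem partialD_iterate_comm {n : ℕ} (i j : Fin (n + 1)) (k : ℕ) {φ : E n → ℝ}
    (h : ContDiff ℝ ∞ φ ∧ HasCompactSupport φ) :
    (partialD i)^[k] (partialD j φ) = partialD j ((partialD i)^[k] φ) := by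
  induction k generalizing φ with
  | zero => rfl
  | succ k ih =>
    rw [Function.iterate_succ_apply, Function.iterate_succ_apply, partialD_comm i j h.1,
      ih (smooth_partialD i h)]

theorem smooth_partialD_iterate {n : ℕ} (i : Fin (n + 1)) (k : ℕ) {φ : E n → ℝ}
    (h : ContDiff ℝ ∞ φ ∧ HasCompactSupport φ) :
    ContDiff ℝ ∞ ((partialD i)^[k] φ) ∧ HasCompactSupport ((partialD i)^[k] φ) := by
  induction k generalizing φ with
  | zero => exact h
  | succ k ih => exact ih (smooth_partialD i h)

theorem smooth_foldr_partialD {n : ℕ} (α : Fin (n + 1) → ℕ) (l : List (Fin (n + 1))) {φ : E n → ℝ}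
    (h : ContDiff ℝ ∞ φ ∧ HasCompactSupport φ) :
    ContDiff ℝ ∞ (l.foldr (fun i ψ => (partialD i)^[α i] ψ) φ) ∧
      HasCompactSupport (l.foldr (fun i ψ => (partialD i)^[α i] ψ) φ) := by
  induction l with
  | nil => exact h
  | cons i l ih => exact smooth_partialD_iterate i (α i) ih

theorem foldr_partialD_comm {n : ℕ} (α : Fin (n + 1) → ℕ) (j : Fin (n + 1))
    (l : List (Fin (n + 1))) {φ : E n → ℝ} (h : ContDiff ℝ ∞ φ ∧ HasCompactSupport φ) :
    l.foldr (fun i ψ => (partialD i)^[α i] ψ) (partialD j φ) =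
      partialD j (l.foldr (fun i ψ => (partialD i)^[α i] ψ) φ) := by
  induction l with
  | nil => rfl
  | cons i l ih =>
    rw [List.foldr_cons, List.foldr_cons, ih,
      partialD_iterate_comm _ _ _ (smooth_foldr_partialD α l h)]

/-- In a list without repetition j occurs at most once, so raising its exponent adds one derivative
there, which commutes to the front. -/
theorem foldr_partialD_add_single {n : ℕ} (α : Fin (n + 1) → ℕ) (j : Fin (n + 1))
    (l : List (Fin (n + 1))) (hl : l.Nodup) {φ : E n → ℝ}
    (h : ContDiff ℝ ∞ φ ∧ HasCompactSupport φ) :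
    l.foldr (fun i ψ => (partialD i)^[(α + Pi.single j 1 : Fin (n + 1) → ℕ) i] ψ) φ =
      if j ∈ l then partialD j (l.foldr (fun i ψ => (partialD i)^[α i] ψ) φ)
      else l.foldr (fun i ψ => (partialD i)^[α i] ψ) φ := by
  induction l with
  | nil => simp
  | cons i l ih =>
    rw [List.nodup_cons] at hl
    rw [List.foldr_cons, List.foldr_cons, ih hl.2]
    by_cases hij : i = j
    · subst hij
      simp only [hl.1, if_false, List.mem_cons, true_or, if_true, Pi.add_apply, Pi.single_eq_same]
      rw [Function.iterate_succ_apply']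
    · have h1 : (α + Pi.single j 1 : Fin (n + 1) → ℕ) i = α i := by
        simp [Pi.single_eq_of_ne hij]
      rw [h1]
      by_cases hjl : j ∈ l
      · simp only [hjl, if_true, List.mem_cons, or_true]
        rw [partialD_iterate_comm _ _ _ (smooth_foldr_partialD α l h)]
      · have : j ≠ i := fun h => hij h.symm
        simp [hjl, this]

theorem iterPartial_add_single {n : ℕ} (α : Fin (n + 1) → ℕ) (j : Fin (n + 1)) {φ : E n → ℝ}
    (h : ContDiff ℝ ∞ φ ∧ HasCompactSupport φ) :
    iterPartial (α + Pi.single j 1) φ = iterPartial α (partialD j φ) := by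
  unfold iterPartial
  rw [foldr_partialD_add_single α j _ (List.nodup_finRange _) h, foldr_partialD_comm α j _ h]
  simp

theorem IsTest.partialD {n : ℕ} {R : ℝ} {φ : E n → ℝ} (h : IsTest n R φ) (i : Fin (n + 1)) :
    IsTest n R (partialD i φ) where
  smooth := (smooth_partialD i ⟨h.smooth, h.compact⟩).1
  compact := (smooth_partialD i ⟨h.smooth, h.compact⟩).2
  supp := (tsupport_fderiv_apply_subset ℝ (EuclideanSpace.single i (1 : ℝ))).trans h.supp

theorem wD_eq {n p : ℕ} {R : ℝ} {α : Fin (n + 1) → ℕ} (hα : ∑ i, α i ≤ p) (u : Hp n p R) :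
    wD α u = (u : JetSpace n p R) ⟨α, mem_multiIdx.2 hα⟩ := by
  rw [wD, dif_pos (mem_multiIdx.2 hα)]

theorem measurable_wD {n p : ℕ} {R : ℝ} (α : Fin (n + 1) → ℕ) (u : Hp n p R) :
    Measurable (wD α u) := by
  unfold wD
  split_ifs
  · exact (Lp.stronglyMeasurable _).measurable
  · exact measurable_const

theorem memLp_wD {n p : ℕ} {R : ℝ} (α : Fin (n + 1) → ℕ) (u : Hp n p R) :
    MemLp (wD α u) 2 (cubeMeasure n R) := by
  unfold wD
  split_ifs
  · exact Lp.memLp _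
  · exact MemLp.zero

theorem integral_wD_mul_iterPartial {n p : ℕ} {R : ℝ} (u : Hp n p R) {α : Fin (n + 1) → ℕ}
    (hα : ∑ i, α i ≤ p) {φ : E n → ℝ} (hφ : IsTest n R φ) :
    ∫ x, wD 0 u x * iterPartial α φ x ∂(cubeMeasure n R) =
      (-1) ^ (∑ i, α i) * ∫ x, wD α u x * φ x ∂(cubeMeasure n R) := by
  rw [wD_eq hα, wD_eq (by simp)]
  exact u.2 ⟨α, mem_multiIdx.2 hα⟩ φ hφ

/-- `D^{α + e_i} u` is the weak `i`-th derivative of `D^α u`. -/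
theorem integral_wD_mul_partialD {n p : ℕ} {R : ℝ} (u : Hp n p R) {α : Fin (n + 1) → ℕ}
    (hα : ∑ i, α i + 1 ≤ p) (i : Fin (n + 1)) {φ : E n → ℝ} (hφ : IsTest n R φ) :
    ∫ x, wD α u x * partialD i φ x ∂(cubeMeasure n R) =
      -∫ x, wD (α + Pi.single i 1) u x * φ x ∂(cubeMeasure n R) := by
  -- The identity for α tested with ∂_i φ and the one for α + e_i tested with φ have the same left
  -- side; dividing by (−1)^|α| leaves one minus sign.
  have h1 := integral_wD_mul_iterPartial u (α := α) (by omega) (hφ.partialD i)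
  have h2 := integral_wD_mul_iterPartial u (α := α + Pi.single i 1)
    (by rw [sum_add_single]; exact hα) hφ
  rw [iterPartial_add_single α i ⟨hφ.smooth, hφ.compact⟩, h1, sum_add_single, pow_succ,
    mul_assoc] at h2
  simpa using mul_left_cancel₀ (pow_ne_zero _ (by norm_num)) h2

/-! ### Smoothing by dilation and convolution -/

/-- The convolution of `f 1_Ω` with `ψ`, dilated by the factor `t`. -/
def mol {n : ℕ} (R : ℝ) (ψ : E n → ℝ) (t : ℝ) (f : E n → ℝ) (x : E n) : ℝ :=
  ∫ y, f y * ψ (t • x - y) ∂(cubeMeasure n R)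

/-- Admissible kernels: the ball in which `ψ` lives fits between `tΩ` and the boundary of `Ω`. -/
structure IsMollifier (n : ℕ) (R t : ℝ) (ψ : E n → ℝ) : Prop where
  smooth : ContDiff ℝ ∞ ψ
  compact : HasCompactSupport ψ
  supp : tsupport ψ ⊆ Metric.closedBall 0 ((1 - t) * R / 2)
  nonneg : ∀ x, 0 ≤ ψ x
  integral_eq : ∫ x, ψ x = 1
  half_le : 1 / 2 ≤ t
  lt_one : t < 1

theorem exists_isMollifier (n : ℕ) {R t : ℝ} (hR : 0 < R) (h1 : 1 / 2 ≤ t) (h2 : t < 1) :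
    ∃ ψ, IsMollifier n R t ψ := by
  have hpos : 0 < (1 - t) * R / 2 := by have := sub_pos.2 h2; positivity
  let φ : ContDiffBump (0 : E n) := ⟨(1 - t) * R / 4, (1 - t) * R / 2, by linarith, by linarith⟩
  exact ⟨φ.normed volume, φ.contDiff_normed, φ.hasCompactSupport_normed,
    (φ.tsupport_normed_eq).le, φ.nonneg_normed, φ.integral_normed, h1, h2⟩

/-- The centre tx is at distance at least (1 − t)R from ∂Ω, twice the kernel radius. The kernel is
thus a test function even when x lies on the boundary, and no extension of u beyond Ω is needed. -/
theorem IsMollifier.isTest {n : ℕ} {R t : ℝ} {ψ : E n → ℝ} (hψ : IsMollifier n R t ψ)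
    (hR : 0 < R) {x : E n} (hx : x ∈ closure (cube n R)) :
    IsTest n R fun y => ψ (t • x - y) where
  smooth := hψ.smooth.comp (contDiff_const.sub contDiff_id)
  compact := hψ.compact.comp_homeomorph (Homeomorph.subLeft (t • x))
  supp := by
    intro y hy
    have h1 : t • x - y ∈ tsupport ψ :=
      tsupport_comp_subset_preimage ψ (f := fun y => t • x - y) (by fun_prop) hy
    have h2 := hψ.supp h1
    rw [mem_closedBall_zero_iff] at h2
    intro i
    have h3 := (PiLp.norm_apply_le (t • x - y) i).trans h2
    rw [PiLp.sub_apply, PiLp.smul_apply, smul_eq_mul, Real.norm_eq_abs, abs_le] at h3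
    have h4 := (mem_closure_cube hR).1 hx i
    have h5 := hψ.half_le
    have h6 := sub_pos.2 hψ.lt_one
    have h7 := mul_pos h6 hR
    constructor <;> nlinarith [h3.1, h3.2, h4.1, h4.2]

theorem mol_eq_convolution {n : ℕ} (R : ℝ) (ψ : E n → ℝ) (t : ℝ) (f : E n → ℝ) :
    mol R ψ t f = fun x => convolution ((cube n R).indicator f) ψ (ContinuousLinearMap.mul ℝ ℝ)
      volume (t • x) := by
  funext x
  rw [convolution_mul, mol, ← integral_indicator (measurableSet_cube n R)]
  refine integral_congr_ae (Filter.Eventually.of_forall fun y => ?_)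
  by_cases hy : y ∈ cube n R <;> simp [hy]

theorem locallyIntegrable_indicator {n : ℕ} {R : ℝ} {f : E n → ℝ}
    (hf : MemLp f 2 (cubeMeasure n R)) : LocallyIntegrable ((cube n R).indicator f) volume :=
  ((integrable_indicator_iff (measurableSet_cube n R)).2
    (hf.integrable (by norm_num))).locallyIntegrable

theorem contDiff_mol {n : ℕ} {R : ℝ} {ψ : E n → ℝ} (hψ : ContDiff ℝ ∞ ψ)
    (hc : HasCompactSupport ψ) (t : ℝ) {f : E n → ℝ} (hf : MemLp f 2 (cubeMeasure n R)) :
    ContDiff ℝ ∞ (mol R ψ t f) := by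
  rw [mol_eq_convolution]
  exact (hc.contDiff_convolution_right _ (locallyIntegrable_indicator hf) hψ).comp
    (contDiff_const_smul t)

theorem partialD_mol {n : ℕ} {R : ℝ} {ψ : E n → ℝ} (hψ : ContDiff ℝ ∞ ψ)
    (hc : HasCompactSupport ψ) (t : ℝ) {f : E n → ℝ} (hf : MemLp f 2 (cubeMeasure n R))
    (i : Fin (n + 1)) (x : E n) :
    fderiv ℝ (mol R ψ t f) x (EuclideanSpace.single i 1) = t * mol R (partialD i ψ) t f x := by
  have hloc := locallyIntegrable_indicator hf
  have hψ1 : ContDiff ℝ 1 ψ := hψ.of_le (by simp)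
  have h1 := hc.hasFDerivAt_convolution_right (ContinuousLinearMap.mul ℝ ℝ) hloc hψ1 (t • x)
  have h2 : HasFDerivAt (fun x : E n => t • x) (t • ContinuousLinearMap.id ℝ (E n)) x :=
    (hasFDerivAt_id x).const_smul t
  have h3 := h1.comp x h2
  rw [mol_eq_convolution, mol_eq_convolution]
  change fderiv ℝ (convolution ((cube n R).indicator f) ψ (ContinuousLinearMap.mul ℝ ℝ)
      volume ∘ fun x => t • x) x _ = _
  rw [h3.fderiv, ContinuousLinearMap.comp_apply, smul_apply, map_smul,
    smul_eq_mul, ContinuousLinearMap.id_apply,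
    convolution_precompR_apply _ hloc (hc.fderiv ℝ) (hψ1.continuous_fderiv (by norm_num))]
  rfl

/-- The sign from differentiating ψ(tx − y) in y cancels the sign in the weak derivative. -/
theorem mol_partialD_wD {n p : ℕ} {R t : ℝ} {ψ : E n → ℝ} (hψ : IsMollifier n R t ψ)
    (hR : 0 < R) (u : Hp n p R) {α : Fin (n + 1) → ℕ} (hα : ∑ i, α i + 1 ≤ p) (i : Fin (n + 1))
    {x : E n} (hx : x ∈ closure (cube n R)) :
    mol R (partialD i ψ) t (wD α u) x = mol R ψ t (wD (α + Pi.single i 1) u) x := by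
  have h1 := integral_wD_mul_partialD u hα i (hψ.isTest hR hx)
  have h2 : ∀ y, partialD i (fun y => ψ (t • x - y)) y = -partialD i ψ (t • x - y) := by
    intro y
    have h3 : HasFDerivAt (fun y => ψ (t • x - y))
        ((fderiv ℝ ψ (t • x - y)).comp (-ContinuousLinearMap.id ℝ (E n))) y :=
      ((hψ.smooth.differentiable (by simp)) _).hasFDerivAt.comp y
        ((hasFDerivAt_id y).const_sub (t • x))
    rw [partialD, h3.fderiv]
    simp [partialD]
  simp only [h2, mul_neg, integral_neg, neg_inj] at h1
  exact h1

theorem IsMollifier.lintegral_eq {n : ℕ} {R t : ℝ} {ψ : E n → ℝ} (hψ : IsMollifier n R t ψ) :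
    ∫⁻ x, ENNReal.ofReal (ψ x) = 1 := by
  rw [← ofReal_integral_eq_lintegral_ofReal
    (hψ.smooth.continuous.integrable_of_hasCompactSupport hψ.compact)
    (Filter.Eventually.of_forall hψ.nonneg), hψ.integral_eq, ENNReal.ofReal_one]

/-- Jensen's inequality for the measure ψ(tx − y) dy on Ω, whose mass is at most one for arbitrary
x. -/
theorem enorm_mol_sq_le {n : ℕ} {R t : ℝ} {ψ : E n → ℝ} (hψ : IsMollifier n R t ψ)
    {f : E n → ℝ} (hf : Measurable f) (x : E n) :
    ‖mol R ψ t f x‖ₑ ^ (2 : ℝ) ≤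
      ∫⁻ y in cube n R, ENNReal.ofReal (ψ (t • x - y)) * ‖f y‖ₑ ^ (2 : ℝ) := by
  have hm : Measurable fun y : E n => ENNReal.ofReal (ψ (t • x - y)) :=
    (hψ.smooth.continuous.comp (by fun_prop : Continuous fun y : E n => t • x - y)).measurable.ennreal_ofReal
  set ν := (cubeMeasure n R).withDensity fun y => ENNReal.ofReal (ψ (t • x - y)) with hν
  have hν1 : ν univ ≤ 1 := by
    rw [hν, withDensity_apply _ MeasurableSet.univ, ← hψ.lintegral_eq, Measure.restrict_univ,
      ← lintegral_sub_left_eq_self (fun y => ENNReal.ofReal (ψ y)) (t • x)]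
    exact setLIntegral_le_lintegral _ _
  have h1 : ‖mol R ψ t f x‖ₑ ≤ eLpNorm f 1 ν := by
    rw [eLpNorm_one_eq_lintegral_enorm, hν, lintegral_withDensity_eq_lintegral_mul _ hm hf.enorm]
    refine (enorm_integral_le_lintegral_enorm _).trans (lintegral_mono fun y => ?_)
    rw [enorm_mul, Pi.mul_apply, mul_comm, Real.enorm_eq_ofReal (hψ.nonneg _)]
  have h2 : eLpNorm f 1 ν ≤ eLpNorm f 2 ν := by
    refine (eLpNorm_le_eLpNorm_mul_rpow_measure_univ (q := 2) (by norm_num)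
      hf.aestronglyMeasurable).trans ?_
    refine mul_le_of_le_one_right' (ENNReal.rpow_le_one hν1 ?_)
    norm_num
  have h3 : eLpNorm f 2 ν ^ (2 : ℝ) = ∫⁻ y, ‖f y‖ₑ ^ (2 : ℝ) ∂ν := by
    have := eLpNorm_nnreal_pow_eq_lintegral (f := f) (μ := ν) (p := 2) (by norm_num)
    simpa using this
  calc _ ≤ eLpNorm f 2 ν ^ (2 : ℝ) := ENNReal.rpow_le_rpow (h1.trans h2) (by norm_num)
    _ = _ := by
      rw [h3, hν, lintegral_withDensity_eq_lintegral_mul _ hm (hf.enorm.pow_const _)]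
      rfl

/-- The substitution z = tx costs t^(−(n+1)), which t ≥ 1/2 bounds uniformly. -/
theorem lintegral_kernel_le {n : ℕ} {R t : ℝ} {ψ : E n → ℝ} (hψ : IsMollifier n R t ψ) (y : E n) :
    ∫⁻ x in cube n R, ENNReal.ofReal (ψ (t • x - y)) ≤ 2 ^ (n + 1) := by
  have ht : 0 < t := by linarith [hψ.half_le]
  have hm : Measurable fun z : E n => ENNReal.ofReal (ψ (z - y)) :=
    (hψ.smooth.continuous.comp (by fun_prop : Continuous fun z : E n => z - y)).measurable.ennreal_ofReal
  refine (setLIntegral_le_lintegral _ _).trans ?_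
  rw [← lintegral_map (μ := volume) (f := fun z : E n => ENNReal.ofReal (ψ (z - y))) hm
    (measurable_const_smul t), Measure.map_addHaar_smul _ ht.ne', lintegral_smul_measure,
    lintegral_sub_right_eq_self (fun z => ENNReal.ofReal (ψ z)) y, hψ.lintegral_eq, smul_eq_mul,
    mul_one]
  rw [show (2 : ENNReal) ^ (n + 1) = ENNReal.ofReal (2 ^ (n + 1)) by
    rw [ENNReal.ofReal_pow (by norm_num)]; simp]
  apply ENNReal.ofReal_le_ofReal
  rw [abs_of_pos (by positivity), finrank_euclideanSpace, Fintype.card_fin, ← inv_pow]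
  gcongr
  rw [inv_le_comm₀ ht (by norm_num)]
  linarith [hψ.half_le]

/-- What matters is that the constant depends on neither t nor ψ; it is not sharp. -/
theorem eLpNorm_mol_le {n : ℕ} {R t : ℝ} {ψ : E n → ℝ} (hψ : IsMollifier n R t ψ)
    {f : E n → ℝ} (hf : Measurable f) :
    eLpNorm (mol R ψ t f) 2 (cubeMeasure n R) ≤ 2 ^ (n + 1) * eLpNorm f 2 (cubeMeasure n R) := by
  have h3 : ∀ g : E n → ℝ, eLpNorm g 2 (cubeMeasure n R) ^ (2 : ℝ) =
      ∫⁻ y in cube n R, ‖g y‖ₑ ^ (2 : ℝ) := by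
    intro g
    have := eLpNorm_nnreal_pow_eq_lintegral (f := g) (μ := cubeMeasure n R) (p := 2) (by norm_num)
    simpa using this
  rw [← ENNReal.rpow_le_rpow_iff (z := 2) (by norm_num),
    ENNReal.mul_rpow_of_nonneg _ _ (by norm_num), h3, h3]
  calc _ ≤ ∫⁻ x in cube n R, ∫⁻ y in cube n R,
        ENNReal.ofReal (ψ (t • x - y)) * ‖f y‖ₑ ^ (2 : ℝ) :=
        lintegral_mono fun x => enorm_mol_sq_le hψ hf x
    _ = ∫⁻ y in cube n R, ∫⁻ x in cube n R,
        ENNReal.ofReal (ψ (t • x - y)) * ‖f y‖ₑ ^ (2 : ℝ) := by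
        rw [lintegral_lintegral_swap]
        refine Measurable.aemeasurable (Measurable.mul ?_ ?_)
        · exact (hψ.smooth.continuous.comp
            (by fun_prop : Continuous fun q : E n × E n => t • q.1 - q.2)).measurable.ennreal_ofReal
        · exact (hf.comp measurable_snd).enorm.pow_const _
    _ ≤ ∫⁻ y in cube n R, 2 ^ (n + 1) * ‖f y‖ₑ ^ (2 : ℝ) := by
        refine lintegral_mono fun y => ?_
        have hm : Measurable fun x : E n => ENNReal.ofReal (ψ (t • x - y)) :=
          (hψ.smooth.continuous.comp
            (by fun_prop : Continuous fun x : E n => t • x - y)).measurable.ennreal_ofReal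
        rw [lintegral_mul_const _ hm]
        exact mul_le_mul' (lintegral_kernel_le hψ y) le_rfl
    _ = 2 ^ (n + 1) * ∫⁻ y in cube n R, ‖f y‖ₑ ^ (2 : ℝ) :=
        lintegral_const_mul' _ _ (by simp)
    _ ≤ _ := by
        refine mul_le_mul' ?_ le_rfl
        rw [ENNReal.rpow_two]
        exact le_self_pow₀ (one_le_pow₀ (by norm_num)) (by norm_num)

theorem IsMollifier.integrable_mul {n : ℕ} {R t : ℝ} {ψ : E n → ℝ} (hψ : IsMollifier n R t ψ)
    {f : E n → ℝ} (hf : MemLp f 2 (cubeMeasure n R)) (x : E n) :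
    Integrable (fun y => f y * ψ (t • x - y)) (cubeMeasure n R) :=
  MemLp.integrable_mul (p := 2) (q := 2) hf
    ((hψ.smooth.continuous.comp (by fun_prop : Continuous fun y : E n => t • x - y)).memLp_of_hasCompactSupport
      (hψ.compact.comp_homeomorph (Homeomorph.subLeft (t • x))))

theorem mol_sub {n : ℕ} {R t : ℝ} {ψ : E n → ℝ} (hψ : IsMollifier n R t ψ) {f g : E n → ℝ}
    (hf : MemLp f 2 (cubeMeasure n R)) (hg : MemLp g 2 (cubeMeasure n R)) :
    mol R ψ t (f - g) = mol R ψ t f - mol R ψ t g := by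
  funext x
  simp only [mol, Pi.sub_apply, sub_mul]
  exact integral_sub (hψ.integrable_mul hf x) (hψ.integrable_mul hg x)

theorem IsMollifier.setIntegral_eq {n : ℕ} {R t : ℝ} {ψ : E n → ℝ} (hψ : IsMollifier n R t ψ)
    (hR : 0 < R) {x : E n} (hx : x ∈ closure (cube n R)) :
    ∫ y, ψ (t • x - y) ∂(cubeMeasure n R) = 1 := by
  rw [← hψ.integral_eq, ← integral_sub_left_eq_self (fun y => ψ y) volume (t • x),
    setIntegral_eq_integral_of_forall_compl_eq_zero]
  intro y hy
  by_contra h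
  exact hy ((hψ.isTest hR hx).supp (subset_tsupport _ h))

theorem norm_le_of_mem_closure_cube {n : ℕ} {R : ℝ} (hR : 0 < R) {x : E n}
    (hx : x ∈ closure (cube n R)) : ‖x‖ ≤ (n + 1) * R := by
  have h := (EuclideanSpace.basisFun (Fin (n + 1)) ℝ).sum_repr x
  rw [← h]
  refine (norm_sum_le _ _).trans ?_
  calc _ ≤ ∑ _i : Fin (n + 1), R := Finset.sum_le_sum fun i _ => by
        have := (mem_closure_cube hR).1 hx i
        rw [norm_smul]
        simpa [abs_le] using this
    _ = _ := by simp

/-- The kernel has mass one and only sees y with |y − tx| ≤ (1 − t)R/2, while |tx − x| ≤ (1 − t)(n +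
1)R. -/
theorem abs_mol_sub_le {n : ℕ} {R t : ℝ} {ψ : E n → ℝ} (hψ : IsMollifier n R t ψ)
    (hR : 0 < R) {g : E n → ℝ} (hg : MemLp g 2 (cubeMeasure n R)) {δ ρ : ℝ}
    (hδ : ∀ x y, dist x y ≤ ρ → |g x - g y| ≤ δ) (hρ : (1 - t) * ((n + 2) * R) ≤ ρ)
    {x : E n} (hx : x ∈ closure (cube n R)) : |mol R ψ t g x - g x| ≤ δ := by
  have hψi : Integrable (fun y => ψ (t • x - y)) (cubeMeasure n R) :=
    ((hψ.isTest hR hx).smooth.continuous.integrable_of_hasCompactSupport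
      (hψ.isTest hR hx).compact).mono_measure Measure.restrict_le_self
  have h1 : mol R ψ t g x - g x = ∫ y, (g y - g x) * ψ (t • x - y) ∂(cubeMeasure n R) := by
    simp only [sub_mul]
    rw [integral_sub (hψ.integrable_mul hg x) (hψi.const_mul _), integral_const_mul,
      hψ.setIntegral_eq hR hx, mul_one, mol]
  rw [h1, ← Real.norm_eq_abs]
  have h2 : ∫ y, δ * ψ (t • x - y) ∂(cubeMeasure n R) = δ := by
    rw [integral_const_mul, hψ.setIntegral_eq hR hx, mul_one]
  rw [← h2]
  refine norm_integral_le_of_norm_le (hψi.const_mul _) (Filter.Eventually.of_forall fun y => ?_)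
  rw [norm_mul, Real.norm_of_nonneg (hψ.nonneg _), Real.norm_eq_abs]
  by_cases hy : ψ (t • x - y) = 0
  · simp [hy]
  refine mul_le_mul_of_nonneg_right (hδ _ _ ?_) (hψ.nonneg _)
  have h3 := hψ.supp (subset_tsupport _ hy)
  rw [mem_closedBall_zero_iff] at h3
  have h4 : y - x = -(t • x - y) - (1 - t) • x := by module
  rw [dist_eq_norm, h4]
  have h5 := sub_pos.2 hψ.lt_one
  calc _ ≤ ‖t • x - y‖ + (1 - t) * ‖x‖ := by
        refine (norm_sub_le _ _).trans ?_
        rw [norm_neg, norm_smul, Real.norm_of_nonneg h5.le]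
    _ ≤ (1 - t) * R / 2 + (1 - t) * ((n + 1) * R) := by
        gcongr
        exact norm_le_of_mem_closure_cube hR hx
    _ ≤ _ := by nlinarith [mul_pos h5 hR]

theorem eLpNorm_mol_sub_le {n : ℕ} {R : ℝ} (hR : 0 < R) {f : E n → ℝ} (hfm : Measurable f)
    (hf : MemLp f 2 (cubeMeasure n R)) {ε : ENNReal} (hε : ε ≠ 0) :
    ∃ τ < (1 : ℝ), ∀ t ψ, τ ≤ t → IsMollifier n R t ψ →
      eLpNorm (mol R ψ t f - f) 2 (cubeMeasure n R) ≤ ε := by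
  have hV : volume (cube n R) ^ (1 / 2 : ℝ) ≠ ⊤ :=
    ENNReal.rpow_ne_top_of_nonneg (by norm_num) (volume_cube_lt_top n R).ne
  -- Three errors for a continuous approximation g of f: smoothing of f − g, f − g itself, and the
  -- uniform error of g.
  set K : ENNReal := 2 ^ (n + 1) + 1 + volume (cube n R) ^ (1 / 2 : ℝ) with hK
  have hKt : K ≠ ⊤ := by
    rw [hK]
    exact ENNReal.add_ne_top.2 ⟨ENNReal.add_ne_top.2 ⟨by simp, by simp⟩, hV⟩
  obtain ⟨δ, hδ0, hδ⟩ : ∃ δ : ℝ, 0 < δ ∧ K * ENNReal.ofReal δ ≤ ε := by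
    obtain ⟨δ, hδ0, hδ⟩ := ENNReal.exists_nnreal_pos_mul_lt hKt hε
    refine ⟨δ, hδ0, ?_⟩
    rw [mul_comm, ENNReal.ofReal_coe_nnreal]
    exact hδ.le
  obtain ⟨g, hgc, hfg, hgcont, hgm⟩ :=
    hf.exists_hasCompactSupport_eLpNorm_sub_le (by norm_num) (ε := ENNReal.ofReal δ) (by simpa)
  obtain ⟨ρ, hρ0, hρ⟩ := Metric.uniformContinuous_iff.1
    (hgc.uniformContinuous_of_continuous hgcont) δ hδ0
  have hpos : 0 < ((n : ℝ) + 2) * R := by positivity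
  -- This makes (1 − t)(n + 2)R ≤ ρ/2; the half provides the strict inequality required by uniform
  -- continuity.
  refine ⟨1 - ρ / 2 / ((n + 2) * R), by
    have : 0 < ρ / 2 / (((n : ℝ) + 2) * R) := by positivity
    linarith, fun t ψ ht hψ => ?_⟩
  have hclose : ∀ x ∈ cube n R, ‖(mol R ψ t g - g) x‖ ≤ δ := by
    intro x hx
    refine abs_mol_sub_le hψ hR hgm (ρ := ρ / 2) (fun x y hxy => ?_) ?_ (subset_closure hx)
    · rw [← Real.dist_eq]
      exact (hρ (hxy.trans_lt (by linarith))).le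
    · rw [← le_div_iff₀ hpos]; linarith
  have h1 : eLpNorm (mol R ψ t g - g) 2 (cubeMeasure n R) ≤
      volume (cube n R) ^ (1 / 2 : ℝ) * ENNReal.ofReal δ := by
    refine (eLpNorm_le_of_ae_bound
      ((ae_restrict_iff' (measurableSet_cube n R)).2 (Filter.Eventually.of_forall hclose))).trans ?_
    rw [Measure.restrict_apply_univ]
    simp
  have h2 : mol R ψ t f - f = mol R ψ t (f - g) + ((mol R ψ t g - g) - (f - g)) := by
    rw [mol_sub hψ hf hgm]; abel
  have hmolm : ∀ {f : E n → ℝ}, MemLp f 2 (cubeMeasure n R) →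
      AEStronglyMeasurable (mol R ψ t f) (cubeMeasure n R) := fun hf =>
    (contDiff_mol hψ.smooth hψ.compact t hf).continuous.aestronglyMeasurable
  rw [h2]
  have h3 : eLpNorm (mol R ψ t (f - g)) 2 (cubeMeasure n R) ≤ 2 ^ (n + 1) * ENNReal.ofReal δ :=
    (eLpNorm_mol_le hψ (hfm.sub hgcont.measurable)).trans (by gcongr)
  calc _ ≤ 2 ^ (n + 1) * ENNReal.ofReal δ +
        (volume (cube n R) ^ (1 / 2 : ℝ) * ENNReal.ofReal δ + ENNReal.ofReal δ) := by
        refine (eLpNorm_add_le (hmolm (hf.sub hgm)) (((hmolm hgm).sub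
          hgcont.aestronglyMeasurable).sub (hf.sub hgm).1) (by norm_num)).trans
          (add_le_add h3 ?_)
        refine (eLpNorm_sub_le ((hmolm hgm).sub hgcont.aestronglyMeasurable)
          (hf.sub hgm).1 (by norm_num)).trans (add_le_add h1 hfg)
    _ = K * ENNReal.ofReal δ := by rw [hK]; ring
    _ ≤ ε := hδ

open Filter Topology

/-! ### Representatives of class `C²` -/

/-- The normalization t^|α| absorbs the chain-rule factor t produced by each derivative. -/
theorem isJet_mol {n p : ℕ} {R t : ℝ} {ψ : E n → ℝ} (hR : 0 < R) (hψ : IsMollifier n R t ψ)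
    (u : Hp n p R) : IsJet n p R fun α x => t ^ (∑ i, α i) * mol R ψ t (wD α u) x where
  smooth α := ((contDiff_mol hψ.smooth hψ.compact t (memLp_wD α u)).const_smul
    (t ^ (∑ i, α i))).of_le (by simp)
  deriv_eq α hα i x hx := by
    have h1 := contDiff_mol hψ.smooth hψ.compact t (memLp_wD α u)
    rw [fderiv_const_mul ((h1.differentiable (by simp)) x), smul_apply, smul_eq_mul,
      partialD_mol hψ.smooth hψ.compact t (memLp_wD α u), mol_partialD_wD hψ hR u hα i hx,
      sum_add_single, pow_succ, mul_assoc]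

theorem eLpNorm_jet_mol_sub_le {n p : ℕ} {R t : ℝ} {ψ : E n → ℝ} (hψ : IsMollifier n R t ψ)
    (u : Hp n p R) (α : Fin (n + 1) → ℕ) :
    eLpNorm ((fun x => t ^ (∑ i, α i) * mol R ψ t (wD α u) x) - wD α u) 2 (cubeMeasure n R) ≤
      eLpNorm (mol R ψ t (wD α u) - wD α u) 2 (cubeMeasure n R) +
        ENNReal.ofReal (1 - t ^ (∑ i, α i)) * eLpNorm (wD α u) 2 (cubeMeasure n R) := by
  have h0 : 0 ≤ t := by linarith [hψ.half_le]
  have h1 : t ^ (∑ i, α i) ≤ 1 := pow_le_one₀ h0 hψ.lt_one.le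
  have hm := (contDiff_mol hψ.smooth hψ.compact t (memLp_wD α u)).continuous.aestronglyMeasurable
    (μ := cubeMeasure n R)
  have h2 : (fun x => t ^ (∑ i, α i) * mol R ψ t (wD α u) x) - wD α u =
      t ^ (∑ i, α i) • (mol R ψ t (wD α u) - wD α u) - (1 - t ^ (∑ i, α i)) • wD α u := by
    funext x
    simp only [Pi.sub_apply, Pi.smul_apply, smul_eq_mul]
    ring
  rw [h2]
  refine (eLpNorm_sub_le ((hm.sub (memLp_wD α u).1).const_smul _)
    ((memLp_wD α u).1.const_smul _) (by norm_num)).trans (add_le_add ?_ ?_)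
  · rw [eLpNorm_const_smul, Real.enorm_eq_ofReal (by positivity)]
    exact mul_le_of_le_one_left' (ENNReal.ofReal_le_one.2 h1)
  · rw [eLpNorm_const_smul, Real.enorm_eq_ofReal (by linarith)]

/-- Every `u ∈ H^p(Ω)` is a limit of smooth jets. -/
theorem exists_jet_approx {n p : ℕ} {R : ℝ} (hR : 0 < R) (u : Hp n p R) :
    ∃ f : ℕ → (Fin (n + 1) → ℕ) → E n → ℝ, (∀ k, IsJet n p R (f k)) ∧
      ∀ α, Tendsto (fun k => eLpNorm (f k α - wD α u) 2 (cubeMeasure n R)) atTop (𝓝 0) := by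
  -- The sequence starts at 1/2, the least dilation allowed for a mollifier.
  let t : ℕ → ℝ := fun k => 1 - 1 / ((k : ℝ) + 2)
  have hinv : Tendsto (fun k : ℕ => 1 / ((k : ℝ) + 2)) atTop (𝓝 0) := by
    have := tendsto_one_div_add_atTop_nhds_zero_nat (𝕜 := ℝ)
    refine ((tendsto_add_atTop_iff_nat 1).2 this).congr fun k => ?_
    push_cast; ring
  have ht : Tendsto t atTop (𝓝 1) := by
    have := hinv.const_sub 1
    rwa [sub_zero] at this
  have hthalf : ∀ k, 1 / 2 ≤ t k := by
    intro k
    have : 1 / ((k : ℝ) + 2) ≤ 1 / 2 := by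
      apply one_div_le_one_div_of_le <;> linarith [(Nat.cast_nonneg k : (0 : ℝ) ≤ k)]
    simp only [t]; linarith
  have htlt : ∀ k, t k < 1 := fun k => by
    have : 0 < 1 / ((k : ℝ) + 2) := by positivity
    simp only [t]; linarith
  choose ψ hψ using fun k => exists_isMollifier n hR (hthalf k) (htlt k)
  refine ⟨_, fun k => isJet_mol hR (hψ k) u, fun α => ?_⟩
  have h1 : Tendsto (fun k => eLpNorm (mol R (ψ k) (t k) (wD α u) - wD α u) 2 (cubeMeasure n R))
      atTop (𝓝 0) := by
    rw [ENNReal.tendsto_nhds_zero]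
    intro ε hε
    obtain ⟨τ, hτ, h⟩ := eLpNorm_mol_sub_le hR (measurable_wD α u) (memLp_wD α u) hε.ne'
    filter_upwards [ht.eventually (lt_mem_nhds hτ)] with k hk
    exact h _ _ hk.le (hψ k)
  have h2 : Tendsto (fun k => ENNReal.ofReal (1 - t k ^ (∑ i, α i)) *
      eLpNorm (wD α u) 2 (cubeMeasure n R)) atTop (𝓝 0) := by
    have h3 : Tendsto (fun k => ENNReal.ofReal (1 - t k ^ (∑ i, α i))) atTop (𝓝 0) := by
      have := ENNReal.tendsto_ofReal ((ht.pow (∑ i, α i)).const_sub 1)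
      simpa using this
    simpa using ENNReal.Tendsto.mul_const h3 (Or.inr (memLp_wD α u).2.ne)
  exact tendsto_of_tendsto_of_tendsto_of_le_of_le tendsto_const_nhds (by simpa using h1.add h2)
    (fun _ => zero_le) fun k => eLpNorm_jet_mol_sub_le (hψ k) u α

/-- `V` is a family of continuous representatives on the closed cube of the derivatives of `u` of
order at most two. -/
structure IsRep {n p : ℕ} {R : ℝ} (u : Hp n p R) (V : (Fin (n + 1) → ℕ) → E n → ℝ) : Prop where
  cont : ∀ α, ∑ i, α i ≤ 2 → ContinuousOn (V α) (closure (cube n R))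
  ae_eq : ∀ α, ∑ i, α i ≤ 2 → V α =ᵐ[cubeMeasure n R] wD α u
  deriv : ∀ α, ∑ i, α i ≤ 1 → ∀ x ∈ closure (cube n R), HasFDerivWithinAt (V α)
    (∑ i, V (α + Pi.single i 1) x • (EuclideanSpace.proj i : E n →L[ℝ] ℝ)) (closure (cube n R)) x

theorem fderiv_eq_sum_of_isJet {n p : ℕ} {R : ℝ} {f : (Fin (n + 1) → ℕ) → E n → ℝ}
    (hf : IsJet n p R f) {α : Fin (n + 1) → ℕ} (hα : ∑ i, α i + 1 ≤ p) {x : E n}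
    (hx : x ∈ closure (cube n R)) : HasFDerivAt (f α)
      (∑ i, f (α + Pi.single i 1) x • (EuclideanSpace.proj i : E n →L[ℝ] ℝ)) x := by
  have h := ((hf.smooth α).differentiable (by norm_num) x).hasFDerivAt
  refine h.congr_fderiv (ContinuousLinearMap.ext fun v => ?_)
  rw [clm_apply_eq_sum (fderiv ℝ (f α) x)]
  simp only [sum_apply, smul_apply, smul_eq_mul, hf.deriv_eq α hα _ x hx]
  exact Finset.sum_congr rfl fun i _ => mul_comm _ _

theorem tendstoUniformlyOn_sum_smul {n : ℕ} {s : Set (E n)} {f : ℕ → Fin (n + 1) → E n → ℝ}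
    {V : Fin (n + 1) → E n → ℝ}
    (h : ∀ i, TendstoUniformlyOn (fun k => f k i) (V i) atTop s) :
    TendstoUniformlyOn (fun k x => ∑ i, f k i x • (EuclideanSpace.proj i : E n →L[ℝ] ℝ))
      (fun x => ∑ i, V i x • (EuclideanSpace.proj i : E n →L[ℝ] ℝ)) atTop s := by
  rw [Metric.tendstoUniformlyOn_iff]
  intro ε hε
  have hS : 0 < ∑ i, (‖(EuclideanSpace.proj i : E n →L[ℝ] ℝ)‖ + 1) :=
    Finset.sum_pos (fun i _ => by positivity) Finset.univ_nonempty
  have h1 : ∀ i, ∀ᶠ k in atTop, ∀ x ∈ s, dist (V i x) (f k i x) <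
      ε / ∑ i, (‖(EuclideanSpace.proj i : E n →L[ℝ] ℝ)‖ + 1) :=
    fun i => Metric.tendstoUniformlyOn_iff.1 (h i) _ (by positivity)
  filter_upwards [eventually_all.2 h1] with k hk x hx
  rw [dist_eq_norm, ← Finset.sum_sub_distrib]
  simp only [← sub_smul]
  calc _ ≤ ∑ i, ‖V i x - f k i x‖ * ‖(EuclideanSpace.proj i : E n →L[ℝ] ℝ)‖ :=
        (norm_sum_le _ _).trans (Finset.sum_le_sum fun i _ => (norm_smul_le _ _))
    _ < ∑ i, ε / (∑ i, (‖(EuclideanSpace.proj i : E n →L[ℝ] ℝ)‖ + 1)) *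
        (‖(EuclideanSpace.proj i : E n →L[ℝ] ℝ)‖ + 1) := by
        refine Finset.sum_lt_sum_of_nonempty Finset.univ_nonempty fun i _ => ?_
        have h2 := hk i x hx
        rw [dist_eq_norm] at h2
        have := norm_nonneg (EuclideanSpace.proj i : E n →L[ℝ] ℝ)
        nlinarith [norm_nonneg (V i x - f k i x)]
    _ = ε := by rw [← Finset.mul_sum]; field_simp

theorem continuousOn_sum_smul_proj {n : ℕ} {s : Set (E n)} {V : Fin (n + 1) → E n → ℝ}
    (h : ∀ i, ContinuousOn (V i) s) :
    ContinuousOn (fun x => ∑ i, V i x • (EuclideanSpace.proj i : E n →L[ℝ] ℝ)) s :=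
  continuousOn_finsetSum _ fun i _ => (h i).smul continuousOn_const

theorem eLpNorm_wD_le {n p : ℕ} {R : ℝ} (u : Hp n p R) (α : Fin (n + 1) → ℕ) :
    eLpNorm (wD α u) 2 (cubeMeasure n R) ≤ ‖u‖ₑ := by
  unfold wD
  split_ifs with h
  · rw [← Lp.enorm_def]
    have := PiLp.norm_apply_le (u : JetSpace n p R) ⟨α, h⟩
    exact enorm_le_iff_norm_le.2 this
  · simp

/-- The Sobolev inequality for differences of approximating jets makes the derivatives of order at
most two uniformly Cauchy on the closed cube. With D = ⌈(n+1)/2⌉ the count 2 + (D + 1) ≤ p is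
exactly the hypothesis on p. -/
theorem exists_isRep {n p : ℕ} {R : ℝ} (hp : ⌈((n : ℝ) + 1) / 2⌉₊ + 2 < p) (hR : 0 < R) :
    ∃ C : ℝ, 0 < C ∧ ∀ u : Hp n p R, ∃ V, IsRep u V ∧
      ∀ α, ∑ i, α i ≤ 2 → ∀ x ∈ closure (cube n R), |V α x| ≤ C * ‖u‖ := by
  obtain ⟨C, hC⟩ := exists_enorm_jet_le (n := n) (p := p) hR (Nat.le_ceil (((n : ℝ) + 1) / 2))
  -- The summand 1 only makes the constant strictly positive.
  refine ⟨C * (multiIdx n p).card + 1, by positivity, fun u => ?_⟩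
  obtain ⟨f, hf, hlim⟩ := exists_jet_approx hR u
  set a : ℕ → ENNReal := fun k =>
    ∑ α ∈ multiIdx n p, eLpNorm (f k α - wD α u) 2 (cubeMeasure n R) with ha
  have ha0 : Tendsto a atTop (𝓝 0) := by
    have := tendsto_finsetSum (multiIdx n p) fun α _ => hlim α
    simpa using this
  have hfm : ∀ k α, AEStronglyMeasurable (f k α) (cubeMeasure n R) := fun k α =>
    ((hf k).smooth α).continuous.aestronglyMeasurable
  have hsub : ∀ k l, jetNorm n p R (fun α x => f k α x - f l α x) ≤ a k + a l := by
    intro k l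
    rw [jetNorm, ha, ← Finset.sum_add_distrib]
    refine Finset.sum_le_sum fun α _ => ?_
    have h1 : (fun x => f k α x - f l α x) = (f k α - wD α u) - (f l α - wD α u) := by
      funext x; simp
    rw [h1]
    exact eLpNorm_sub_le ((hfm k α).sub (memLp_wD α u).1) ((hfm l α).sub (memLp_wD α u).1)
      (by norm_num)
  have hbd : ∀ k, jetNorm n p R (f k) ≤ a k + (multiIdx n p).card * ‖u‖ₑ := by
    intro k
    rw [jetNorm, ha, ← nsmul_eq_mul, ← Finset.sum_const, ← Finset.sum_add_distrib]
    refine Finset.sum_le_sum fun α _ => ?_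
    have h1 : f k α = (f k α - wD α u) + wD α u := by simp
    conv_lhs => rw [h1]
    exact (eLpNorm_add_le ((hfm k α).sub (memLp_wD α u).1) (memLp_wD α u).1 (by norm_num)).trans
      (add_le_add le_rfl (eLpNorm_wD_le u α))
  have hcauchy : ∀ α, ∑ i, α i ≤ 2 →
      UniformCauchySeqOn (fun k => f k α) atTop (closure (cube n R)) := by
    intro α hα
    rw [Metric.uniformCauchySeqOn_iff]
    intro ε hε
    have h2 : Tendsto (fun k => C * (a k + a k)) atTop (𝓝 0) := by
      simpa using ENNReal.Tendsto.const_mul (ha0.add ha0) (Or.inr ENNReal.coe_ne_top)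
    have h2' : Tendsto (fun k : ℕ => (C : ENNReal) * a k) atTop (𝓝 0) := by
      simpa using ENNReal.Tendsto.const_mul ha0 (Or.inr ENNReal.coe_ne_top)
    have hε2 : 0 < ENNReal.ofReal (ε / 2) := by simpa using hε
    obtain ⟨N, hN⟩ := eventually_atTop.1 (h2'.eventually (gt_mem_nhds hε2))
    refine ⟨N, fun k hk l hl x hx => ?_⟩
    have h3 := hC _ ((hf k).sub (hf l)) α (by omega) x hx
    have h4 : ‖f k α x - f l α x‖ₑ < ENNReal.ofReal ε := by
      refine (h3.trans (mul_le_mul_right (hsub k l) _)).trans_lt ?_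
      rw [mul_add, ← add_halves ε, ENNReal.ofReal_add (by positivity) (by positivity)]
      exact ENNReal.add_lt_add (hN k hk) (hN l hl)
    rw [Real.enorm_eq_ofReal_abs, ENNReal.ofReal_lt_ofReal_iff hε] at h4
    rwa [Real.dist_eq]
  have hex : ∀ α x, ∃ v, ∑ i, α i ≤ 2 → x ∈ closure (cube n R) →
      Tendsto (fun k => f k α x) atTop (𝓝 v) := by
    intro α x
    by_cases h : ∑ i, α i ≤ 2 ∧ x ∈ closure (cube n R)
    · obtain ⟨v, hv⟩ := cauchySeq_tendsto_of_complete ((hcauchy α h.1).cauchySeq h.2)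
      exact ⟨v, fun _ _ => hv⟩
    · exact ⟨0, fun h1 h2 => absurd ⟨h1, h2⟩ h⟩
  choose V hV using hex
  have hunif : ∀ α, ∑ i, α i ≤ 2 →
      TendstoUniformlyOn (fun k => f k α) (V α) atTop (closure (cube n R)) := fun α hα =>
    (hcauchy α hα).tendstoUniformlyOn_of_tendsto fun x hx => hV α x hα hx
  have hcont : ∀ α, ∑ i, α i ≤ 2 → ContinuousOn (V α) (closure (cube n R)) := fun α hα =>
    (hunif α hα).continuousOn
      (Eventually.frequently (Eventually.of_forall fun k => ((hf k).smooth α).continuous.continuousOn))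
  refine ⟨V, ⟨hcont, ?_, ?_⟩, ?_⟩
  · intro α hα
    obtain ⟨ns, hns, hae⟩ := (tendstoInMeasure_of_tendsto_eLpNorm (by norm_num)
      (fun k => hfm k α) (memLp_wD α u).1 (hlim α)).exists_seq_tendsto_ae
    filter_upwards [hae, ae_restrict_mem (measurableSet_cube n R)] with x hx hmem
    exact tendsto_nhds_unique ((hV α x hα (subset_closure hmem)).comp hns.tendsto_atTop) hx
  · intro α hα
    set g' : E n → E n →L[ℝ] ℝ :=
      fun x => ∑ i, V (α + Pi.single i 1) x • (EuclideanSpace.proj i : E n →L[ℝ] ℝ) with hg'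
    have hα' : ∀ i, ∑ j, (α + Pi.single i 1 : Fin (n + 1) → ℕ) j ≤ 2 := fun i => by
      rw [sum_add_single]; omega
    have hin : ∀ x ∈ cube n R, HasFDerivAt (V α) (g' x) x := fun x hx =>
      hasFDerivAt_of_tendstoUniformlyOn (isOpen_cube n R)
        ((tendstoUniformlyOn_sum_smul fun i => hunif _ (hα' i)).mono subset_closure)
        (fun k x hx => fderiv_eq_sum_of_isJet (hf k) (by omega) (subset_closure hx))
        (fun x hx => hV α x (by omega) (subset_closure hx)) hx
    intro x hx
    -- Up to the boundary: on a convex set, a derivative with a continuous limit at x gives the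
    -- one-sided derivative there.
    refine hasFDerivWithinAt_closure_of_tendsto_fderiv
      (fun y hy => (hin y hy).differentiableAt.differentiableWithinAt) (convex_cube n R)
      (isOpen_cube n R) (fun y hy => ((hcont α (by omega)) y hy).mono subset_closure) ?_
    have h1 : Tendsto g' (𝓝[cube n R] x) (𝓝 (g' x)) :=
      ((continuousOn_sum_smul_proj fun i => hcont _ (hα' i)) x hx).mono subset_closure
    refine h1.congr' ?_
    filter_upwards [self_mem_nhdsWithin] with y hy
    exact (hin y hy).fderiv.symm
  · intro α hα x hx
    have h1 : ∀ k, ‖f k α x‖ₑ ≤ C * (a k + (multiIdx n p).card * ‖u‖ₑ) := fun k =>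
      (hC _ (hf k) α (by omega) x hx).trans (mul_le_mul_right (hbd k) _)
    have h2 : Tendsto (fun k => C * (a k + (multiIdx n p).card * ‖u‖ₑ)) atTop
        (𝓝 (C * (0 + (multiIdx n p).card * ‖u‖ₑ))) :=
      ENNReal.Tendsto.const_mul (ha0.add tendsto_const_nhds) (Or.inr ENNReal.coe_ne_top)
    have h3 := le_of_tendsto_of_tendsto' (hV α x hα hx).enorm h2 h1
    rw [zero_add, ← ofReal_norm (V α x), ← ofReal_norm u] at h3
    have h4 : (C : ENNReal) * ((multiIdx n p).card * ENNReal.ofReal ‖u‖) =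
        ENNReal.ofReal (C * ((multiIdx n p).card * ‖u‖)) := by
      rw [ENNReal.ofReal_mul (by positivity), ENNReal.ofReal_mul (by positivity)]
      simp
    rw [h4, ENNReal.ofReal_le_ofReal_iff (by positivity), Real.norm_eq_abs] at h3
    nlinarith [norm_nonneg u]

/-! ### The canonical representative and its calculus -/

/-- Continuous functions equal almost everywhere agree on the open cube, hence on its closure. This
makes the representatives unique, and therefore linear in u. -/
theorem eqOn_closure_cube_of_ae_eq {n : ℕ} {R : ℝ} {f g : E n → ℝ}
    (hf : ContinuousOn f (closure (cube n R))) (hg : ContinuousOn g (closure (cube n R)))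
    (h : f =ᵐ[cubeMeasure n R] g) : EqOn f g (closure (cube n R)) :=
  (Measure.eqOn_open_of_ae_eq h (isOpen_cube n R) (hf.mono subset_closure)
    (hg.mono subset_closure)).of_subset_closure hf hg subset_closure subset_rfl

theorem IsRep.eqOn {n p : ℕ} {R : ℝ} {u : Hp n p R} {V W : (Fin (n + 1) → ℕ) → E n → ℝ}
    (hV : IsRep u V) (hW : IsRep u W) {α : Fin (n + 1) → ℕ} (hα : ∑ i, α i ≤ 2) :
    EqOn (V α) (W α) (closure (cube n R)) :=
  eqOn_closure_cube_of_ae_eq (hV.cont α hα) (hW.cont α hα)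
    ((hV.ae_eq α hα).trans (hW.ae_eq α hα).symm)

open Classical in
/-- The continuous representatives on the closed cube of the derivatives of `u`. -/
def jet {n p : ℕ} {R : ℝ} (u : Hp n p R) : (Fin (n + 1) → ℕ) → E n → ℝ :=
  if h : ∃ V, IsRep u V then h.choose else 0

theorem isRep_jet {n p : ℕ} {R : ℝ} (hp : ⌈((n : ℝ) + 1) / 2⌉₊ + 2 < p) (hR : 0 < R)
    (u : Hp n p R) : IsRep u (jet u) := by
  obtain ⟨C, -, hC⟩ := exists_isRep hp hR
  have h : ∃ V, IsRep u V := (hC u).imp fun _ h => h.1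
  rw [jet, dif_pos h]
  exact h.choose_spec

theorem exists_abs_jet_le {n p : ℕ} {R : ℝ} (hp : ⌈((n : ℝ) + 1) / 2⌉₊ + 2 < p) (hR : 0 < R) :
    ∃ C : ℝ, 0 < C ∧ ∀ (u : Hp n p R) α, ∑ i, α i ≤ 2 → ∀ x ∈ closure (cube n R),
      |jet u α x| ≤ C * ‖u‖ := by
  obtain ⟨C, hC0, hC⟩ := exists_isRep hp hR
  refine ⟨C, hC0, fun u α hα x hx => ?_⟩
  obtain ⟨V, hV, hVC⟩ := hC u
  rw [(isRep_jet hp hR u).eqOn hV hα hx]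
  exact hVC α hα x hx

theorem wD_add {n p : ℕ} {R : ℝ} (α : Fin (n + 1) → ℕ) (u v : Hp n p R) :
    wD α (u + v) =ᵐ[cubeMeasure n R] wD α u + wD α v := by
  unfold wD
  split_ifs
  · exact Lp.coeFn_add _ _
  · simp

theorem wD_smul {n p : ℕ} {R : ℝ} (α : Fin (n + 1) → ℕ) (c : ℝ) (u : Hp n p R) :
    wD α (c • u) =ᵐ[cubeMeasure n R] c • wD α u := by
  unfold wD
  split_ifs
  · exact Lp.coeFn_smul _ _
  · simp

theorem jet_add {n p : ℕ} {R : ℝ} (hp : ⌈((n : ℝ) + 1) / 2⌉₊ + 2 < p) (hR : 0 < R)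
    (u v : Hp n p R) {α : Fin (n + 1) → ℕ} (hα : ∑ i, α i ≤ 2) {x : E n}
    (hx : x ∈ closure (cube n R)) : jet (u + v) α x = jet u α x + jet v α x := by
  have hu := isRep_jet hp hR u
  have hv := isRep_jet hp hR v
  have huv := isRep_jet hp hR (u + v)
  exact eqOn_closure_cube_of_ae_eq (huv.cont α hα) ((hu.cont α hα).add (hv.cont α hα))
    ((huv.ae_eq α hα).trans ((wD_add α u v).trans
      ((hu.ae_eq α hα).add (hv.ae_eq α hα)).symm)) hx

theorem jet_smul {n p : ℕ} {R : ℝ} (hp : ⌈((n : ℝ) + 1) / 2⌉₊ + 2 < p) (hR : 0 < R)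
    (c : ℝ) (u : Hp n p R) {α : Fin (n + 1) → ℕ} (hα : ∑ i, α i ≤ 2) {x : E n}
    (hx : x ∈ closure (cube n R)) : jet (c • u) α x = c * jet u α x := by
  have hu := isRep_jet hp hR u
  have hcu := isRep_jet hp hR (c • u)
  exact eqOn_closure_cube_of_ae_eq (hcu.cont α hα) ((hu.cont α hα).const_smul c)
    ((hcu.ae_eq α hα).trans ((wD_smul α c u).trans ((hu.ae_eq α hα).const_smul c).symm)) hx

/-- Evaluation of `D^α u`, `|α| ≤ 2`, at a point of the closed cube. -/
theorem exists_jet_clm {n p : ℕ} {R : ℝ} (hp : ⌈((n : ℝ) + 1) / 2⌉₊ + 2 < p) (hR : 0 < R)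
    {α : Fin (n + 1) → ℕ} (hα : ∑ i, α i ≤ 2) {x : E n} (hx : x ∈ closure (cube n R)) :
    ∃ L : Hp n p R →L[ℝ] ℝ, ∀ u, L u = jet u α x := by
  obtain ⟨C, -, hC⟩ := exists_abs_jet_le hp hR
  exact ⟨LinearMap.mkContinuous
    { toFun := fun u => jet u α x
      map_add' := fun u v => jet_add hp hR u v hα hx
      map_smul' := fun c u => jet_smul hp hR c u hα hx } C (fun u => hC u α hα x hx), fun _ => rfl⟩

theorem single_add_single {n : ℕ} (i : Fin (n + 1)) :
    (Pi.single i 1 + Pi.single i 1 : Fin (n + 1) → ℕ) = Pi.single i 2 := by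
  rw [← Pi.single_add]

theorem sum_single {n : ℕ} (i : Fin (n + 1)) (k : ℕ) :
    ∑ j, (Pi.single i k : Fin (n + 1) → ℕ) j = k := by simp

theorem IsRep.contDiffOn {n p : ℕ} {R : ℝ} {u : Hp n p R} {V : (Fin (n + 1) → ℕ) → E n → ℝ}
    (hV : IsRep u V) (hR : 0 < R) : ContDiffOn ℝ 2 (V 0) (closure (cube n R)) := by
  have hU := uniqueDiffOn_closure_cube n hR
  have h1 : ∀ i, ContDiffOn ℝ 1 (V (Pi.single i 1)) (closure (cube n R)) := by
    intro i
    rw [show (1 : WithTop ℕ∞) = 0 + 1 by simp, contDiffOn_succ_iff_hasFDerivWithinAt_of_uniqueDiffOn hU]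
    refine ⟨by simp, _, ?_, hV.deriv _ (by rw [sum_single])⟩
    rw [contDiffOn_zero]
    exact continuousOn_sum_smul_proj fun j => hV.cont _ (by rw [sum_add_single, sum_single])
  rw [show (2 : WithTop ℕ∞) = 1 + 1 by norm_num,
    contDiffOn_succ_iff_hasFDerivWithinAt_of_uniqueDiffOn hU]
  refine ⟨by simp, _, ?_, hV.deriv 0 (by simp)⟩
  simp only [zero_add]
  exact ContDiffOn.sum fun i _ => (h1 i).smul contDiffOn_const

theorem IsRep.fderivWithin_apply {n p : ℕ} {R : ℝ} {u : Hp n p R}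
    {V : (Fin (n + 1) → ℕ) → E n → ℝ} (hV : IsRep u V) (hR : 0 < R) {x : E n}
    (hx : x ∈ closure (cube n R)) (i : Fin (n + 1)) :
    fderivWithin ℝ (V 0) (closure (cube n R)) x (EuclideanSpace.single i 1) =
      V (Pi.single i 1) x := by
  rw [(hV.deriv 0 (by simp) x hx).fderivWithin (uniqueDiffOn_closure_cube n hR x hx)]
  simp [sum_apply]

theorem gammaPlus_subset {n : ℕ} {R : ℝ} (hR : 0 < R) :
    gammaPlus n R ⊆ closure (cube n R) := fun _ hx =>
  (mem_closure_cube hR).2 fun i => abs_le.1 (hx.1 i)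

/-- The boundary conditions in terms of the canonical representative. -/
theorem mem_bdrySet_iff {n p : ℕ} {R : ℝ} (hp : ⌈((n : ℝ) + 1) / 2⌉₊ + 2 < p) (hR : 0 < R)
    {f g : E n → ℝ} {u : Hp n p R} : u ∈ bdrySet n p R f g ↔
      (∀ x ∈ frontier (cube n R), jet u 0 x = f x) ∧
      ∀ x ∈ gammaPlus n R, jet u (Pi.single (Fin.last n) 1) x = g x := by
  have hu := isRep_jet hp hR u
  constructor
  · rintro ⟨U, hU2, hUae, hUf, hUg⟩
    have heq : EqOn U (jet u 0) (closure (cube n R)) :=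
      eqOn_closure_cube_of_ae_eq hU2.continuousOn (hu.cont 0 (by simp))
        (hUae.trans (hu.ae_eq 0 (by simp)).symm)
    refine ⟨fun x hx => ?_, fun x hx => ?_⟩
    · rw [← heq (frontier_subset_closure hx), hUf x hx]
    · have hx' := gammaPlus_subset hR hx
      rw [← hu.fderivWithin_apply hR hx', ← hUg x hx, fderivWithin_congr heq (heq hx')]
  · rintro ⟨h1, h2⟩
    refine ⟨jet u 0, hu.contDiffOn hR, hu.ae_eq 0 (by simp), h1, fun x hx => ?_⟩
    rw [hu.fderivWithin_apply hR (gammaPlus_subset hR hx), h2 x hx]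

/-- The closed subspace `H₀`. -/
def H0 {n p : ℕ} {R : ℝ} (hp : ⌈((n : ℝ) + 1) / 2⌉₊ + 2 < p) (hR : 0 < R) :
    Submodule ℝ (Hp n p R) where
  carrier := bdrySet n p R 0 0
  zero_mem' := by
    rw [mem_bdrySet_iff hp hR]
    refine ⟨fun x hx => ?_, fun x hx => ?_⟩
    · simpa using jet_smul hp hR 0 0 (α := 0) (by simp) (frontier_subset_closure hx)
    · simpa using jet_smul hp hR 0 0 (α := Pi.single (Fin.last n) 1) (by rw [sum_single]; norm_num)
        (gammaPlus_subset hR hx)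
  add_mem' := by
    intro u v hu hv
    rw [mem_bdrySet_iff hp hR] at *
    refine ⟨fun x hx => ?_, fun x hx => ?_⟩
    · rw [jet_add hp hR u v (by simp) (frontier_subset_closure hx), hu.1 x hx, hv.1 x hx]; simp
    · rw [jet_add hp hR u v (by rw [sum_single]; norm_num) (gammaPlus_subset hR hx), hu.2 x hx,
        hv.2 x hx]; simp
  smul_mem' := by
    intro c u hu
    rw [mem_bdrySet_iff hp hR] at *
    refine ⟨fun x hx => ?_, fun x hx => ?_⟩
    · rw [jet_smul hp hR c u (by simp) (frontier_subset_closure hx), hu.1 x hx]; simp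
    · rw [jet_smul hp hR c u (by rw [sum_single]; norm_num) (gammaPlus_subset hR hx), hu.2 x hx]
      simp

theorem mem_H0 {n p : ℕ} {R : ℝ} (hp : ⌈((n : ℝ) + 1) / 2⌉₊ + 2 < p) (hR : 0 < R)
    {u : Hp n p R} : u ∈ H0 hp hR ↔ u ∈ bdrySet n p R 0 0 := Iff.rfl

/-- An intersection of kernels of point evaluations, which the Sobolev embedding makes continuous.
Closedness is what the Riesz theorem on H₀ needs. -/
theorem isClosed_H0 {n p : ℕ} {R : ℝ} (hp : ⌈((n : ℝ) + 1) / 2⌉₊ + 2 < p) (hR : 0 < R) :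
    IsClosed (H0 hp hR : Set (Hp n p R)) := by
  have h : (H0 hp hR : Set (Hp n p R)) =
      (⋂ x ∈ frontier (cube n R), {u | jet u 0 x = 0}) ∩
      ⋂ x ∈ gammaPlus n R, {u | jet u (Pi.single (Fin.last n) 1) x = 0} := by
    ext u
    simp only [SetLike.mem_coe, mem_H0, mem_bdrySet_iff hp hR, Pi.zero_apply, mem_inter_iff,
      mem_iInter, mem_ofPred_eq]
  have key : ∀ α : Fin (n + 1) → ℕ, ∑ i, α i ≤ 2 → ∀ x ∈ closure (cube n R),
      IsClosed {u : Hp n p R | jet u α x = 0} := by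
    intro α hα x hx
    obtain ⟨L, hL⟩ := exists_jet_clm hp hR hα hx
    simp only [← hL]
    exact isClosed_eq L.continuous continuous_const
  rw [h]
  exact (isClosed_biInter fun x hx => key _ (by simp) x (frontier_subset_closure hx)).inter
    (isClosed_biInter fun x hx => key _ (by rw [sum_single]; norm_num) x (gammaPlus_subset hR hx))

theorem sub_mem_H0 {n p : ℕ} {R : ℝ} (hp : ⌈((n : ℝ) + 1) / 2⌉₊ + 2 < p) (hR : 0 < R)
    {f g : E n → ℝ} {u v : Hp n p R} (hu : u ∈ bdrySet n p R f g) (hv : v ∈ bdrySet n p R f g) :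
    u - v ∈ H0 hp hR := by
  rw [mem_H0, mem_bdrySet_iff hp hR] at *
  rw [sub_eq_add_neg, ← neg_one_smul ℝ v]
  refine ⟨fun x hx => ?_, fun x hx => ?_⟩
  · have hx' := frontier_subset_closure hx
    rw [jet_add hp hR _ _ (by simp) hx', jet_smul hp hR _ _ (by simp) hx', hu.1 x hx, hv.1 x hx]
    simp
  · have hx' := gammaPlus_subset hR hx
    rw [jet_add hp hR _ _ (by rw [sum_single]; norm_num) hx',
      jet_smul hp hR _ _ (by rw [sum_single]; norm_num) hx', hu.2 x hx, hv.2 x hx]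
    simp

theorem add_mem_bdrySet {n p : ℕ} {R : ℝ} (hp : ⌈((n : ℝ) + 1) / 2⌉₊ + 2 < p) (hR : 0 < R)
    {f g : E n → ℝ} {u h : Hp n p R} (hu : u ∈ bdrySet n p R f g) (hh : h ∈ H0 hp hR) :
    u + h ∈ bdrySet n p R f g := by
  rw [mem_H0, mem_bdrySet_iff hp hR] at *
  refine ⟨fun x hx => ?_, fun x hx => ?_⟩
  · rw [jet_add hp hR _ _ (by simp) (frontier_subset_closure hx), hu.1 x hx, hh.1 x hx]
    simp
  · rw [jet_add hp hR _ _ (by rw [sum_single]; norm_num) (gammaPlus_subset hR hx), hu.2 x hx,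
      hh.2 x hx]
    simp

/-- The continuous representative of `∇u`. -/
def jetGrad {n p : ℕ} {R : ℝ} (u : Hp n p R) (x : E n) : E n :=
  WithLp.toLp 2 fun i => jet u (Pi.single i 1) x

/-- The continuous representative of `Δu`. -/
def jetLap {n p : ℕ} {R : ℝ} (u : Hp n p R) (x : E n) : ℝ := ∑ i, jet u (Pi.single i 2) x

theorem jetGrad_add {n p : ℕ} {R : ℝ} (hp : ⌈((n : ℝ) + 1) / 2⌉₊ + 2 < p)
    (hR : 0 < R) (u v : Hp n p R) {x : E n} (hx : x ∈ closure (cube n R)) :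
    jetGrad (u + v) x = jetGrad u x + jetGrad v x := by
  ext i
  exact jet_add hp hR u v (by rw [sum_single]; norm_num) hx

theorem jetGrad_smul {n p : ℕ} {R : ℝ} (hp : ⌈((n : ℝ) + 1) / 2⌉₊ + 2 < p)
    (hR : 0 < R) (c : ℝ) (u : Hp n p R) {x : E n} (hx : x ∈ closure (cube n R)) :
    jetGrad (c • u) x = c • jetGrad u x := by
  ext i
  exact jet_smul hp hR c u (by rw [sum_single]; norm_num) hx

theorem jetLap_add {n p : ℕ} {R : ℝ} (hp : ⌈((n : ℝ) + 1) / 2⌉₊ + 2 < p)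
    (hR : 0 < R) (u v : Hp n p R) {x : E n} (hx : x ∈ closure (cube n R)) :
    jetLap (u + v) x = jetLap u x + jetLap v x := by
  simp only [jetLap, ← Finset.sum_add_distrib]
  exact Finset.sum_congr rfl fun i _ => jet_add hp hR u v (by rw [sum_single]) hx

theorem jetLap_smul {n p : ℕ} {R : ℝ} (hp : ⌈((n : ℝ) + 1) / 2⌉₊ + 2 < p)
    (hR : 0 < R) (c : ℝ) (u : Hp n p R) {x : E n} (hx : x ∈ closure (cube n R)) :
    jetLap (c • u) x = c * jetLap u x := by
  simp only [jetLap, Finset.mul_sum]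
  exact Finset.sum_congr rfl fun i _ => jet_smul hp hR c u (by rw [sum_single]) hx

theorem continuousOn_jet_zero {n p : ℕ} {R : ℝ} (hp : ⌈((n : ℝ) + 1) / 2⌉₊ + 2 < p)
    (hR : 0 < R) (u : Hp n p R) : ContinuousOn (jet u 0) (closure (cube n R)) :=
  (isRep_jet hp hR u).cont 0 (by simp)

theorem continuousOn_jetGrad {n p : ℕ} {R : ℝ} (hp : ⌈((n : ℝ) + 1) / 2⌉₊ + 2 < p)
    (hR : 0 < R) (u : Hp n p R) : ContinuousOn (jetGrad u) (closure (cube n R)) := by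
  refine (PiLp.continuous_toLp 2 _).comp_continuousOn (continuousOn_pi.2 fun i => ?_)
  exact (isRep_jet hp hR u).cont _ (by rw [sum_single]; norm_num)

theorem continuousOn_jetLap {n p : ℕ} {R : ℝ} (hp : ⌈((n : ℝ) + 1) / 2⌉₊ + 2 < p)
    (hR : 0 < R) (u : Hp n p R) : ContinuousOn (jetLap u) (closure (cube n R)) :=
  continuousOn_finsetSum _ fun i _ => (isRep_jet hp hR u).cont _ (by rw [sum_single])

theorem exists_jet_bounds {n p : ℕ} {R : ℝ} (hp : ⌈((n : ℝ) + 1) / 2⌉₊ + 2 < p)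
    (hR : 0 < R) : ∃ C : ℝ, 0 < C ∧ ∀ (u : Hp n p R), ∀ x ∈ closure (cube n R),
    |jet u 0 x| ≤ C * ‖u‖ ∧ ‖jetGrad u x‖ ≤ C * ‖u‖ ∧ |jetLap u x| ≤ C * ‖u‖ := by
  obtain ⟨C, hC0, hC⟩ := exists_abs_jet_le hp hR
  have hn : (0 : ℝ) ≤ n := Nat.cast_nonneg n
  refine ⟨(n + 1) * C, by positivity, fun u x hx => ⟨?_, ?_, ?_⟩⟩
  · refine (hC u 0 (by simp) x hx).trans ?_
    have := mul_nonneg hn (mul_nonneg hC0.le (norm_nonneg u))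
    nlinarith
  · rw [← (EuclideanSpace.basisFun (Fin (n + 1)) ℝ).sum_repr (jetGrad u x)]
    refine (norm_sum_le _ _).trans ?_
    calc _ ≤ ∑ _i : Fin (n + 1), C * ‖u‖ := Finset.sum_le_sum fun i _ => by
          rw [norm_smul]
          simpa [jetGrad] using hC u (Pi.single i 1) (by rw [sum_single]; norm_num) x hx
      _ = _ := by simp; ring
  · refine (Finset.abs_sum_le_sum_abs _ _).trans ?_
    calc _ ≤ ∑ _i : Fin (n + 1), C * ‖u‖ := Finset.sum_le_sum fun i _ =>
          hC u (Pi.single i 2) (by rw [sum_single]) x hx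
      _ = _ := by simp; ring

theorem ae_eq_jets {n p : ℕ} {R : ℝ} (hp : ⌈((n : ℝ) + 1) / 2⌉₊ + 2 < p)
    (hR : 0 < R) (u : Hp n p R) : ∀ᵐ x ∂(cubeMeasure n R),
    val u x = jet u 0 x ∧ grad u x = jetGrad u x ∧ lap u x = jetLap u x := by
  have hu := isRep_jet hp hR u
  have h1 : ∀ i, ∀ᵐ x ∂(cubeMeasure n R), jet u (Pi.single i 1) x = wD (Pi.single i 1) u x :=
    fun i => hu.ae_eq _ (by rw [sum_single]; norm_num)
  have h2 : ∀ i, ∀ᵐ x ∂(cubeMeasure n R), jet u (Pi.single i 2) x = wD (Pi.single i 2) u x :=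
    fun i => hu.ae_eq _ (by rw [sum_single])
  filter_upwards [hu.ae_eq 0 (by simp), ae_all_iff.2 h1, ae_all_iff.2 h2] with x hx0 hx1 hx2
  refine ⟨hx0.symm, ?_, ?_⟩
  · simp only [grad, jetGrad, hx1]
  · simp only [lap, jetLap, hx2]

/-! ### The divergence theorem on the cube -/

theorem frontier_cube_ae (n : ℕ) (R : ℝ) :
    (closure (cube n R) : Set (E n)) =ᵐ[volume] cube n R := by
  have h : volume (frontier (cube n R)) = 0 := (convex_cube n R).addHaar_frontier volume
  exact closure_ae_eq_of_null_frontier h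

theorem continuousOn_integrable {n : ℕ} {R : ℝ} {f : E n → ℝ}
    (hf : ContinuousOn f (closure (cube n R))) : Integrable f (cubeMeasure n R) :=
  (hf.integrableOn_compact (isCompact_closure_cube n R)).mono_set subset_closure

/-- If the field `V` points outwards on the boundary of the cube, its divergence has a
nonnegative integral. -/
theorem integral_divergence_nonneg {n : ℕ} {R : ℝ} (hR : 0 < R) {V : Fin (n + 1) → E n → ℝ}
    {D : E n → ℝ} (hVc : ∀ i, ContinuousOn (V i) (closure (cube n R)))
    (hVd : ∀ x ∈ cube n R, ∀ i, DifferentiableAt ℝ (V i) x)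
    (hD : ∀ x ∈ cube n R, ∑ i, fderiv ℝ (V i) x (EuclideanSpace.single i 1) = D x)
    (hDc : ContinuousOn D (closure (cube n R)))
    (hfront : ∀ x ∈ closure (cube n R), ∀ i, x i = R → 0 ≤ V i x)
    (hback : ∀ x ∈ closure (cube n R), ∀ i, x i = -R → V i x ≤ 0) :
    0 ≤ ∫ x, D x ∂(cubeMeasure n R) := by
  let e : (Fin (n + 1) → ℝ) ≃L[ℝ] E n := (EuclideanSpace.equiv (Fin (n + 1)) ℝ).symm
  have he : ∀ y i, e y i = y i := fun y i => rfl
  have hemeas : MeasurePreserving e volume volume := PiLp.volume_preserving_toLp _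
  have heemb : MeasurableEmbedding e := e.toHomeomorph.measurableEmbedding
  let a : Fin (n + 1) → ℝ := fun _ => -R
  let b : Fin (n + 1) → ℝ := fun _ => R
  have hIcc : e ⁻¹' closure (cube n R) = Icc a b := by
    ext y
    rw [mem_preimage, mem_closure_cube hR]
    simp only [he, mem_Icc, Pi.le_def, a, b]
    exact ⟨fun h => ⟨fun i => (h i).1, fun i => (h i).2⟩, fun h i => ⟨h.1 i, h.2 i⟩⟩
  have hmem : ∀ y ∈ Icc a b, e y ∈ closure (cube n R) := fun y hy => by
    rw [← hIcc] at hy; exact hy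
  have hIoo : ∀ y ∈ pi univ fun i => Ioo (a i) (b i), e y ∈ cube n R := fun y hy i =>
    hy i (mem_univ i)
  have hint : ∀ f : E n → ℝ, ∫ y in Icc a b, f (e y) = ∫ x in cube n R, f x := by
    intro f
    rw [← hIcc, hemeas.setIntegral_preimage_emb heemb, setIntegral_congr_set (frontier_cube_ae n R)]
  -- The derivatives are known only in the open box; the faces have measure zero.
  have hae : ∀ᵐ y ∂(volume.restrict (Icc a b)),
      D (e y) = ∑ i, (fderiv ℝ (V i) (e y)).comp (e : (Fin (n + 1) → ℝ) →L[ℝ] E n)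
        (Pi.single i 1) := by
    rw [volume_pi, ← Measure.restrict_congr_set Measure.univ_pi_Ioo_ae_eq_Icc]
    refine (ae_restrict_iff' (MeasurableSet.univ_pi fun _ => measurableSet_Ioo)).2
      (Eventually.of_forall fun y hy => ?_)
    rw [← hD _ (hIoo y hy)]
    rfl
  have hDi : IntegrableOn (fun y => D (e y)) (Icc a b) := by
    rw [← hIcc]
    exact (hemeas.integrableOn_comp_preimage heemb).2
      (hDc.integrableOn_compact (isCompact_closure_cube n R))
  have key := integral_divergence_of_hasFDerivAt_off_countable' a b
    (fun i => by simp only [a, b]; linarith) (fun i y => V i (e y))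
    (fun i y => (fderiv ℝ (V i) (e y)).comp (e : (Fin (n + 1) → ℝ) →L[ℝ] E n)) ∅ countable_empty
    (fun i => (hVc i).comp e.continuous.continuousOn fun y hy => hmem y hy)
    (fun y hy i => (hVd _ (hIoo y hy.1) i).hasFDerivAt.comp y e.hasFDerivAt)
    (hDi.congr hae)
  rw [← integral_congr_ae hae, hint] at key
  rw [key]
  have hins : ∀ (i : Fin (n + 1)) (c : ℝ), c ∈ Icc (-R) R →
      ∀ y ∈ Icc (a ∘ i.succAbove) (b ∘ i.succAbove), e (i.insertNth c y) ∈ closure (cube n R) := by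
    intro i c hc y hy
    refine (mem_closure_cube hR).2 fun j => ?_
    rw [he]
    induction j using Fin.succAboveCases i with
    | x => simpa using hc
    | p j => simpa using ⟨hy.1 j, hy.2 j⟩
  refine Finset.sum_nonneg fun i _ => sub_nonneg.2 (le_trans (b := 0) ?_ ?_)
  · refine setIntegral_nonpos measurableSet_Icc fun y hy => ?_
    exact hback _ (hins i _ ⟨le_rfl, show -R ≤ R by linarith⟩ y hy) i (by rw [he]; simp)
  · refine setIntegral_nonneg measurableSet_Icc fun y hy => ?_
    exact hfront _ (hins i _ ⟨show -R ≤ R by linarith, le_rfl⟩ y hy) i (by rw [he]; simp)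

/-! ### A Carleman estimate -/

theorem mem_frontier_cube {n : ℕ} {R : ℝ} {x : E n} (hx : x ∈ closure (cube n R))
    {i : Fin (n + 1)} (hi : x i = R ∨ x i = -R) : x ∈ frontier (cube n R) := by
  rw [(isOpen_cube n R).frontier_eq]
  refine ⟨hx, fun h => ?_⟩
  have := h i
  rcases hi with hi | hi <;> rw [hi] at this
  · exact lt_irrefl _ this.2
  · exact lt_irrefl _ this.1

/-- The tangential derivatives of a function that vanishes on the boundary of the cube. -/
theorem jet_tangential_eq_zero {n p : ℕ} {R : ℝ} (hp : ⌈((n : ℝ) + 1) / 2⌉₊ + 2 < p) (hR : 0 < R)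
    {h : Hp n p R} (hh : ∀ x ∈ frontier (cube n R), jet h 0 x = 0) {x : E n}
    (hx : x ∈ closure (cube n R)) {i j : Fin (n + 1)} (hij : i ≠ j) (hj : x j = R ∨ x j = -R) :
    jet h (Pi.single i 1) x = 0 := by
  have hx' := (mem_closure_cube hR).1 hx
  -- Moving x_i towards the farther end of [−R, R] keeps the face x_j fixed and gives a
  -- nondegenerate segment even from an edge; a one-sided derivative along it suffices.
  obtain ⟨c, hc, hcx⟩ : ∃ c ∈ Icc (-R) R, c - x i ≠ 0 := by
    rcases le_or_gt (x i) 0 with h0 | h0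
    · exact ⟨R, ⟨by linarith, le_rfl⟩, by linarith⟩
    · exact ⟨-R, ⟨le_rfl, by linarith⟩, by linarith⟩
  let v : E n := EuclideanSpace.single i (c - x i)
  have hv : ∀ k, v k = if k = i then c - x i else 0 := fun k => by
    simp [v]
  have hline : ∀ t ∈ Icc (0 : ℝ) 1, x + t • v ∈ closure (cube n R) ∧ (x + t • v) j = x j := by
    intro t ht
    constructor
    · refine (mem_closure_cube hR).2 fun k => ?_
      rw [PiLp.add_apply, PiLp.smul_apply, hv, smul_eq_mul]
      split_ifs with hk
      · subst hk
        have h1 := hx' k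
        have h2 := ht.1
        have h3 := sub_nonneg.2 ht.2
        constructor
        · nlinarith [mul_nonneg h2 (sub_nonneg.2 hc.1), mul_nonneg h3 (sub_nonneg.2 h1.1)]
        · nlinarith [mul_nonneg h2 (sub_nonneg.2 hc.2), mul_nonneg h3 (sub_nonneg.2 h1.2)]
      · simpa using hx' k
    · rw [PiLp.add_apply, PiLp.smul_apply, hv, if_neg hij.symm]; simp
  have hzero : ∀ t ∈ Icc (0 : ℝ) 1, jet h 0 (x + t • v) = 0 := fun t ht =>
    hh _ (mem_frontier_cube (hline t ht).1 (i := j) (by rw [(hline t ht).2]; exact hj))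
  have hd := (isRep_jet hp hR h).deriv 0 (by simp) x hx
  have hl : HasDerivWithinAt (fun t : ℝ => x + t • v) v (Icc 0 1) 0 := by
    simpa using (((hasDerivAt_id (0 : ℝ)).smul_const v).const_add x).hasDerivWithinAt
  have h1 : HasDerivWithinAt (fun t : ℝ => jet h 0 (x + t • v))
      ((∑ i, jet h (0 + Pi.single i 1) x • (EuclideanSpace.proj i : E n →L[ℝ] ℝ)) v)
      (Icc 0 1) 0 :=
    HasFDerivWithinAt.comp_hasDerivWithinAt_of_eq (t := closure (cube n R)) (0 : ℝ) hd hl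
      (fun t ht => (hline t ht).1) (by simp)
  have h2 : HasDerivWithinAt (fun t : ℝ => jet h 0 (x + t • v)) 0 (Icc 0 1) 0 :=
    (hasDerivWithinAt_const (0 : ℝ) (Icc 0 1) (0 : ℝ)).congr hzero (hzero 0 (by simp))
  have h3 := (uniqueDiffOn_Icc zero_lt_one (0 : ℝ) (by simp)).eq_deriv _ h1 h2
  have hproj : ∀ k, (EuclideanSpace.proj k : E n →L[ℝ] ℝ) v = v k := fun _ => rfl
  simp only [zero_add, sum_apply, smul_apply, hproj, smul_eq_mul, hv,
    mul_ite, mul_zero, Finset.sum_ite_eq', Finset.mem_univ, if_true] at h3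
  exact (mul_eq_zero.1 h3).resolve_right hcx

/-- The weight functions of the Carleman estimate: `ψ₀`, increasing and convex, and its first three
derivatives. -/
structure IsWeightProfile (R : ℝ) (ψ₀ ψ₁ ψ₂ ψ₃ : ℝ → ℝ) (l B : ℝ) : Prop where
  deriv_zero : ∀ z ∈ Icc (-R) R, HasDerivAt ψ₀ (ψ₁ z) z
  deriv_one : ∀ z ∈ Icc (-R) R, HasDerivAt ψ₁ (ψ₂ z) z
  deriv_two : ∀ z ∈ Icc (-R) R, HasDerivAt ψ₂ (ψ₃ z) z
  cont_three : ContinuousOn ψ₃ (Icc (-R) R)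
  pos : 0 < l
  le_one : ∀ z ∈ Icc (-R) R, l ≤ ψ₁ z
  le_two : ∀ z ∈ Icc (-R) R, l ≤ ψ₂ z
  one_le : ∀ z ∈ Icc (-R) R, ψ₁ z ≤ B
  two_le : ∀ z ∈ Icc (-R) R, ψ₂ z ≤ B
  three_le : ∀ z ∈ Icc (-R) R, |ψ₃ z| ≤ B

theorem continuousOn_comp_zCoord {n : ℕ} {R : ℝ} (hR : 0 < R) {f : ℝ → ℝ}
    (hf : ContinuousOn f (Icc (-R) R)) :
    ContinuousOn (fun x : E n => f (zCoord x)) (closure (cube n R)) :=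
  hf.comp (by unfold zCoord; fun_prop) fun _ hx => (mem_closure_cube hR).1 hx (Fin.last n)

/-- The vector field whose divergence yields the Carleman estimate. -/
def carlemanField {n p : ℕ} {R : ℝ} (w m q : ℝ → ℝ) (h : Hp n p R) (i : Fin (n + 1)) (x : E n) :
    ℝ :=
  -(w (zCoord x) * (2 * jet h (Pi.single (Fin.last n) 1) x + m (zCoord x) * jet h 0 x) *
      jet h (Pi.single i 1) x) +
    (if i = Fin.last n then 1 else 0) *
      (w (zCoord x) * ∑ j, jet h (Pi.single j 1) x * jet h (Pi.single j 1) x +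
        q (zCoord x) * (jet h 0 x * jet h 0 x))

theorem hasFDerivAt_jet {n p : ℕ} {R : ℝ} (hp : ⌈((n : ℝ) + 1) / 2⌉₊ + 2 < p) (hR : 0 < R)
    (h : Hp n p R) {α : Fin (n + 1) → ℕ} (hα : ∑ i, α i ≤ 1) {x : E n} (hx : x ∈ cube n R) :
    ∃ L : E n →L[ℝ] ℝ, HasFDerivAt (jet h α) L x ∧
      ∀ i, L (EuclideanSpace.single i 1) = jet h (α + Pi.single i 1) x := by
  refine ⟨_, ((isRep_jet hp hR h).deriv α hα x (subset_closure hx)).hasFDerivAt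
    (mem_of_superset ((isOpen_cube n R).mem_nhds hx) subset_closure), fun i => ?_⟩
  simp [sum_apply]

theorem hasFDerivAt_comp_zCoord {n : ℕ} {f : ℝ → ℝ} {f' : ℝ} {x : E n}
    (hf : HasDerivAt f f' (zCoord x)) : ∃ L : E n →L[ℝ] ℝ,
      HasFDerivAt (fun x : E n => f (zCoord x)) L x ∧
      ∀ i, L (EuclideanSpace.single i 1) = if i = Fin.last n then f' else 0 := by
  refine ⟨_, hf.comp_hasFDerivAt x (EuclideanSpace.proj (𝕜 := ℝ) (Fin.last n)).hasFDerivAt,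
    fun i => ?_⟩
  simp [eq_comm]

/-- The divergence of the Carleman field. -/
theorem divergence_carlemanField {n p : ℕ} {R : ℝ} (hp : ⌈((n : ℝ) + 1) / 2⌉₊ + 2 < p)
    (hR : 0 < R) {w m q : ℝ → ℝ} {w' m' q' : ℝ} (h : Hp n p R) {x : E n} (hx : x ∈ cube n R)
    (hw : HasDerivAt w w' (zCoord x)) (hm : HasDerivAt m m' (zCoord x))
    (hq : HasDerivAt q q' (zCoord x)) :
    (∀ i, DifferentiableAt ℝ (carlemanField w m q h i) x) ∧
    ∑ i, fderiv ℝ (carlemanField w m q h i) x (EuclideanSpace.single i 1) =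
      -(w (zCoord x) * (2 * jet h (Pi.single (Fin.last n) 1) x + m (zCoord x) * jet h 0 x) *
        jetLap h x)
      - w' * (2 * jet h (Pi.single (Fin.last n) 1) x + m (zCoord x) * jet h 0 x) *
        jet h (Pi.single (Fin.last n) 1) x
      - w (zCoord x) * m' * jet h 0 x * jet h (Pi.single (Fin.last n) 1) x
      + (w' - w (zCoord x) * m (zCoord x)) *
        ∑ j, jet h (Pi.single j 1) x * jet h (Pi.single j 1) x
      + q' * (jet h 0 x * jet h 0 x)
      + 2 * q (zCoord x) * jet h 0 x * jet h (Pi.single (Fin.last n) 1) x := by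
  obtain ⟨dw, hdw, hdw'⟩ := hasFDerivAt_comp_zCoord hw
  obtain ⟨dm, hdm, hdm'⟩ := hasFDerivAt_comp_zCoord hm
  obtain ⟨dq, hdq, hdq'⟩ := hasFDerivAt_comp_zCoord hq
  obtain ⟨dU, hdU, hdU'⟩ := hasFDerivAt_jet hp hR h (α := 0) (by simp) hx
  choose dP hdP hdP' using fun i : Fin (n + 1) =>
    hasFDerivAt_jet hp hR h (α := Pi.single i 1) (by rw [sum_single]) hx
  have hV : ∀ i, HasFDerivAt (carlemanField w m q h i) _ x := fun i =>
    ((hdw.mul (((hdP (Fin.last n)).const_mul 2).add (hdm.mul hdU))).mul (hdP i)).neg.add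
      (((hdw.mul (HasFDerivAt.fun_sum fun j (_ : j ∈ Finset.univ) => (hdP j).mul (hdP j))).add
        (hdq.mul (hdU.mul hdU))).const_mul (if i = Fin.last n then (1 : ℝ) else 0))
  refine ⟨fun i => (hV i).differentiableAt, ?_⟩
  simp only [(hV _).fderiv, add_apply, neg_apply, smul_apply, sum_apply, smul_eq_mul, hdw', hdm',
    hdq', hdU', hdP', zero_add, Pi.add_apply, Pi.mul_apply, Finset.sum_add_distrib,
    Finset.sum_neg_distrib, ite_mul, one_mul, zero_mul, mul_ite, mul_zero, Finset.sum_ite_eq',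
    Finset.mem_univ, if_true, mul_add, single_add_single, jetLap]
  -- The mixed second derivatives from the multiplier 2h_z cancel those from the gradient of |∇h|²,
  -- leaving only the Laplacian.
  have h1 : ∑ i, jet h (Pi.single i 1) x *
      (w (zCoord x) * (2 * jet h (Pi.single (Fin.last n) 1 + Pi.single i 1) x)) =
      2 * w (zCoord x) *
        ∑ i, jet h (Pi.single i 1) x * jet h (Pi.single i 1 + Pi.single (Fin.last n) 1) x := by
    rw [Finset.mul_sum]
    refine Finset.sum_congr rfl fun i _ => ?_
    rw [add_comm (Pi.single (Fin.last n) 1)]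
    ring
  have h2 : ∑ i, jet h (Pi.single i 1) x *
      (w (zCoord x) * (m (zCoord x) * jet h (Pi.single i 1) x)) =
      w (zCoord x) * m (zCoord x) * ∑ i, jet h (Pi.single i 1) x * jet h (Pi.single i 1) x := by
    rw [Finset.mul_sum]
    exact Finset.sum_congr rfl fun i _ => by ring
  rw [h1, h2, ← Finset.mul_sum]
  ring

/-- Write φ = λs₁, φ′ = λs₂ and a = P + φU. The multiplier 2P + (2φ + c)U equals 2a + cU, and the
gradient term is −cS. The UP terms add up to −8φ²UP, which with −4φP² gives −4φa² + 4φ³U²; the cubic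
term cancels the one coming from q′. What remains is −ZU², where Z has order λ² and is positive by
the convexity bound s₂ ≥ l. -/
theorem carleman_pointwise {lam l B c s₁ s₂ s₃ w P U L S : ℝ} (hl : 0 < l) (hc : c = l / (2 * B))
    (hlB : l ≤ B) (hlam : (c * B + B + c ^ 2 * B / 2 + c) / l ^ 2 + 1 ≤ lam)
    (h1 : l ≤ s₁) (h1' : s₁ ≤ B) (h2 : l ≤ s₂) (h2' : s₂ ≤ B) (h3 : |s₃| ≤ B) (hw : 0 ≤ w) :
    -(w * (2 * P + (2 * (lam * s₁) + c) * U) * L)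
      - w * (2 * (lam * s₁)) * (2 * P + (2 * (lam * s₁) + c) * U) * P
      - w * (2 * (lam * s₂)) * U * P
      + (w * (2 * (lam * s₁)) - w * (2 * (lam * s₁) + c)) * S
      + (w * (2 * (lam * s₁)) * (-2 * (lam * s₁) ^ 2 + c * (lam * s₁) + lam * s₂) +
          w * (-4 * (lam * s₁) * (lam * s₂) + c * (lam * s₂) + lam * s₃)) * (U * U)
      + 2 * (w * (-2 * (lam * s₁) ^ 2 + c * (lam * s₁) + lam * s₂)) * U * P ≤
    1 / (lam * l) * (w * L ^ 2) - c * (w * (S + U ^ 2)) := by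
  have hB : 0 < B := hl.trans_le hlB
  have hc0 : 0 < c := by rw [hc]; positivity
  have hX : 0 ≤ c * B + B + c ^ 2 * B / 2 + c := by positivity
  set X := c * B + B + c ^ 2 * B / 2 + c with hXdef
  have hlam1 : 1 ≤ lam := by
    have : 0 ≤ X / l ^ 2 := by positivity
    linarith
  have hlamX : X ≤ lam * l ^ 2 := by
    have h : X / l ^ 2 ≤ lam := by linarith
    rwa [div_le_iff₀ (by positivity)] at h
  have hs1 : 0 < s₁ := hl.trans_le h1
  have hφ : 0 < lam * s₁ := by positivity
  -- The reason for c = l/(2B): subtracting 2cφ² from 2φφ′ leaves at least φφ′.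
  have hcs : 2 * c * s₁ ≤ s₂ := by
    have : 2 * c * B = l := by rw [hc]; field_simp
    have := mul_le_mul_of_nonneg_left h1' (by positivity : 0 ≤ 2 * c)
    linarith
  have hZ : c ≤ 2 * (lam * s₁) * (lam * s₂) - 2 * c * (lam * s₁) ^ 2 - c * (lam * s₂) - lam * s₃
      - c ^ 2 * (lam * s₁) / 2 := by
    have e1 : lam ^ 2 * l ^ 2 ≤ 2 * (lam * s₁) * (lam * s₂) - 2 * c * (lam * s₁) ^ 2 := by
      have f1 : lam ^ 2 * s₁ * (2 * c * s₁) ≤ lam ^ 2 * s₁ * s₂ :=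
        mul_le_mul_of_nonneg_left hcs (by positivity)
      have f2 : lam ^ 2 * (l * l) ≤ lam ^ 2 * (s₁ * s₂) :=
        mul_le_mul_of_nonneg_left (mul_le_mul h1 h2 hl.le hs1.le) (by positivity)
      nlinarith
    have e2 : c * (lam * s₂) + lam * s₃ + c ^ 2 * (lam * s₁) / 2 ≤ lam * (X - c) := by
      have f1 : c * s₂ ≤ c * B := mul_le_mul_of_nonneg_left h2' hc0.le
      have f2 : s₃ ≤ B := (abs_le.1 h3).2
      have f3 : c ^ 2 * s₁ ≤ c ^ 2 * B := mul_le_mul_of_nonneg_left h1' (by positivity)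
      have f4 : lam * (c * s₂ + s₃ + c ^ 2 * s₁ / 2) ≤ lam * (X - c) :=
        mul_le_mul_of_nonneg_left (by rw [hXdef]; linarith) (by linarith)
      linarith
    -- The gain λ²l² ≥ λX pays for the lower-order terms, at most λ(X − c), and leaves λc ≥ c.
    have e3 : lam * X ≤ lam * (lam * l ^ 2) := mul_le_mul_of_nonneg_left hlamX (by linarith)
    nlinarith
  set a := P + lam * s₁ * U with ha
  set Z := 2 * (lam * s₁) * (lam * s₂) - 2 * c * (lam * s₁) ^ 2 - c * (lam * s₂) - lam * s₃ with hZdef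
  have hmain : -(2 * a + c * U) * L - 4 * (lam * s₁) * a ^ 2 - Z * U ^ 2 ≤
      1 / (lam * l) * L ^ 2 - c * U ^ 2 := by
    have g0 : 1 / (lam * s₁) * L ^ 2 ≤ 1 / (lam * l) * L ^ 2 := by gcongr
    set i := 1 / (lam * s₁) with hi
    have hii : i * (lam * s₁) = 1 := by rw [hi]; field_simp
    have hi0 : 0 < i := by positivity
    -- Young's inequality, twice: `g1` and `g2` each use half of L²/φ, the other sides going into
    -- 4φa² and into ZU².
    have g1 : -(2 * a * L) ≤ 2 * (lam * s₁) * a ^ 2 + i * L ^ 2 / 2 := by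
      have : 0 ≤ i * (2 * (lam * s₁) * a + L) ^ 2 := by positivity
      have e : i * (2 * (lam * s₁) * a + L) ^ 2 =
        4 * (i * (lam * s₁)) * (lam * s₁) * a ^ 2 + 4 * (i * (lam * s₁)) * a * L + i * L ^ 2 := by ring
      rw [e, hii] at this
      linarith
    have g2 : -(c * U * L) ≤ c ^ 2 * (lam * s₁) / 2 * U ^ 2 + i * L ^ 2 / 2 := by
      have : 0 ≤ i * ((lam * s₁) * (c * U) + L) ^ 2 := by positivity
      have e : i * ((lam * s₁) * (c * U) + L) ^ 2 =
        (i * (lam * s₁)) * (lam * s₁) * (c * U) ^ 2 + 2 * (i * (lam * s₁)) * (c * U) * L +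
          i * L ^ 2 := by ring
      rw [e, hii] at this
      linarith
    have g3 : c * U ^ 2 ≤ (Z - c ^ 2 * (lam * s₁) / 2) * U ^ 2 :=
      mul_le_mul_of_nonneg_right hZ (sq_nonneg U)
    have g4 : 0 ≤ (lam * s₁) * a ^ 2 := by positivity
    linarith
  have := mul_le_mul_of_nonneg_left hmain hw
  rw [ha, hZdef] at this
  linarith

/-- On a lateral face h_z is tangential, so the factor 2h_z + mh vanishes; on Γ⁺ the condition h_z =
0 removes the remaining normal derivative. -/
theorem carlemanField_front {n p : ℕ} {R : ℝ} (hp : ⌈((n : ℝ) + 1) / 2⌉₊ + 2 < p) (hR : 0 < R)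
    {w m q : ℝ → ℝ} {h : Hp n p R} (hh : h ∈ H0 hp hR) {x : E n} (hx : x ∈ closure (cube n R))
    {i : Fin (n + 1)} (hi : x i = R) : carlemanField w m q h i x = 0 := by
  rw [mem_H0, mem_bdrySet_iff hp hR] at hh
  have hU : jet h 0 x = 0 := hh.1 x (mem_frontier_cube hx (Or.inl hi))
  have hP : ∀ j, j ≠ i → jet h (Pi.single j 1) x = 0 := fun j hj =>
    jet_tangential_eq_zero hp hR hh.1 hx hj (Or.inl hi)
  by_cases hz : i = Fin.last n
  · have hPz : jet h (Pi.single (Fin.last n) 1) x = 0 := by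
      refine hh.2 x ⟨fun j => abs_le.2 ((mem_closure_cube hR).1 hx j), ?_⟩
      rw [zCoord, ← hz, hi]
    have hP' : ∀ j, jet h (Pi.single j 1) x = 0 := fun j => by
      by_cases hj : j = i
      · rw [hj, hz, hPz]
      · exact hP j hj
    simp [carlemanField, hU, hP']
  · simp [carlemanField, hU, hP (Fin.last n) (Ne.symm hz), hz]

/-- On z = −R the normal derivative is free, but the field reduces to −2wh_z² + wh_z² = −wh_z²,
which has the outward sign. -/
theorem carlemanField_back {n p : ℕ} {R : ℝ} (hp : ⌈((n : ℝ) + 1) / 2⌉₊ + 2 < p) (hR : 0 < R)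
    {w m q : ℝ → ℝ} (hw : ∀ z, 0 ≤ w z) {h : Hp n p R} (hh : h ∈ H0 hp hR) {x : E n}
    (hx : x ∈ closure (cube n R)) {i : Fin (n + 1)} (hi : x i = -R) :
    carlemanField w m q h i x ≤ 0 := by
  rw [mem_H0, mem_bdrySet_iff hp hR] at hh
  have hU : jet h 0 x = 0 := hh.1 x (mem_frontier_cube hx (Or.inr hi))
  have hP : ∀ j, j ≠ i → jet h (Pi.single j 1) x = 0 := fun j hj =>
    jet_tangential_eq_zero hp hR hh.1 hx hj (Or.inr hi)
  by_cases hz : i = Fin.last n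
  · subst hz
    have hS : ∑ j, jet h (Pi.single j 1) x * jet h (Pi.single j 1) x =
        jet h (Pi.single (Fin.last n) 1) x * jet h (Pi.single (Fin.last n) 1) x :=
      Finset.sum_eq_single _ (fun j _ hj => by rw [hP j hj, mul_zero]) (by simp)
    rw [carlemanField, hS, hU, if_pos rfl]
    nlinarith [mul_nonneg (hw (zCoord x)) (mul_self_nonneg (jet h (Pi.single (Fin.last n) 1) x))]
  · simp [carlemanField, hU, hP (Fin.last n) (Ne.symm hz), hz]

theorem norm_jetGrad_sq {n p : ℕ} {R : ℝ} (h : Hp n p R) (x : E n) :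
    ‖jetGrad h x‖ ^ 2 = ∑ j, jet h (Pi.single j 1) x * jet h (Pi.single j 1) x := by
  rw [EuclideanSpace.real_norm_sq_eq]
  exact Finset.sum_congr rfl fun j _ => by rw [jetGrad, sq]

/-- **Carleman estimate** for the Laplacian on `H₀`. -/
theorem exists_carleman {n p : ℕ} {R : ℝ} (hp : ⌈((n : ℝ) + 1) / 2⌉₊ + 2 < p) (hR : 0 < R)
    {ψ₀ ψ₁ ψ₂ ψ₃ : ℝ → ℝ} {l B : ℝ} (hψ : IsWeightProfile R ψ₀ ψ₁ ψ₂ ψ₃ l B) :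
    ∃ k lam₁ : ℝ, 0 < k ∧ 0 < lam₁ ∧ ∀ lam, lam₁ ≤ lam → ∀ h ∈ H0 hp hR (n := n) (p := p),
      k * lam * ∫ x, Real.exp (2 * lam * ψ₀ (zCoord x)) * (‖jetGrad h x‖ ^ 2 + jet h 0 x ^ 2)
        ∂(cubeMeasure n R) ≤
      ∫ x, Real.exp (2 * lam * ψ₀ (zCoord x)) * jetLap h x ^ 2 ∂(cubeMeasure n R) := by
  have hl := hψ.pos
  have hlB : l ≤ B := (hψ.le_one 0 (by simp [hR.le])).trans (hψ.one_le 0 (by simp [hR.le]))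
  have hB : 0 < B := hl.trans_le hlB
  obtain ⟨c, hc⟩ : ∃ c, c = l / (2 * B) := ⟨_, rfl⟩
  have hc0 : 0 < c := by rw [hc]; positivity
  refine ⟨c * l, (c * B + B + c ^ 2 * B / 2 + c) / l ^ 2 + 1, by positivity, by positivity,
    fun lam hlam h hh => ?_⟩
  have hlam0 : 0 < lam := lt_of_lt_of_le (by positivity) hlam
  set w : ℝ → ℝ := fun z => Real.exp (2 * lam * ψ₀ z) with hw
  -- m exceeds w′/w = 2λψ₁ by c, so that w′ − wm = −cw multiplies |∇h|²; Q then completes the square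
  -- in h_z + λψ₁h.
  let m : ℝ → ℝ := fun z => 2 * (lam * ψ₁ z) + c
  let Q : ℝ → ℝ := fun z => -2 * (lam * ψ₁ z) ^ 2 + c * (lam * ψ₁ z) + lam * ψ₂ z
  let q : ℝ → ℝ := fun z => w z * Q z
  let w' : ℝ → ℝ := fun z => w z * (2 * (lam * ψ₁ z))
  let m' : ℝ → ℝ := fun z => 2 * (lam * ψ₂ z)
  let q' : ℝ → ℝ := fun z => w z * (2 * (lam * ψ₁ z)) * Q z +
    w z * (-4 * (lam * ψ₁ z) * (lam * ψ₂ z) + c * (lam * ψ₂ z) + lam * ψ₃ z)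
  have dw : ∀ z ∈ Icc (-R) R, HasDerivAt w (w' z) z := fun z hz => by
    refine ((hψ.deriv_zero z hz).const_mul (2 * lam)).exp.congr_deriv ?_
    simp only [w', w]; ring
  have dm : ∀ z ∈ Icc (-R) R, HasDerivAt m (m' z) z := fun z hz =>
    (((hψ.deriv_one z hz).const_mul lam).const_mul 2).add_const c
  have dQ : ∀ z ∈ Icc (-R) R, HasDerivAt Q
      (-4 * (lam * ψ₁ z) * (lam * ψ₂ z) + c * (lam * ψ₂ z) + lam * ψ₃ z) z := fun z hz => by
    refine ((((((hψ.deriv_one z hz).const_mul lam).pow 2).const_mul (-2)).add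
      (((hψ.deriv_one z hz).const_mul lam).const_mul c)).add
      ((hψ.deriv_two z hz).const_mul lam)).congr_deriv ?_
    push_cast
    ring
  have dq : ∀ z ∈ Icc (-R) R, HasDerivAt q (q' z) z := fun z hz => (dw z hz).mul (dQ z hz)
  have cont : ∀ {f f' : ℝ → ℝ}, (∀ z ∈ Icc (-R) R, HasDerivAt f (f' z) z) →
      ContinuousOn f (Icc (-R) R) := fun hf z hz => (hf z hz).continuousAt.continuousWithinAt
  have c0 := cont hψ.deriv_zero
  have c1 := cont hψ.deriv_one
  have c2 := cont hψ.deriv_two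
  have c3 := hψ.cont_three
  have cw := continuousOn_comp_zCoord (n := n) hR (cont dw)
  have cm := continuousOn_comp_zCoord (n := n) hR (cont dm)
  have cq := continuousOn_comp_zCoord (n := n) hR (cont dq)
  have cw' : ContinuousOn (fun x : E n => w' (zCoord x)) (closure (cube n R)) :=
    continuousOn_comp_zCoord hR ((cont dw).mul (continuousOn_const.mul (continuousOn_const.mul c1)))
  have cm' : ContinuousOn (fun x : E n => m' (zCoord x)) (closure (cube n R)) :=
    continuousOn_comp_zCoord hR (continuousOn_const.mul (continuousOn_const.mul c2))
  have cq' : ContinuousOn (fun x : E n => q' (zCoord x)) (closure (cube n R)) := by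
    refine continuousOn_comp_zCoord hR ?_
    have := cont dw
    have := cont dQ
    fun_prop
  have cU := continuousOn_jet_zero hp hR h
  have cP : ∀ i, ContinuousOn (jet h (Pi.single i 1)) (closure (cube n R)) := fun i =>
    (isRep_jet hp hR h).cont _ (by rw [sum_single]; norm_num)
  have cL := continuousOn_jetLap hp hR h
  have cS : ContinuousOn (fun x => ∑ j, jet h (Pi.single j 1) x * jet h (Pi.single j 1) x)
      (closure (cube n R)) := continuousOn_finsetSum _ fun j _ => (cP j).mul (cP j)
  have hz : ∀ x ∈ closure (cube n R), zCoord x ∈ Icc (-R) R := fun x hx =>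
    (mem_closure_cube hR).1 hx (Fin.last n)
  have hdiv := fun x (hx : x ∈ cube n R) => divergence_carlemanField hp hR h hx
    (dw _ (hz x (subset_closure hx))) (dm _ (hz x (subset_closure hx)))
    (dq _ (hz x (subset_closure hx)))
  have cPz := cP (Fin.last n)
  have cA := ((continuousOn_const (c := (2 : ℝ))).mul cPz).add (cm.mul cU)
  have cD := ((((((cw.mul cA).mul cL).neg.sub ((cw'.mul cA).mul cPz)).sub
    (((cw.mul cm').mul cU).mul cPz)).add ((cw'.sub (cw.mul cm)).mul cS)).add
    (cq'.mul (cU.mul cU))).add ((((continuousOn_const (c := (2 : ℝ))).mul cq).mul cU).mul cPz)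
  have hnonneg := integral_divergence_nonneg hR (V := carlemanField w m q h) (fun i => by
      unfold carlemanField
      have := cP i
      exact (((cw.mul ((continuousOn_const.mul cPz).add (cm.mul cU))).mul (cP i)).neg).add
        (continuousOn_const.mul ((cw.mul cS).add (cq.mul (cU.mul cU)))))
    (fun x hx => (hdiv x hx).1) (fun x hx => (hdiv x hx).2) cD
    (fun x hx i hi => (carlemanField_front hp hR hh hx hi).ge)
    (fun x hx i hi => carlemanField_back hp hR (fun z => (Real.exp_pos _).le) hh hx hi)
  have i1 : Integrable (fun x => w (zCoord x) * jetLap h x ^ 2) (cubeMeasure n R) :=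
    continuousOn_integrable (cw.mul (cL.pow 2))
  have i2 : Integrable (fun x => w (zCoord x) * (‖jetGrad h x‖ ^ 2 + jet h 0 x ^ 2))
      (cubeMeasure n R) := by
    refine continuousOn_integrable (cw.mul (ContinuousOn.add ?_ (cU.pow 2)))
    exact (continuousOn_jetGrad hp hR h).norm.pow 2
  have hle := hnonneg.trans (setIntegral_mono_on (continuousOn_integrable cD)
    ((i1.const_mul (1 / (lam * l))).sub (i2.const_mul c)) (measurableSet_cube n R)
    (fun x hx => by
      have hz' := hz x (subset_closure hx)
      have := carleman_pointwise (P := jet h (Pi.single (Fin.last n) 1) x) (U := jet h 0 x)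
        (L := jetLap h x) (S := ‖jetGrad h x‖ ^ 2) hl hc hlB hlam (hψ.le_one _ hz')
        (hψ.one_le _ hz') (hψ.le_two _ hz') (hψ.two_le _ hz') (hψ.three_le _ hz')
        (Real.exp_pos (2 * lam * ψ₀ (zCoord x))).le
      simp only [Pi.sub_apply]
      rw [norm_jetGrad_sq] at this ⊢
      exact this))
  simp only [Pi.sub_apply] at hle
  rw [integral_sub (i1.const_mul _) (i2.const_mul c), integral_const_mul, integral_const_mul] at hle
  have h1 := mul_le_mul_of_nonneg_left hle (by positivity : 0 ≤ lam * l)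
  have h2 : lam * l * (1 / (lam * l) * ∫ x, w (zCoord x) * jetLap h x ^ 2 ∂(cubeMeasure n R)) =
      ∫ x, w (zCoord x) * jetLap h x ^ 2 ∂(cubeMeasure n R) := by
    field_simp
  rw [mul_zero, mul_sub, h2] at h1
  linarith

/-! ### The weight of the functional -/

/-- The family C((z + r)/b)^γ is stable under differentiation, so its iteration yields all three
derivatives of the exponent. -/
theorem hasDerivAt_rpow_affine {r b : ℝ} (C γ : ℝ) {z : ℝ} (hz : 0 < (z + r) / b) :
    HasDerivAt (fun z => C * ((z + r) / b) ^ γ) (C * (γ / b) * ((z + r) / b) ^ (γ - 1)) z := by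
  have h := ((((hasDerivAt_id z).add_const r).div_const b).rpow_const (p := γ)
    (Or.inl hz.ne')).const_mul C
  refine h.congr_deriv ?_
  simp only [id]
  ring

/-- The bound r > R + 1 keeps the base positive on [−R, R], so compactness gives positive minima; β
> 1 makes the second derivative positive. -/
theorem exists_isWeightProfile {R r b β : ℝ} (hR : 0 < R) (hr : R + 1 < r) (hb : R + r < b)
    (hβ : 1 < β) : ∃ ψ₁ ψ₂ ψ₃ l B, IsWeightProfile R (fun z => ((z + r) / b) ^ β) ψ₁ ψ₂ ψ₃ l B := by
  have hb0 : 0 < b := by linarith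
  have hpos : ∀ z ∈ Icc (-R) R, 0 < (z + r) / b := fun z hz => by
    have : 0 < z + r := by linarith [hz.1]
    positivity
  have hd := fun (C γ : ℝ) z (hz : z ∈ Icc (-R) R) => hasDerivAt_rpow_affine C γ (hpos z hz)
  have hc : ∀ C γ : ℝ, ContinuousOn (fun z => C * ((z + r) / b) ^ γ) (Icc (-R) R) := fun C γ z hz =>
    (hd C γ z hz).continuousAt.continuousWithinAt
  have hne : (Icc (-R) R).Nonempty := ⟨0, by simp [hR.le]⟩
  have hmin : ∀ C γ : ℝ, 0 < C → ∃ l > 0, ∀ z ∈ Icc (-R) R, l ≤ C * ((z + r) / b) ^ γ := by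
    intro C γ hC
    obtain ⟨z₀, hz₀, h⟩ := isCompact_Icc.exists_isMinOn hne (hc C γ)
    exact ⟨_, mul_pos hC (Real.rpow_pos_of_pos (hpos z₀ hz₀) γ), fun z hz => h hz⟩
  have hmax : ∀ C γ : ℝ, ∃ B, ∀ z ∈ Icc (-R) R, |C * ((z + r) / b) ^ γ| ≤ B := fun C γ =>
    isCompact_Icc.exists_bound_of_continuousOn (hc C γ)
  obtain ⟨l₁, hl₁, h₁⟩ := hmin (1 * (β / b)) (β - 1) (by have := zero_lt_one.trans hβ; positivity)
  obtain ⟨l₂, hl₂, h₂⟩ := hmin (1 * (β / b) * ((β - 1) / b)) (β - 1 - 1) (by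
    have := zero_lt_one.trans hβ
    have := sub_pos.2 hβ
    positivity)
  obtain ⟨B₁, hB₁⟩ := hmax (1 * (β / b)) (β - 1)
  obtain ⟨B₂, hB₂⟩ := hmax (1 * (β / b) * ((β - 1) / b)) (β - 1 - 1)
  obtain ⟨B₃, hB₃⟩ := hmax (1 * (β / b) * ((β - 1) / b) * ((β - 1 - 1) / b)) (β - 1 - 1 - 1)
  refine ⟨_, _, _, min l₁ l₂, max B₁ (max B₂ B₃), ⟨fun z hz => ?_, hd _ _, hd _ _, hc _ _,
    lt_min hl₁ hl₂, fun z hz => (min_le_left _ _).trans (h₁ z hz),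
    fun z hz => (min_le_right _ _).trans (h₂ z hz), fun z hz => ?_, fun z hz => ?_, fun z hz => ?_⟩⟩
  · simpa using hd 1 β z hz
  · exact (le_abs_self _).trans ((hB₁ z hz).trans (le_max_left _ _))
  · exact (le_abs_self _).trans ((hB₂ z hz).trans ((le_max_left _ _).trans (le_max_right _ _)))
  · exact (hB₃ z hz).trans ((le_max_right _ _).trans (le_max_right _ _))

theorem continuousOn_weight {n : ℕ} {R r b β : ℝ} (hR : 0 < R) (hr : R + 1 < r) (hb : R + r < b)
    (hβ : 1 < β) (lam : ℝ) : ContinuousOn (weight (n := n) r b lam β) (closure (cube n R)) := by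
  obtain ⟨ψ₁, ψ₂, ψ₃, l, B, hψ⟩ := exists_isWeightProfile hR hr hb hβ
  have : ContinuousOn (fun z => ((z + r) / b) ^ β) (Icc (-R) R) := fun z hz =>
    (hψ.deriv_zero z hz).continuousAt.continuousWithinAt
  exact Real.continuous_exp.comp_continuousOn
    (continuousOn_const.mul (continuousOn_comp_zCoord hR this))

theorem weight_pos {n : ℕ} (r b lam β : ℝ) (x : E n) : 0 < weight r b lam β x := Real.exp_pos _

/-- Because b > R + r, the base (z + r)/b stays below one. -/
theorem weight_le {n : ℕ} {R r b β lam : ℝ} (hR : 0 < R) (hr : R + 1 < r) (hb : R + r < b)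
    (hβ : 1 < β) (hlam : 0 ≤ lam) {x : E n} (hx : x ∈ closure (cube n R)) :
    weight r b lam β x ≤ Real.exp (2 * lam) := by
  have hz : zCoord x ∈ Icc (-R) R := (mem_closure_cube hR).1 hx (Fin.last n)
  have hb0 : 0 < b := by linarith
  have h0 : 0 ≤ (zCoord x + r) / b := div_nonneg (by linarith [hz.1]) hb0.le
  have h1 : (zCoord x + r) / b ≤ 1 := (div_le_one hb0).2 (by linarith [hz.2])
  have h2 : ((zCoord x + r) / b) ^ β ≤ 1 := Real.rpow_le_one h0 h1 (by linarith)
  rw [weight, Real.exp_le_exp]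
  nlinarith

/-! ### The nonlinearity -/

/-- `Λ` bounds `F`, its first derivatives in `(s, p)`, and their Lipschitz constants, on
`closure Ω × [-A, A] × {|p| ≤ A}`. -/
structure IsC2Bound {n : ℕ} (R A Λ : ℝ) (F : E n → ℝ → E n → ℝ) : Prop where
  abs_le : ∀ x ∈ closure (cube n R), ∀ s q, |s| ≤ A → ‖q‖ ≤ A → |F x s q| ≤ Λ
  deriv_le : ∀ x ∈ closure (cube n R), ∀ s q, |s| ≤ A → ‖q‖ ≤ A → |deriv (fun s => F x s q) s| ≤ Λ
  fderiv_le : ∀ x ∈ closure (cube n R), ∀ s q, |s| ≤ A → ‖q‖ ≤ A →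
    ‖fderiv ℝ (fun q => F x s q) q‖ ≤ Λ
  deriv_sub_le : ∀ x ∈ closure (cube n R), ∀ s q s' q', |s| ≤ A → ‖q‖ ≤ A → |s'| ≤ A → ‖q'‖ ≤ A →
    |deriv (fun s => F x s q') s' - deriv (fun s => F x s q) s| ≤ Λ * (|s' - s| + ‖q' - q‖)
  fderiv_sub_le : ∀ x ∈ closure (cube n R), ∀ s q s' q', |s| ≤ A → ‖q‖ ≤ A → |s'| ≤ A → ‖q'‖ ≤ A →
    ‖fderiv ℝ (fun q => F x s' q) q' - fderiv ℝ (fun q => F x s q) q‖ ≤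
      Λ * (|s' - s| + ‖q' - q‖)
  sub_le : ∀ x ∈ closure (cube n R), ∀ s q s' q', |s| ≤ A → ‖q‖ ≤ A → |s'| ≤ A → ‖q'‖ ≤ A →
    |F x s' q' - F x s q| ≤ Λ * (|s' - s| + ‖q' - q‖)
  taylor : ∀ x ∈ closure (cube n R), ∀ s q s' q', |s| ≤ A → ‖q‖ ≤ A → |s'| ≤ A → ‖q'‖ ≤ A →
    |F x s' q' - F x s q - deriv (fun s => F x s q) s * (s' - s) -
      fderiv ℝ (fun q => F x s q) q (q' - q)| ≤ Λ * (|s' - s| + ‖q' - q‖) ^ 2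

section Nonlinearity

variable {n : ℕ} {R : ℝ} {F : E n → ℝ → E n → ℝ}

theorem uniqueDiffOn_domain (hR : 0 < R) :
    UniqueDiffOn ℝ (closure (cube n R) ×ˢ (univ : Set (ℝ × E n))) :=
  (uniqueDiffOn_closure_cube n hR).prod uniqueDiffOn_univ

/-- The derivative of `F` in all its variables. -/
def fullDeriv (R : ℝ) (F : E n → ℝ → E n → ℝ) : E n × ℝ × E n → E n × ℝ × E n →L[ℝ] ℝ :=
  fderivWithin ℝ (fun q : E n × ℝ × E n => F q.1 q.2.1 q.2.2) (closure (cube n R) ×ˢ univ)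

theorem IsC2.hasFDerivWithinAt (hF : IsC2 R F) {y : E n × ℝ × E n}
    (hy : y.1 ∈ closure (cube n R)) :
    HasFDerivWithinAt (fun q : E n × ℝ × E n => F q.1 q.2.1 q.2.2) (fullDeriv R F y)
      (closure (cube n R) ×ˢ univ) y :=
  (ContDiffOn.differentiableOn hF (by norm_num) y ⟨hy, mem_univ _⟩).hasFDerivWithinAt

theorem IsC2.contDiffOn_fullDeriv (hR : 0 < R) (hF : IsC2 R F) :
    ContDiffOn ℝ 1 (fullDeriv R F) (closure (cube n R) ×ˢ univ) :=
  ContDiffOn.fderivWithin hF (uniqueDiffOn_domain hR) (by norm_num)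

/-- The slice in s is the whole line, so the derivative within the domain gives a genuine partial
derivative even at x ∈ ∂Ω. -/
theorem IsC2.deriv_eq (hF : IsC2 R F) {x : E n} (hx : x ∈ closure (cube n R)) (s : ℝ) (q : E n) :
    deriv (fun s => F x s q) s = fullDeriv R F (x, s, q) (0, 1, 0) := by
  have h1 : HasDerivAt (fun s : ℝ => ((x, s, q) : E n × ℝ × E n)) (0, 1, 0) s :=
    (hasDerivAt_const s x).prodMk ((hasDerivAt_id s).prodMk (hasDerivAt_const s q))
  have h2 := (hF.hasFDerivWithinAt (y := (x, s, q)) hx).comp_hasDerivWithinAt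
    (t := closure (cube n R) ×ˢ univ) (s := univ) s h1.hasDerivWithinAt (fun _ _ => ⟨hx, mem_univ _⟩)
  exact (hasDerivWithinAt_univ.1 h2).deriv

theorem IsC2.fderiv_eq (hF : IsC2 R F) {x : E n} (hx : x ∈ closure (cube n R)) (s : ℝ) (q : E n) :
    fderiv ℝ (fun q => F x s q) q = (fullDeriv R F (x, s, q)).comp
      ((ContinuousLinearMap.inr ℝ (E n) (ℝ × E n)).comp (ContinuousLinearMap.inr ℝ ℝ (E n))) := by
  have h1 : HasFDerivAt (fun q : E n => ((x, s, q) : E n × ℝ × E n))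
      ((ContinuousLinearMap.inr ℝ (E n) (ℝ × E n)).comp (ContinuousLinearMap.inr ℝ ℝ (E n))) q :=
    ((hasFDerivAt_const x q).prodMk ((hasFDerivAt_const s q).prodMk (hasFDerivAt_id q))).congr_fderiv
      rfl
  have h2 := (hF.hasFDerivWithinAt (y := (x, s, q)) hx).comp (t := closure (cube n R) ×ˢ univ)
    (s := univ) q h1.hasFDerivWithinAt (fun _ _ => ⟨hx, mem_univ _⟩)
  exact (hasFDerivWithinAt_univ.1 h2).fderiv

theorem IsC2.continuousOn_comp (hF : IsC2 R F) {V : E n → ℝ} {G : E n → E n}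
    (hV : ContinuousOn V (closure (cube n R))) (hG : ContinuousOn G (closure (cube n R))) :
    ContinuousOn (fun x => F x (V x) (G x)) (closure (cube n R)) :=
  (ContDiffOn.continuousOn hF).comp (continuousOn_id.prodMk (hV.prodMk hG))
    fun _ hx => ⟨hx, mem_univ _⟩

theorem IsC2.continuousOn_deriv (hR : 0 < R) (hF : IsC2 R F) {V : E n → ℝ} {G : E n → E n}
    (hV : ContinuousOn V (closure (cube n R))) (hG : ContinuousOn G (closure (cube n R))) :
    ContinuousOn (fun x => deriv (fun s => F x s (G x)) (V x)) (closure (cube n R)) := by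
  have h : ContinuousOn (fun x => fullDeriv R F (x, V x, G x)) (closure (cube n R)) :=
    (hF.contDiffOn_fullDeriv hR).continuousOn.comp (continuousOn_id.prodMk (hV.prodMk hG))
      fun _ hx => ⟨hx, mem_univ _⟩
  exact (h.clm_apply continuousOn_const).congr fun x hx => hF.deriv_eq hx _ _

theorem IsC2.continuousOn_fderiv (hR : 0 < R) (hF : IsC2 R F) {V : E n → ℝ} {G H : E n → E n}
    (hV : ContinuousOn V (closure (cube n R))) (hG : ContinuousOn G (closure (cube n R)))
    (hH : ContinuousOn H (closure (cube n R))) :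
    ContinuousOn (fun x => fderiv ℝ (fun q => F x (V x) q) (G x) (H x)) (closure (cube n R)) := by
  have h : ContinuousOn (fun x => fullDeriv R F (x, V x, G x)) (closure (cube n R)) :=
    (hF.contDiffOn_fullDeriv hR).continuousOn.comp (continuousOn_id.prodMk (hV.prodMk hG))
      fun _ hx => ⟨hx, mem_univ _⟩
  refine (h.clm_apply (continuousOn_const.prodMk (continuousOn_const.prodMk hH))).congr
    (f := fun x => fullDeriv R F (x, V x, G x) (0, 0, H x)) fun x hx => ?_
  simp only [hF.fderiv_eq hx]
  rfl

theorem norm_triple_le (s : ℝ) (q : E n) : ‖((0, s, q) : E n × ℝ × E n)‖ ≤ |s| + ‖q‖ := by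
  simp only [Prod.norm_def, norm_zero, Real.norm_eq_abs]
  refine max_le (by positivity) (max_le ?_ ?_)
  · linarith [norm_nonneg q]
  · linarith [abs_nonneg s]

/-- A `C²` function satisfies uniform bounds on compact sets. -/
theorem IsC2.exists_isC2Bound (hR : 0 < R) (hF : IsC2 R F) (A : ℝ) :
    ∃ Λ, 0 ≤ Λ ∧ ∀ Λ', Λ ≤ Λ' → IsC2Bound R A Λ' F := by
  let S : Set (E n × ℝ × E n) := closure (cube n R) ×ˢ univ
  let T : Set (E n × ℝ × E n) := closure (cube n R) ×ˢ (Icc (-A) A ×ˢ Metric.closedBall 0 A)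
  have hTS : T ⊆ S := prod_mono subset_rfl (subset_univ _)
  have hT : IsCompact T :=
    (isCompact_closure_cube n R).prod (isCompact_Icc.prod (isCompact_closedBall 0 A))
  have hTc : Convex ℝ T :=
    (convex_closure_cube n R).prod ((convex_Icc _ _).prod (convex_closedBall 0 A))
  have hΦ := hF.contDiffOn_fullDeriv hR
  obtain ⟨C₀, h₀⟩ := hT.exists_bound_of_continuousOn
    ((ContDiffOn.continuousOn hF).mono hTS)
  obtain ⟨C₁, h₁⟩ := hT.exists_bound_of_continuousOn (hΦ.continuousOn.mono hTS)
  obtain ⟨C₂, h₂⟩ := hT.exists_bound_of_continuousOn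
    ((hΦ.continuousOn_fderivWithin (uniqueDiffOn_domain hR) (by norm_num)).mono hTS)
  -- T is convex, so the bound C₂ on the second derivative is a Lipschitz constant of the first.
  have hlip : ∀ y ∈ T, ∀ y' ∈ T, ‖fullDeriv R F y' - fullDeriv R F y‖ ≤ C₂ * ‖y' - y‖ :=
    fun y hy y' hy' => hTc.norm_image_sub_le_of_norm_hasFDerivWithin_le
      (fun z hz => ((hΦ.differentiableOn (by norm_num) z (hTS hz)).hasFDerivWithinAt).mono hTS)
      h₂ hy hy'
  have hmem : ∀ {x s q}, x ∈ closure (cube n R) → |s| ≤ A → ‖q‖ ≤ A →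
      ((x, s, q) : E n × ℝ × E n) ∈ T := fun hx hs hq =>
    ⟨hx, _root_.abs_le.1 hs, mem_closedBall_zero_iff.2 hq⟩
  refine ⟨max (max |C₀| |C₁|) |C₂|, by positivity, fun Λ hΛ => ?_⟩
  have hΛ₀ : C₀ ≤ Λ := (le_abs_self _).trans ((le_max_left _ _).trans ((le_max_left _ _).trans hΛ))
  have hΛ₁ : C₁ ≤ Λ := (le_abs_self _).trans ((le_max_right _ _).trans ((le_max_left _ _).trans hΛ))
  have hΛ₂ : C₂ ≤ Λ := (le_abs_self _).trans ((le_max_right _ _).trans hΛ)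
  have hΛn : 0 ≤ Λ := (by positivity : 0 ≤ max (max |C₀| |C₁|) |C₂|).trans hΛ
  have hdiff : ∀ (x : E n) (s : ℝ) (q : E n) (s' : ℝ) (q' : E n),
      ((x, s', q') : E n × ℝ × E n) - (x, s, q) = (0, s' - s, q' - q) := fun x s q s' q' => by
    simp
  have hone : ‖((0, 1, 0) : E n × ℝ × E n)‖ ≤ 1 := by
    simp [Prod.norm_def]
  have hinr : ‖(ContinuousLinearMap.inr ℝ (E n) (ℝ × E n)).comp
      (ContinuousLinearMap.inr ℝ ℝ (E n))‖ ≤ 1 :=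
    ContinuousLinearMap.opNorm_le_bound _ zero_le_one fun q => by
      simp [Prod.norm_def]
  have hlip' : ∀ {x s q s' q'}, x ∈ closure (cube n R) → |s| ≤ A → ‖q‖ ≤ A → |s'| ≤ A → ‖q'‖ ≤ A →
      ‖fullDeriv R F (x, s', q') - fullDeriv R F (x, s, q)‖ ≤ Λ * (|s' - s| + ‖q' - q‖) := by
    intro x s q s' q' hx hs hq hs' hq'
    refine (hlip _ (hmem hx hs hq) _ (hmem hx hs' hq')).trans ?_
    rw [hdiff]
    exact mul_le_mul hΛ₂ (norm_triple_le _ _) (norm_nonneg _) hΛn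
  refine ⟨?_, ?_, ?_, ?_, ?_, ?_, ?_⟩
  · intro x hx s q hs hq
    exact (h₀ _ (hmem hx hs hq)).trans hΛ₀
  · intro x hx s q hs hq
    rw [hF.deriv_eq hx, ← Real.norm_eq_abs]
    refine (ContinuousLinearMap.le_opNorm _ _).trans ?_
    have := (h₁ _ (hmem hx hs hq)).trans hΛ₁
    nlinarith [norm_nonneg ((0, 1, 0) : E n × ℝ × E n)]
  · intro x hx s q hs hq
    rw [hF.fderiv_eq hx]
    refine (ContinuousLinearMap.opNorm_comp_le _ _).trans ?_
    have h := (h₁ _ (hmem hx hs hq)).trans hΛ₁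
    exact (mul_le_mul h hinr (norm_nonneg _) hΛn).trans (mul_one Λ).le
  · intro x hx s q s' q' hs hq hs' hq'
    rw [hF.deriv_eq hx, hF.deriv_eq hx, ← sub_apply, ← Real.norm_eq_abs]
    refine (ContinuousLinearMap.le_opNorm _ _).trans ?_
    exact (mul_le_mul (hlip' hx hs hq hs' hq') hone (norm_nonneg _) (by positivity)).trans
      (mul_one _).le
  · intro x hx s q s' q' hs hq hs' hq'
    rw [hF.fderiv_eq hx, hF.fderiv_eq hx, ← ContinuousLinearMap.sub_comp]
    refine (ContinuousLinearMap.opNorm_comp_le _ _).trans ?_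
    exact (mul_le_mul (hlip' hx hs hq hs' hq') hinr (norm_nonneg _) (by positivity)).trans
      (mul_one _).le
  · intro x hx s q s' q' hs hq hs' hq'
    have h := hTc.norm_image_sub_le_of_norm_hasFDerivWithin_le
      (fun z hz => (hF.hasFDerivWithinAt hz.1).mono hTS) h₁ (hmem hx hs hq) (hmem hx hs' hq')
    rw [Real.norm_eq_abs, hdiff] at h
    exact h.trans (mul_le_mul hΛ₁ (norm_triple_le _ _) (norm_nonneg _) hΛn)
  · intro x hx s q s' q' hs hq hs' hq'
    have hseg : segment ℝ ((x, s, q) : E n × ℝ × E n) (x, s', q') ⊆ T :=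
      hTc.segment_subset (hmem hx hs hq) (hmem hx hs' hq')
    -- Mean value inequality relative to the derivative at the starting point: on the segment the
    -- derivative differs from it by at most Λ times the length, whence the square.
    have h := (convex_segment ((x, s, q) : E n × ℝ × E n)
        (x, s', q')).norm_image_sub_le_of_norm_hasFDerivWithin_le'
      (C := Λ * (|s' - s| + ‖q' - q‖)) (φ := fullDeriv R F (x, s, q))
      (fun z hz => (hF.hasFDerivWithinAt (hseg hz).1).mono (hseg.trans hTS))
      (fun z hz => by
        refine (hlip _ (hmem hx hs hq) z (hseg hz)).trans ?_
        refine mul_le_mul hΛ₂ ?_ (norm_nonneg _) hΛn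
        refine (norm_sub_le_of_mem_segment hz).trans ?_
        rw [hdiff]
        exact norm_triple_le _ _)
      (left_mem_segment _ _ _) (right_mem_segment _ _ _)
    rw [Real.norm_eq_abs, hdiff] at h
    have hsplit : ((0, s' - s, q' - q) : E n × ℝ × E n) =
        (s' - s) • ((0, 1, 0) : E n × ℝ × E n) + (0, 0, q' - q) := by simp
    have hval : fullDeriv R F (x, s, q) (0, s' - s, q' - q) =
        deriv (fun s => F x s q) s * (s' - s) + fderiv ℝ (fun q => F x s q) q (q' - q) := by
      rw [hF.deriv_eq hx, hF.fderiv_eq hx, hsplit, map_add, map_smul, smul_eq_mul, mul_comm]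
      rfl
    rw [hval, ← sub_sub] at h
    refine h.trans ?_
    rw [sq, mul_assoc]
    gcongr
    exact norm_triple_le _ _

end Nonlinearity

/-! ### Hilbert space lemmas -/

section Hilbert

variable {V : Type*} [NormedAddCommGroup V] [InnerProductSpace ℝ V]

theorem existsUnique_inner_eq_of_isClosed [CompleteSpace V] (K : Submodule ℝ V)
    (hK : IsClosed (K : Set V)) (ℓ : V →L[ℝ] ℝ) :
    ∃! G, G ∈ K ∧ ∀ h ∈ K, inner ℝ G h = ℓ h := by
  have : CompleteSpace K := hK.completeSpace_coe
  let G : K := (InnerProductSpace.toDual ℝ K).symm (ℓ.comp K.subtypeL)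
  have hG : ∀ h ∈ K, inner ℝ (G : V) h = ℓ h := fun h hh =>
    InnerProductSpace.toDual_symm_apply (𝕜 := ℝ) (E := K) (x := ⟨h, hh⟩)
      (y := ℓ.comp K.subtypeL)
  refine ⟨G, ⟨G.2, hG⟩, fun G' hG' => ?_⟩
  have hsub : G' - G ∈ K := K.sub_mem hG'.1 G.2
  have h0 : inner ℝ (G' - (G : V)) (G' - G) = 0 := by
    rw [inner_sub_left, hG'.2 _ hsub, hG _ hsub, sub_self]
  exact sub_eq_zero.1 (inner_self_eq_zero.1 h0)

theorem norm_add_smul_sq (u h : V) (t : ℝ) :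
    ‖u + t • h‖ ^ 2 = ‖u‖ ^ 2 + 2 * t * inner ℝ u h + t ^ 2 * ‖h‖ ^ 2 := by
  rw [norm_add_sq_real, inner_smul_right, norm_smul, mul_pow, Real.norm_eq_abs, sq_abs]; ring

/-- A gradient step with a strongly monotone, Lipschitz field `G` contracts the error `e`. -/
theorem norm_sub_smul_le_of_monotone {e G : V} {κ η L : ℝ} (hκ : 0 ≤ κ)
    (hmono : 2 * η * ‖e‖ ^ 2 ≤ inner ℝ G e) (hlip : ‖G‖ ≤ L * ‖e‖) (hκL : κ * L ^ 2 ≤ η)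
    (hη : 0 ≤ η) : ‖e - κ • G‖ ^ 2 ≤ (1 - κ * η) * ‖e‖ ^ 2 := by
  have h1 := norm_add_smul_sq e G (-κ)
  rw [neg_smul, ← sub_eq_add_neg, real_inner_comm] at h1
  have h2 : ‖G‖ ^ 2 ≤ L ^ 2 * ‖e‖ ^ 2 := by
    rw [← mul_pow]; exact pow_le_pow_left₀ (norm_nonneg _) hlip 2
  have h3 := mul_le_mul_of_nonneg_left hmono hκ
  have h4 := mul_le_mul_of_nonneg_left h2 (sq_nonneg κ)
  have h5 := mul_le_mul_of_nonneg_right (mul_le_mul_of_nonneg_left hκL hκ) (sq_nonneg ‖e‖)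
  have h6 : 0 ≤ κ * η * ‖e‖ ^ 2 := by positivity
  -- Since κ²L² ≤ κη, the expansion has factor at most 1 − 4κη + κη; the surplus is discarded.
  nlinarith

end Hilbert

/-! ### Completeness -/

theorem exists_clm_integral_mul {n : ℕ} {R : ℝ} {ψ : E n → ℝ}
    (h : ContDiff ℝ ∞ ψ ∧ HasCompactSupport ψ) :
    ∃ L : Lp ℝ 2 (cubeMeasure n R) →L[ℝ] ℝ, ∀ v, L v = ∫ x, v x * ψ x ∂(cubeMeasure n R) := by
  have hψ : MemLp ψ 2 (cubeMeasure n R) := h.1.continuous.memLp_of_hasCompactSupport h.2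
  refine ⟨innerSL ℝ hψ.toLp, fun v => ?_⟩
  rw [innerSL_apply_apply, L2.inner_def]
  refine integral_congr_ae ?_
  filter_upwards [hψ.coeFn_toLp] with x hx
  rw [hx]
  simp

/-- Both sides of each weak-derivative identity are continuous functionals of the jet. -/
theorem isClosed_sobolev (n p : ℕ) (R : ℝ) : IsClosed (sobolev n p R : Set (JetSpace n p R)) := by
  have h : (sobolev n p R : Set (JetSpace n p R)) =
      ⋂ (α : multiIdx n p) (φ : E n → ℝ) (_ : IsTest n R φ), {u |
        ∫ x, u ⟨0, zero_mem_multiIdx n p⟩ x * iterPartial α.1 φ x ∂(cubeMeasure n R)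
          = (-1) ^ (∑ i, α.1 i) * ∫ x, u α x * φ x ∂(cubeMeasure n R)} := by
    ext u
    simp only [mem_iInter]
    rfl
  rw [h]
  refine isClosed_iInter fun α => isClosed_iInter fun φ => isClosed_iInter fun hφ => ?_
  obtain ⟨L₁, h₁⟩ := exists_clm_integral_mul (R := R)
    (smooth_iterPartial α.1 ⟨hφ.smooth, hφ.compact⟩)
  obtain ⟨L₂, h₂⟩ := exists_clm_integral_mul (R := R) ⟨hφ.smooth, hφ.compact⟩
  simp only [← h₁, ← h₂]
  exact isClosed_eq (L₁.continuous.comp (PiLp.continuous_apply 2 _ _))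
    (continuous_const.mul (L₂.continuous.comp (PiLp.continuous_apply 2 _ _)))

instance completeSpace_Hp (n p : ℕ) (R : ℝ) : CompleteSpace (Hp n p R) :=
  (isClosed_sobolev n p R).completeSpace_coe

/-! ### The functional in terms of continuous representatives -/

/-- The continuous representative of the residual. -/
def res {n p : ℕ} {R : ℝ} (ε₀ : ℝ) (F : E n → ℝ → E n → ℝ) (u : Hp n p R) (x : E n) : ℝ :=
  -ε₀ * jetLap u x + F x (jet u 0 x) (jetGrad u x)

/-- The continuous representative of the linearized operator. -/
def lin {n p : ℕ} {R : ℝ} (ε₀ : ℝ) (F : E n → ℝ → E n → ℝ) (u h : Hp n p R) (x : E n) : ℝ :=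
  -ε₀ * jetLap h x + deriv (fun s => F x s (jetGrad u x)) (jet u 0 x) * jet h 0 x
    + fderiv ℝ (fun q => F x (jet u 0 x) q) (jetGrad u x) (jetGrad h x)

section Functional

variable {n p : ℕ} {R : ℝ} {r b ε₀ lam β η : ℝ} {F : E n → ℝ → E n → ℝ}

theorem continuousOn_res (hp : ⌈((n : ℝ) + 1) / 2⌉₊ + 2 < p) (hR : 0 < R) (hF : IsC2 R F)
    (u : Hp n p R) : ContinuousOn (res ε₀ F u) (closure (cube n R)) :=
  (continuousOn_const.mul (continuousOn_jetLap hp hR u)).add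
    (hF.continuousOn_comp (continuousOn_jet_zero hp hR u) (continuousOn_jetGrad hp hR u))

theorem continuousOn_lin (hp : ⌈((n : ℝ) + 1) / 2⌉₊ + 2 < p) (hR : 0 < R) (hF : IsC2 R F)
    (u h : Hp n p R) : ContinuousOn (lin ε₀ F u h) (closure (cube n R)) :=
  ((continuousOn_const.mul (continuousOn_jetLap hp hR h)).add
    ((hF.continuousOn_deriv hR (continuousOn_jet_zero hp hR u) (continuousOn_jetGrad hp hR u)).mul
      (continuousOn_jet_zero hp hR h))).add
    (hF.continuousOn_fderiv hR (continuousOn_jet_zero hp hR u) (continuousOn_jetGrad hp hR u)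
      (continuousOn_jetGrad hp hR h))

/-- With representatives continuous on the compact cube, pointwise bounds apply and integrability is
automatic. -/
theorem J_eq (hp : ⌈((n : ℝ) + 1) / 2⌉₊ + 2 < p) (hR : 0 < R) (u : Hp n p R) :
    J r b ε₀ F lam β η u =
      ∫ x, weight r b lam β x * res ε₀ F u x ^ 2 ∂(cubeMeasure n R) + η * ‖u‖ ^ 2 := by
  rw [J]
  congr 1
  refine integral_congr_ae ?_
  filter_upwards [ae_eq_jets hp hR u] with x ⟨h0, h1, h2⟩
  rw [sq_abs, residual, res, h0, h1, h2]

theorem DJ_eq (hp : ⌈((n : ℝ) + 1) / 2⌉₊ + 2 < p) (hR : 0 < R) (u h : Hp n p R) :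
    DJ r b ε₀ F lam β η u h =
      2 * ∫ x, weight r b lam β x * (res ε₀ F u x * lin ε₀ F u h x) ∂(cubeMeasure n R)
        + 2 * η * inner ℝ u h := by
  rw [DJ]
  congr 2
  refine integral_congr_ae ?_
  filter_upwards [ae_eq_jets hp hR u, ae_eq_jets hp hR h] with x ⟨h0, h1, h2⟩ ⟨k0, k1, k2⟩
  rw [residual, linResidual, res, lin, h0, h1, h2, k0, k1, k2, mul_assoc]

theorem lin_add (hp : ⌈((n : ℝ) + 1) / 2⌉₊ + 2 < p) (hR : 0 < R) (u h k : Hp n p R) {x : E n}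
    (hx : x ∈ closure (cube n R)) : lin ε₀ F u (h + k) x = lin ε₀ F u h x + lin ε₀ F u k x := by
  rw [lin, lin, lin, jetLap_add hp hR _ _ hx, jet_add hp hR _ _ (by simp) hx,
    jetGrad_add hp hR _ _ hx, map_add]
  ring

theorem lin_smul (hp : ⌈((n : ℝ) + 1) / 2⌉₊ + 2 < p) (hR : 0 < R) (c : ℝ) (u h : Hp n p R)
    {x : E n} (hx : x ∈ closure (cube n R)) : lin ε₀ F u (c • h) x = c * lin ε₀ F u h x := by
  rw [lin, lin, jetLap_smul hp hR _ _ hx, jet_smul hp hR _ _ (by simp) hx,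
    jetGrad_smul hp hR _ _ hx, map_smul, smul_eq_mul]
  ring

theorem integrable_res_mul_lin (hp : ⌈((n : ℝ) + 1) / 2⌉₊ + 2 < p) (hR : 0 < R)
    (hr : R + 1 < r) (hb : R + r < b) (hβ : 1 < β) (hF : IsC2 R F) (u h : Hp n p R) :
    Integrable (fun x => weight r b lam β x * (res ε₀ F u x * lin ε₀ F u h x))
      (cubeMeasure n R) :=
  continuousOn_integrable ((continuousOn_weight hR hr hb hβ lam).mul
    ((continuousOn_res hp hR hF u).mul (continuousOn_lin hp hR hF u h)))

theorem DJ_add (hp : ⌈((n : ℝ) + 1) / 2⌉₊ + 2 < p) (hR : 0 < R)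
    (hr : R + 1 < r) (hb : R + r < b) (hβ : 1 < β) (hF : IsC2 R F) (u h k : Hp n p R) :
    DJ r b ε₀ F lam β η u (h + k) = DJ r b ε₀ F lam β η u h + DJ r b ε₀ F lam β η u k := by
  rw [DJ_eq hp hR, DJ_eq hp hR, DJ_eq hp hR, inner_add_right]
  have h1 : ∫ x, weight r b lam β x * (res ε₀ F u x * lin ε₀ F u (h + k) x) ∂(cubeMeasure n R) =
      ∫ x, (weight r b lam β x * (res ε₀ F u x * lin ε₀ F u h x) +
        weight r b lam β x * (res ε₀ F u x * lin ε₀ F u k x)) ∂(cubeMeasure n R) :=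
    setIntegral_congr_fun (measurableSet_cube n R) fun x hx => by
      simp only [lin_add hp hR u h k (subset_closure hx)]; ring
  rw [h1, integral_add (integrable_res_mul_lin hp hR hr hb hβ hF u h)
    (integrable_res_mul_lin hp hR hr hb hβ hF u k)]
  ring

theorem DJ_smul (hp : ⌈((n : ℝ) + 1) / 2⌉₊ + 2 < p) (hR : 0 < R) (c : ℝ) (u h : Hp n p R) :
    DJ r b ε₀ F lam β η u (c • h) = c * DJ r b ε₀ F lam β η u h := by
  rw [DJ_eq hp hR, DJ_eq hp hR,
    show inner ℝ u (c • h) = c * inner ℝ u h from real_inner_smul_right u h c]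
  have h1 : ∫ x, weight r b lam β x * (res ε₀ F u x * lin ε₀ F u (c • h) x) ∂(cubeMeasure n R) =
      ∫ x, c * (weight r b lam β x * (res ε₀ F u x * lin ε₀ F u h x)) ∂(cubeMeasure n R) :=
    setIntegral_congr_fun (measurableSet_cube n R) fun x hx => by
      simp only [lin_smul hp hR c u h (subset_closure hx)]; ring
  rw [h1, integral_const_mul]
  ring

/-- `C` is a constant of the embedding of `H^p(Ω)` into `C²`. -/
def IsEmbeddingConst (n p : ℕ) (R C : ℝ) : Prop :=
  0 < C ∧ ∀ (u : Hp n p R), ∀ x ∈ closure (cube n R),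
    |jet u 0 x| ≤ C * ‖u‖ ∧ ‖jetGrad u x‖ ≤ C * ‖u‖ ∧ |jetLap u x| ≤ C * ‖u‖

/-! ### Pointwise estimates -/

theorem IsEmbeddingConst.bounds {C A : ℝ} (hC : IsEmbeddingConst n p R C) {u : Hp n p R}
    (hu : C * ‖u‖ ≤ A) {x : E n} (hx : x ∈ closure (cube n R)) :
    |jet u 0 x| ≤ A ∧ ‖jetGrad u x‖ ≤ A ∧ |jetLap u x| ≤ A :=
  ⟨(hC.2 u x hx).1.trans hu, (hC.2 u x hx).2.1.trans hu, (hC.2 u x hx).2.2.trans hu⟩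

theorem jet_sub (hp : ⌈((n : ℝ) + 1) / 2⌉₊ + 2 < p) (hR : 0 < R) (u v : Hp n p R) {x : E n}
    (hx : x ∈ closure (cube n R)) :
    jet u 0 x - jet v 0 x = jet (u - v) 0 x ∧ jetGrad u x - jetGrad v x = jetGrad (u - v) x ∧
      jetLap u x - jetLap v x = jetLap (u - v) x := by
  have h := sub_add_cancel u v
  refine ⟨?_, ?_, ?_⟩
  · rw [sub_eq_iff_eq_add, ← jet_add hp hR _ _ (by simp) hx, h]
  · rw [sub_eq_iff_eq_add, ← jetGrad_add hp hR _ _ hx, h]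
  · rw [sub_eq_iff_eq_add, ← jetLap_add hp hR _ _ hx, h]

theorem abs_res_le {C A Λ : ℝ} (hε : 0 < ε₀) (hC : IsEmbeddingConst n p R C)
    (hΛ : IsC2Bound R A Λ F) {u : Hp n p R} (hu : C * ‖u‖ ≤ A) {x : E n}
    (hx : x ∈ closure (cube n R)) : |res ε₀ F u x| ≤ ε₀ * A + Λ := by
  obtain ⟨h0, h1, h2⟩ := hC.bounds hu hx
  rw [res]
  refine (abs_add_le _ _).trans (add_le_add ?_ (hΛ.abs_le x hx _ _ h0 h1))
  rw [abs_mul, abs_neg, abs_of_pos hε]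
  gcongr

/-- The part of the linearized operator of order at most one. -/
theorem abs_lin_add_le {C A Λ : ℝ} (hC : IsEmbeddingConst n p R C)
    (hΛ : IsC2Bound R A Λ F) {u : Hp n p R} (hu : C * ‖u‖ ≤ A) (h : Hp n p R) {x : E n}
    (hx : x ∈ closure (cube n R)) :
    |lin ε₀ F u h x + ε₀ * jetLap h x| ≤ Λ * (|jet h 0 x| + ‖jetGrad h x‖) := by
  obtain ⟨h0, h1, -⟩ := hC.bounds hu hx
  have e : lin ε₀ F u h x + ε₀ * jetLap h x =
      deriv (fun s => F x s (jetGrad u x)) (jet u 0 x) * jet h 0 x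
        + fderiv ℝ (fun q => F x (jet u 0 x) q) (jetGrad u x) (jetGrad h x) := by
    rw [lin]; ring
  rw [e, mul_add]
  refine (abs_add_le _ _).trans (add_le_add ?_ ?_)
  · rw [abs_mul]
    exact mul_le_mul_of_nonneg_right (hΛ.deriv_le x hx _ _ h0 h1) (abs_nonneg _)
  · exact ((fderiv ℝ (fun q => F x (jet u 0 x) q) (jetGrad u x)).le_opNorm _).trans
      (mul_le_mul_of_nonneg_right (hΛ.fderiv_le x hx _ _ h0 h1) (norm_nonneg _))

theorem abs_lin_le {C A Λ : ℝ} (hε : 0 < ε₀) (hΛ0 : 0 ≤ Λ) (hC : IsEmbeddingConst n p R C)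
    (hΛ : IsC2Bound R A Λ F) {u : Hp n p R} (hu : C * ‖u‖ ≤ A) (h : Hp n p R) {x : E n}
    (hx : x ∈ closure (cube n R)) : |lin ε₀ F u h x| ≤ (ε₀ + 2 * Λ) * C * ‖h‖ := by
  obtain ⟨k0, k1, k2⟩ := hC.2 h x hx
  have h1 := abs_lin_add_le (ε₀ := ε₀) hC hΛ hu h hx
  have h2 : |ε₀ * jetLap h x| ≤ ε₀ * (C * ‖h‖) := by
    rw [abs_mul, abs_of_pos hε]; gcongr
  have h3 : Λ * (|jet h 0 x| + ‖jetGrad h x‖) ≤ Λ * (C * ‖h‖ + C * ‖h‖) := by gcongr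
  have h4 := abs_sub (lin ε₀ F u h x + ε₀ * jetLap h x) (ε₀ * jetLap h x)
  rw [add_sub_cancel_right] at h4
  linarith

/-- The increment of the residual has the same principal part −ε₀Δ(u − v) as the linearization in
direction u − v (`abs_lin_add_le`); this makes their product coercive in the Laplacian. -/
theorem abs_res_sub_le (hp : ⌈((n : ℝ) + 1) / 2⌉₊ + 2 < p) (hR : 0 < R) {C A Λ : ℝ}
    (hC : IsEmbeddingConst n p R C) (hΛ : IsC2Bound R A Λ F) {u v : Hp n p R}
    (hu : C * ‖u‖ ≤ A) (hv : C * ‖v‖ ≤ A) {x : E n} (hx : x ∈ closure (cube n R)) :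
    |res ε₀ F u x - res ε₀ F v x + ε₀ * jetLap (u - v) x| ≤
      Λ * (|jet (u - v) 0 x| + ‖jetGrad (u - v) x‖) := by
  obtain ⟨h0, h1, -⟩ := hC.bounds hu hx
  obtain ⟨k0, k1, -⟩ := hC.bounds hv hx
  obtain ⟨d0, d1, d2⟩ := jet_sub hp hR u v hx
  have h := hΛ.sub_le x hx _ _ _ _ k0 k1 h0 h1
  rw [d0, d1] at h
  rw [← d2, res, res]
  convert h using 2
  ring

theorem abs_lin_sub_le (hp : ⌈((n : ℝ) + 1) / 2⌉₊ + 2 < p) (hR : 0 < R) {C A Λ : ℝ}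
    (hC : IsEmbeddingConst n p R C) (hΛ : IsC2Bound R A Λ F) {u v : Hp n p R}
    (hu : C * ‖u‖ ≤ A) (hv : C * ‖v‖ ≤ A) (h : Hp n p R) {x : E n}
    (hx : x ∈ closure (cube n R)) :
    |lin ε₀ F u h x - lin ε₀ F v h x| ≤ Λ * (|jet (u - v) 0 x| + ‖jetGrad (u - v) x‖) *
      (|jet h 0 x| + ‖jetGrad h x‖) := by
  obtain ⟨h0, h1, -⟩ := hC.bounds hu hx
  obtain ⟨k0, k1, -⟩ := hC.bounds hv hx
  obtain ⟨d0, d1, d2⟩ := jet_sub hp hR u v hx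
  have e1 := hΛ.deriv_sub_le x hx _ _ _ _ k0 k1 h0 h1
  have e2 := hΛ.fderiv_sub_le x hx _ _ _ _ k0 k1 h0 h1
  rw [d0, d1] at e1 e2
  have e : lin ε₀ F u h x - lin ε₀ F v h x =
      (deriv (fun s => F x s (jetGrad u x)) (jet u 0 x) -
        deriv (fun s => F x s (jetGrad v x)) (jet v 0 x)) * jet h 0 x +
      (fderiv ℝ (fun q => F x (jet u 0 x) q) (jetGrad u x) -
        fderiv ℝ (fun q => F x (jet v 0 x) q) (jetGrad v x)) (jetGrad h x) := by
    rw [lin, lin, sub_apply]; ring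
  rw [e, mul_add]
  refine (abs_add_le _ _).trans (add_le_add ?_ ?_)
  · rw [abs_mul]
    exact mul_le_mul_of_nonneg_right e1 (abs_nonneg _)
  · exact (ContinuousLinearMap.le_opNorm _ _).trans
      (mul_le_mul_of_nonneg_right e2 (norm_nonneg _))

theorem abs_integral_weight_mul_le (hR : 0 < R) (hr : R + 1 < r) (hb : R + r < b) (hβ : 1 < β)
    (hlam : 0 ≤ lam) {f : E n → ℝ} {K : ℝ} (hf : ∀ x ∈ closure (cube n R), |f x| ≤ K) :
    |∫ x, weight r b lam β x * f x ∂(cubeMeasure n R)| ≤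
      Real.exp (2 * lam) * K * volume.real (cube n R) := by
  have h := norm_setIntegral_le_of_norm_le_const (μ := volume) (s := cube n R)
    (f := fun x => weight r b lam β x * f x) (C := Real.exp (2 * lam) * K)
    (volume_cube_lt_top n R) (fun x hx => by
      rw [norm_mul, Real.norm_of_nonneg (weight_pos _ _ _ _ _).le]
      exact mul_le_mul (weight_le hR hr hb hβ hlam (subset_closure hx)) (hf x (subset_closure hx))
        (abs_nonneg _) (Real.exp_pos _).le)
  exact h

/-! ### The gradient -/

/-- Only continuity of `DJ` in h is needed here, so the constant may depend on u. -/
theorem abs_DJ_le (hp : ⌈((n : ℝ) + 1) / 2⌉₊ + 2 < p) (hR : 0 < R)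
    (hr : R + 1 < r) (hb : R + r < b) (hβ : 1 < β) (hε : 0 < ε₀) (hlam : 0 ≤ lam)
    (hF : IsC2 R F) (u : Hp n p R) :
    ∃ K, ∀ h, |DJ r b ε₀ F lam β η u h| ≤ K * ‖h‖ := by
  obtain ⟨C, hC⟩ : ∃ C, IsEmbeddingConst n p R C := exists_jet_bounds hp hR
  obtain ⟨Λ, hΛ0, hΛ⟩ := hF.exists_isC2Bound hR (C * ‖u‖)
  have hΛ := hΛ Λ le_rfl
  refine ⟨2 * (Real.exp (2 * lam) * ((ε₀ * (C * ‖u‖) + Λ) * ((ε₀ + 2 * Λ) * C)) *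
    volume.real (cube n R)) + |2 * η| * ‖u‖, fun h => ?_⟩
  rw [DJ_eq hp hR]
  have h1 := abs_integral_weight_mul_le (r := r) (b := b) (β := β) hR hr hb hβ hlam
    (f := fun x => res ε₀ F u x * lin ε₀ F u h x)
    (K := (ε₀ * (C * ‖u‖) + Λ) * ((ε₀ + 2 * Λ) * C * ‖h‖)) (fun x hx => by
      have := hC.1
      rw [abs_mul]
      exact mul_le_mul (abs_res_le hε hC hΛ le_rfl hx) (abs_lin_le hε hΛ0 hC hΛ le_rfl h hx)
        (abs_nonneg _) (by positivity))
  have h2 : |2 * η * inner ℝ u h| ≤ |2 * η| * (‖u‖ * ‖h‖) := by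
    rw [abs_mul]
    exact mul_le_mul_of_nonneg_left (abs_real_inner_le_norm u h) (abs_nonneg _)
  refine (abs_add_le _ _).trans ?_
  rw [abs_mul, abs_two]
  linarith

theorem existsUnique_isRieszGradient (hp : ⌈((n : ℝ) + 1) / 2⌉₊ + 2 < p) (hR : 0 < R)
    (hr : R + 1 < r) (hb : R + r < b) (hβ : 1 < β) (hε : 0 < ε₀) (hlam : 0 ≤ lam)
    (hF : IsC2 R F) (u : Hp n p R) :
    ∃! G, IsRieszGradient r b ε₀ F lam β η u G := by
  obtain ⟨K, hK⟩ := abs_DJ_le (η := η) hp hR hr hb hβ hε hlam hF u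
  let ℓ : Hp n p R →L[ℝ] ℝ := LinearMap.mkContinuous
    { toFun := DJ r b ε₀ F lam β η u
      map_add' := DJ_add hp hR hr hb hβ hF u
      map_smul' := fun c h => DJ_smul hp hR c u h } K hK
  exact existsUnique_inner_eq_of_isClosed (H0 hp hR) (isClosed_H0 hp hR) ℓ

theorem isRieszGradient_gradJ {u : Hp n p R}
    (h : ∃! G, IsRieszGradient r b ε₀ F lam β η u G) :
    IsRieszGradient r b ε₀ F lam β η u (gradJ r b ε₀ F lam β η u) := by
  rw [gradJ, dif_pos h.exists]
  exact h.exists.choose_spec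

/-! ### Lipschitz continuity and strong monotonicity of the gradient -/

theorem DJ_sub_DJ (hp : ⌈((n : ℝ) + 1) / 2⌉₊ + 2 < p) (hR : 0 < R)
    (hr : R + 1 < r) (hb : R + r < b) (hβ : 1 < β) (hF : IsC2 R F) (u v h : Hp n p R) :
    DJ r b ε₀ F lam β η u h - DJ r b ε₀ F lam β η v h =
      2 * ∫ x, weight r b lam β x * (res ε₀ F u x * lin ε₀ F u h x - res ε₀ F v x * lin ε₀ F v h x)
        ∂(cubeMeasure n R) + 2 * η * inner ℝ (u - v) h := by
  rw [DJ_eq hp hR, DJ_eq hp hR, inner_sub_left]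
  simp only [mul_sub]
  rw [integral_sub (integrable_res_mul_lin hp hR hr hb hβ hF u h)
    (integrable_res_mul_lin hp hR hr hb hβ hF v h)]
  ring

/-- The Lipschitz constant of the gradient. -/
def lipConst (n : ℕ) (R ε₀ C A Λ lam η : ℝ) : ℝ :=
  2 * (Real.exp (2 * lam) * (((ε₀ + 2 * Λ) * C) * ((ε₀ + 2 * Λ) * C) +
    (ε₀ * A + Λ) * (Λ * (2 * C) * (2 * C))) * volume.real (cube n R)) + 2 * η

theorem abs_DJ_sub_DJ_le (hp : ⌈((n : ℝ) + 1) / 2⌉₊ + 2 < p) (hR : 0 < R)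
    (hr : R + 1 < r) (hb : R + r < b) (hβ : 1 < β) (hε : 0 < ε₀) (hlam : 0 ≤ lam) (hη : 0 ≤ η)
    (hF : IsC2 R F) {C A Λ : ℝ} (hΛ0 : 0 ≤ Λ) (hC : IsEmbeddingConst n p R C)
    (hΛ : IsC2Bound R A Λ F) {u v : Hp n p R} (hu : C * ‖u‖ ≤ A) (hv : C * ‖v‖ ≤ A)
    (h : Hp n p R) :
    |DJ r b ε₀ F lam β η u h - DJ r b ε₀ F lam β η v h| ≤
      lipConst n R ε₀ C A Λ lam η * ‖u - v‖ * ‖h‖ := by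
  have hA : 0 ≤ A := (mul_nonneg hC.1.le (norm_nonneg u)).trans hu
  have hC0 := hC.1
  rw [DJ_sub_DJ hp hR hr hb hβ hF]
  have h1 := abs_integral_weight_mul_le (r := r) (b := b) (β := β) hR hr hb hβ hlam
    (f := fun x => res ε₀ F u x * lin ε₀ F u h x - res ε₀ F v x * lin ε₀ F v h x)
    (K := ((ε₀ + 2 * Λ) * C * ‖u - v‖) * ((ε₀ + 2 * Λ) * C * ‖h‖) +
      (ε₀ * A + Λ) * (Λ * (2 * C * ‖u - v‖) * (2 * C * ‖h‖))) (fun x hx => by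
      obtain ⟨j0, j1, j2⟩ := hC.2 (u - v) x hx
      obtain ⟨k0, k1, k2⟩ := hC.2 h x hx
      have e : res ε₀ F u x * lin ε₀ F u h x - res ε₀ F v x * lin ε₀ F v h x =
          (res ε₀ F u x - res ε₀ F v x) * lin ε₀ F u h x +
            res ε₀ F v x * (lin ε₀ F u h x - lin ε₀ F v h x) := by ring
      have f1 : |res ε₀ F u x - res ε₀ F v x| ≤ (ε₀ + 2 * Λ) * C * ‖u - v‖ := by
        have g1 := abs_res_sub_le (ε₀ := ε₀) hp hR hC hΛ hu hv hx
        have g2 : |ε₀ * jetLap (u - v) x| ≤ ε₀ * (C * ‖u - v‖) := by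
          rw [abs_mul, abs_of_pos hε]; gcongr
        have g3 : Λ * (|jet (u - v) 0 x| + ‖jetGrad (u - v) x‖) ≤
            Λ * (C * ‖u - v‖ + C * ‖u - v‖) := by gcongr
        have g4 := abs_sub (res ε₀ F u x - res ε₀ F v x + ε₀ * jetLap (u - v) x)
          (ε₀ * jetLap (u - v) x)
        rw [add_sub_cancel_right] at g4
        linarith
      have f2 : |lin ε₀ F u h x - lin ε₀ F v h x| ≤ Λ * (2 * C * ‖u - v‖) * (2 * C * ‖h‖) := by
        refine (abs_lin_sub_le hp hR hC hΛ hu hv h hx).trans ?_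
        gcongr <;> linarith
      rw [e]
      refine (abs_add_le _ _).trans ?_
      rw [abs_mul, abs_mul]
      exact add_le_add (mul_le_mul f1 (abs_lin_le hε hΛ0 hC hΛ hu h hx) (abs_nonneg _)
        (by positivity)) (mul_le_mul (abs_res_le hε hC hΛ hv hx) f2 (abs_nonneg _)
        (by positivity)))
  have h2 : |2 * η * inner ℝ (u - v) h| ≤ 2 * η * (‖u - v‖ * ‖h‖) := by
    rw [abs_mul, abs_of_nonneg (by positivity : 0 ≤ 2 * η)]
    exact mul_le_mul_of_nonneg_left (abs_real_inner_le_norm _ _) (by positivity)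
  refine (abs_add_le _ _).trans ?_
  rw [abs_mul, abs_two, lipConst]
  linarith

/-- Both f₁ and f₂ equal −ε₀L up to ΛN, so f₁f₂ is ε₀²L² up to cross terms; Young's inequality
spends half of it and costs 3(ΛN)². The term ρg costs at most BΛN². -/
theorem monotone_pointwise {ε₀ L f₁ f₂ g ρ Λ N B S : ℝ} (hΛ0 : 0 ≤ Λ) (hN : 0 ≤ N)
    (h1 : |f₁ + ε₀ * L| ≤ Λ * N) (h2 : |f₂ + ε₀ * L| ≤ Λ * N) (hg : |g| ≤ Λ * N * N)
    (hρ : |ρ| ≤ B) (hS : N ^ 2 ≤ 2 * S) :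
    ε₀ ^ 2 / 2 * L ^ 2 - 2 * (3 * Λ ^ 2 + B * Λ) * S ≤ f₁ * f₂ + ρ * g := by
  have hB : 0 ≤ B := (abs_nonneg ρ).trans hρ
  obtain ⟨a, ha⟩ : ∃ a, a = f₁ + ε₀ * L := ⟨_, rfl⟩
  obtain ⟨c, hc⟩ : ∃ c, c = f₂ + ε₀ * L := ⟨_, rfl⟩
  rw [← ha] at h1
  rw [← hc] at h2
  have e1 : f₁ = a - ε₀ * L := by rw [ha]; ring
  have e2 : f₂ = c - ε₀ * L := by rw [hc]; ring
  have k1 : -(B * (Λ * N * N)) ≤ ρ * g := by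
    have : |ρ * g| ≤ B * (Λ * N * N) := by
      rw [abs_mul]; exact mul_le_mul hρ hg (abs_nonneg _) hB
    exact (abs_le.1 this).1
  have k2 : -(Λ * N * (Λ * N)) ≤ a * c := by
    have : |a * c| ≤ Λ * N * (Λ * N) := by
      rw [abs_mul]; exact mul_le_mul h1 h2 (abs_nonneg _) (by positivity)
    exact (abs_le.1 this).1
  have k3 : (a + c) ^ 2 ≤ (2 * (Λ * N)) ^ 2 := by
    rw [sq_le_sq, abs_of_nonneg (by positivity : 0 ≤ 2 * (Λ * N))]
    linarith [abs_add_le a c]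
  have k4 : ε₀ ^ 2 / 2 * L ^ 2 - 3 * (Λ * N) ^ 2 ≤ f₁ * f₂ := by
    rw [e1, e2]
    -- The square gives ε₀L(a + c) ≤ (ε₀L)²/2 + (a + c)²/2, with (a + c)² ≤ 4(ΛN)² and ac ≥ −(ΛN)².
    nlinarith [sq_nonneg (ε₀ * L - (a + c))]
  have k5 : (3 * Λ ^ 2 + B * Λ) * N ^ 2 ≤ (3 * Λ ^ 2 + B * Λ) * (2 * S) :=
    mul_le_mul_of_nonneg_left hS (by positivity)
  linarith

theorem integrable_weight_mul (hR : 0 < R) (hr : R + 1 < r) (hb : R + r < b) (hβ : 1 < β)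
    {f : E n → ℝ} (hf : ContinuousOn f (closure (cube n R))) :
    Integrable (fun x => weight r b lam β x * f x) (cubeMeasure n R) :=
  continuousOn_integrable ((continuousOn_weight hR hr hb hβ lam).mul hf)

/-- Strong monotonicity of the gradient for large `λ`, by the Carleman estimate. -/
theorem le_DJ_sub_DJ (hp : ⌈((n : ℝ) + 1) / 2⌉₊ + 2 < p) (hR : 0 < R)
    (hr : R + 1 < r) (hb : R + r < b) (hβ : 1 < β) (hε : 0 < ε₀)
    (hF : IsC2 R F) {C A Λ : ℝ} (hΛ0 : 0 ≤ Λ) (hC : IsEmbeddingConst n p R C)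
    (hΛ : IsC2Bound R A Λ F) {u v : Hp n p R} (hu : C * ‖u‖ ≤ A) (hv : C * ‖v‖ ≤ A) {k : ℝ}
    (hcar : k * lam * ∫ x, weight r b lam β x * (‖jetGrad (u - v) x‖ ^ 2 + jet (u - v) 0 x ^ 2)
        ∂(cubeMeasure n R) ≤
      ∫ x, weight r b lam β x * jetLap (u - v) x ^ 2 ∂(cubeMeasure n R))
    (hk : 2 * (3 * Λ ^ 2 + (ε₀ * A + Λ) * Λ) ≤ ε₀ ^ 2 / 2 * (k * lam)) :
    2 * η * ‖u - v‖ ^ 2 ≤ DJ r b ε₀ F lam β η u (u - v) - DJ r b ε₀ F lam β η v (u - v) := by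
  rw [DJ_sub_DJ hp hR hr hb hβ hF, real_inner_self_eq_norm_sq]
  have cS : ContinuousOn (fun x => ‖jetGrad (u - v) x‖ ^ 2 + jet (u - v) 0 x ^ 2)
      (closure (cube n R)) :=
    ((continuousOn_jetGrad hp hR _).norm.pow 2).add ((continuousOn_jet_zero hp hR _).pow 2)
  have cL : ContinuousOn (fun x => jetLap (u - v) x ^ 2) (closure (cube n R)) :=
    (continuousOn_jetLap hp hR _).pow 2
  have iS := integrable_weight_mul (r := r) (b := b) (lam := lam) (β := β) hR hr hb hβ cS
  have iL := integrable_weight_mul (r := r) (b := b) (lam := lam) (β := β) hR hr hb hβ cL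
  have cT : ContinuousOn (fun x => res ε₀ F u x * lin ε₀ F u (u - v) x -
      res ε₀ F v x * lin ε₀ F v (u - v) x) (closure (cube n R)) :=
    ((continuousOn_res hp hR hF u).mul (continuousOn_lin hp hR hF u _)).sub
      ((continuousOn_res hp hR hF v).mul (continuousOn_lin hp hR hF v _))
  have hle := setIntegral_mono_on ((iL.const_mul (ε₀ ^ 2 / 2)).sub
      (iS.const_mul (2 * (3 * Λ ^ 2 + (ε₀ * A + Λ) * Λ))))
    (integrable_weight_mul (r := r) (b := b) (lam := lam) (β := β) hR hr hb hβ cT)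
    (measurableSet_cube n R) (fun x hx' => by
      have hx := subset_closure hx'
      -- The difference of products is split as (res u − res v) · lin u + res v · (lin u − lin v):
      -- f₁, f₂, ρ and g are these four factors.
      have h := monotone_pointwise (S := ‖jetGrad (u - v) x‖ ^ 2 + jet (u - v) 0 x ^ 2) hΛ0
        (by positivity) (abs_res_sub_le (ε₀ := ε₀) hp hR hC hΛ hu hv hx)
        (abs_lin_add_le (ε₀ := ε₀) hC hΛ hu (u - v) hx)
        (abs_lin_sub_le (ε₀ := ε₀) hp hR hC hΛ hu hv (u - v) hx) (abs_res_le hε hC hΛ hv hx)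
        (by
          rw [← sq_abs (jet (u - v) 0 x)]
          nlinarith [sq_nonneg (|jet (u - v) 0 x| - ‖jetGrad (u - v) x‖)])
      have h' := mul_le_mul_of_nonneg_left h (weight_pos r b lam β x).le
      simp only [Pi.sub_apply]
      linarith)
  simp only [Pi.sub_apply] at hle
  rw [integral_sub (iL.const_mul _) (iS.const_mul _), integral_const_mul, integral_const_mul] at hle
  have hS0 : 0 ≤ ∫ x, weight r b lam β x * (‖jetGrad (u - v) x‖ ^ 2 + jet (u - v) 0 x ^ 2)
      ∂(cubeMeasure n R) :=
    integral_nonneg fun x => mul_nonneg (weight_pos _ _ _ _ _).le (by positivity)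
  -- The Carleman estimate absorbs the terms of order at most one into the Laplacian term; only the
  -- regularization survives.
  have h1 := mul_le_mul_of_nonneg_left hcar (by positivity : 0 ≤ ε₀ ^ 2 / 2)
  have h2 := mul_le_mul_of_nonneg_right hk hS0
  linarith

/-! ### The first order condition at a minimizer -/

/-- The Laplacian is linear, so only the Taylor remainder of F is left; its increment is at most
2C‖h‖|t|. -/
theorem res_add_smul (hp : ⌈((n : ℝ) + 1) / 2⌉₊ + 2 < p) (hR : 0 < R) {C A Λ : ℝ}
    (hΛ0 : 0 ≤ Λ) (hC : IsEmbeddingConst n p R C) (hΛ : IsC2Bound R A Λ F) {u h : Hp n p R}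
    (hu : C * (‖u‖ + ‖h‖) ≤ A) {t : ℝ} (ht : |t| ≤ 1) {x : E n} (hx : x ∈ closure (cube n R)) :
    |res ε₀ F (u + t • h) x - res ε₀ F u x - t * lin ε₀ F u h x| ≤
      Λ * (2 * C * ‖h‖) ^ 2 * t ^ 2 := by
  have hC0 := hC.1
  have hu1 : C * ‖u‖ ≤ A := by
    refine le_trans ?_ hu
    gcongr
    linarith [norm_nonneg h]
  have hu2 : C * ‖u + t • h‖ ≤ A := by
    refine le_trans ?_ hu
    gcongr
    refine (norm_add_le _ _).trans ?_
    rw [norm_smul, Real.norm_eq_abs]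
    nlinarith [norm_nonneg h]
  obtain ⟨h0, h1, -⟩ := hC.bounds hu1 hx
  obtain ⟨k0, k1, -⟩ := hC.bounds hu2 hx
  obtain ⟨j0, j1, -⟩ := hC.2 h x hx
  have T := hΛ.taylor x hx _ _ _ _ h0 h1 k0 k1
  have d0 : jet (u + t • h) 0 x - jet u 0 x = t * jet h 0 x := by
    rw [jet_add hp hR _ _ (by simp) hx, jet_smul hp hR _ _ (by simp) hx]; ring
  have d1 : jetGrad (u + t • h) x - jetGrad u x = t • jetGrad h x := by
    rw [jetGrad_add hp hR _ _ hx, jetGrad_smul hp hR _ _ hx]; abel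
  have d2 : jetLap (u + t • h) x = jetLap u x + t * jetLap h x := by
    rw [jetLap_add hp hR _ _ hx, jetLap_smul hp hR _ _ hx]
  rw [d0, d1, map_smul, smul_eq_mul] at T
  have e : res ε₀ F (u + t • h) x - res ε₀ F u x - t * lin ε₀ F u h x =
      F x (jet (u + t • h) 0 x) (jetGrad (u + t • h) x) - F x (jet u 0 x) (jetGrad u x) -
        deriv (fun s => F x s (jetGrad u x)) (jet u 0 x) * (t * jet h 0 x) -
        t * fderiv ℝ (fun q => F x (jet u 0 x) q) (jetGrad u x) (jetGrad h x) := by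
    rw [res, res, lin, d2]; ring
  rw [e]
  refine T.trans ?_
  rw [mul_assoc]
  refine mul_le_mul_of_nonneg_left ?_ hΛ0
  rw [← mul_pow, norm_smul, abs_mul, Real.norm_eq_abs, ← mul_add, ← sq_abs (2 * C * ‖h‖ * t),
    abs_mul _ t, abs_of_nonneg (by positivity : 0 ≤ 2 * C * ‖h‖), mul_comm (2 * C * ‖h‖)]
  gcongr
  linarith

/-- An upper quadratic bound along lines is enough for the first order condition, without
differentiating under the integral. -/
theorem J_add_smul_le (hp : ⌈((n : ℝ) + 1) / 2⌉₊ + 2 < p) (hR : 0 < R)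
    (hr : R + 1 < r) (hb : R + r < b) (hβ : 1 < β) (hε : 0 < ε₀) (hlam : 0 ≤ lam)
    (hF : IsC2 R F) (u h : Hp n p R) :
    ∃ K, ∀ t : ℝ, |t| ≤ 1 → J r b ε₀ F lam β η (u + t • h) ≤
      J r b ε₀ F lam β η u + t * DJ r b ε₀ F lam β η u h + K * t ^ 2 := by
  obtain ⟨C, hC⟩ : ∃ C, IsEmbeddingConst n p R C := exists_jet_bounds hp hR
  have hC0 := hC.1
  obtain ⟨Λ, hΛ0, hΛ⟩ := hF.exists_isC2Bound hR (C * (‖u‖ + ‖h‖))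
  have hΛ := hΛ Λ le_rfl
  set A := C * (‖u‖ + ‖h‖) with hA
  have hu : C * ‖u‖ ≤ A := by
    rw [hA]; gcongr; linarith [norm_nonneg h]
  have hA0 : 0 ≤ A := by positivity
  set P := ε₀ * A + Λ with hP
  set Q := (ε₀ + 2 * Λ) * C * ‖h‖ with hQ
  set T := Λ * (2 * C * ‖h‖) ^ 2 with hT
  have hP0 : 0 ≤ P := by positivity
  have hQ0 : 0 ≤ Q := by positivity
  have hT0 : 0 ≤ T := by positivity
  set K := Q ^ 2 + 2 * T * (P + Q) + T ^ 2 with hK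
  refine ⟨Real.exp (2 * lam) * K * volume.real (cube n R) + η * ‖h‖ ^ 2, fun t ht => ?_⟩
  have ht2 : t ^ 2 ≤ 1 := by rw [← sq_abs]; exact pow_le_one₀ (abs_nonneg t) ht
  have key : ∀ x ∈ closure (cube n R),
      |res ε₀ F (u + t • h) x ^ 2 - res ε₀ F u x ^ 2 -
        2 * t * (res ε₀ F u x * lin ε₀ F u h x)| ≤ K * t ^ 2 := by
    intro x hx
    have e1 := res_add_smul (ε₀ := ε₀) hp hR hΛ0 hC hΛ le_rfl ht hx
    have e2 := abs_res_le hε hC hΛ hu hx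
    have e3 := abs_lin_le hε hΛ0 hC hΛ hu h hx
    rw [← hT] at e1
    rw [← hP] at e2
    rw [← hQ] at e3
    obtain ⟨e, he⟩ : ∃ e, e = res ε₀ F (u + t • h) x - res ε₀ F u x - t * lin ε₀ F u h x :=
      ⟨_, rfl⟩
    rw [← he] at e1
    have hexp : res ε₀ F (u + t • h) x ^ 2 - res ε₀ F u x ^ 2 -
        2 * t * (res ε₀ F u x * lin ε₀ F u h x) =
        t ^ 2 * lin ε₀ F u h x ^ 2 + 2 * e * (res ε₀ F u x + t * lin ε₀ F u h x) + e ^ 2 := by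
      rw [he]; ring
    rw [hexp]
    have b1 : |t ^ 2 * lin ε₀ F u h x ^ 2| ≤ t ^ 2 * Q ^ 2 := by
      rw [abs_mul, abs_of_nonneg (sq_nonneg t), abs_pow]
      gcongr
    have b2 : |2 * e * (res ε₀ F u x + t * lin ε₀ F u h x)| ≤ 2 * (T * t ^ 2) * (P + Q) := by
      rw [abs_mul, abs_mul, abs_two]
      refine mul_le_mul (by linarith) ?_ (abs_nonneg _) (by positivity)
      refine (abs_add_le _ _).trans (add_le_add e2 ?_)
      rw [abs_mul]
      calc |t| * |lin ε₀ F u h x| ≤ 1 * Q := mul_le_mul ht e3 (abs_nonneg _) zero_le_one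
        _ = Q := one_mul Q
    have b3 : |e ^ 2| ≤ T ^ 2 * t ^ 2 := by
      rw [abs_pow]
      calc |e| ^ 2 ≤ (T * t ^ 2) ^ 2 := by gcongr
        _ = T ^ 2 * t ^ 2 * t ^ 2 := by ring
        _ ≤ T ^ 2 * t ^ 2 * 1 := by gcongr
        _ = _ := mul_one _
    refine (abs_add_three _ _ _).trans ?_
    rw [hK]
    linarith
  have cR := fun v : Hp n p R => continuousOn_res (ε₀ := ε₀) hp hR hF v
  have i0 (v : Hp n p R) : Integrable (fun x => weight r b lam β x * res ε₀ F v x ^ 2)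
      (cubeMeasure n R) := integrable_weight_mul hR hr hb hβ ((cR v).pow 2)
  have i1 := i0 (u + t • h)
  have i2 := i0 u
  have i3 := integrable_res_mul_lin (lam := lam) (ε₀ := ε₀) hp hR hr hb hβ hF u h
  have hint := (le_abs_self _).trans (abs_integral_weight_mul_le (r := r) (b := b) (β := β) hR hr
    hb hβ hlam key)
  have hsplit : ∫ x, weight r b lam β x * (res ε₀ F (u + t • h) x ^ 2 - res ε₀ F u x ^ 2 -
      2 * t * (res ε₀ F u x * lin ε₀ F u h x)) ∂(cubeMeasure n R) =
      ∫ x, weight r b lam β x * res ε₀ F (u + t • h) x ^ 2 ∂(cubeMeasure n R) -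
      ∫ x, weight r b lam β x * res ε₀ F u x ^ 2 ∂(cubeMeasure n R) -
      2 * t * ∫ x, weight r b lam β x * (res ε₀ F u x * lin ε₀ F u h x) ∂(cubeMeasure n R) := by
    rw [← integral_const_mul, ← integral_sub i1 i2]
    refine Eq.trans ?_ (integral_sub (i1.sub i2) (i3.const_mul (2 * t)))
    exact integral_congr_ae (Eventually.of_forall fun x => by simp only; ring)
  rw [hsplit] at hint
  have hnorm : ‖u + t • h‖ ^ 2 = ‖u‖ ^ 2 + 2 * t * inner ℝ u h + t ^ 2 * ‖h‖ ^ 2 :=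
    norm_add_smul_sq u h t
  rw [J_eq hp hR, J_eq hp hR, DJ_eq hp hR, hnorm]
  linarith

theorem DJ_eq_zero_of_isMinOn (hp : ⌈((n : ℝ) + 1) / 2⌉₊ + 2 < p) (hR : 0 < R)
    (hr : R + 1 < r) (hb : R + r < b) (hβ : 1 < β) (hε : 0 < ε₀) (hlam : 0 ≤ lam)
    (hF : IsC2 R F) {f g : E n → ℝ} {M : ℝ} {u : Hp n p R} (hu : u ∈ bdrySet n p R f g)
    (huM : ‖u‖ < M) (hmin : IsMinOn (J r b ε₀ F lam β η)
      (bdrySet n p R f g ∩ Metric.closedBall 0 M) u) {h : Hp n p R} (hh : h ∈ H0 hp hR) :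
    DJ r b ε₀ F lam β η u h = 0 := by
  obtain ⟨K, hK⟩ := J_add_smul_le (η := η) hp hR hr hb hβ hε hlam hF u h
  set D := DJ r b ε₀ F lam β η u h
  have hcont : Tendsto (fun t : ℝ => ‖u + t • h‖) (𝓝 0) (𝓝 ‖u‖) := by
    have : Continuous fun t : ℝ => ‖u + t • h‖ := by fun_prop
    simpa using this.tendsto 0
  have habs : ∀ᶠ t : ℝ in 𝓝 0, |t| ≤ 1 := by
    filter_upwards [Metric.closedBall_mem_nhds (0 : ℝ) one_pos] with t ht
    simpa using ht
  -- From J(u) ≤ J(u + th) ≤ J(u) + tD + Kt², the polynomial is nonnegative near 0; strictness of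
  -- ‖u‖ < M allows t of both signs.
  have hloc : IsLocalMin (fun t : ℝ => t * D + K * t ^ 2) 0 := by
    filter_upwards [hcont.eventually (gt_mem_nhds huM), habs] with t ht1 ht2
    have h1 : J r b ε₀ F lam β η u ≤ J r b ε₀ F lam β η (u + t • h) :=
      hmin ⟨add_mem_bdrySet hp hR hu ((H0 hp hR).smul_mem t hh), by
        rw [mem_closedBall_zero_iff]; exact ht1.le⟩
    have h2 := hK t ht2
    simp only [zero_mul, ne_eq, OfNat.ofNat_ne_zero, not_false_eq_true, zero_pow, mul_zero,
      add_zero]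
    linarith
  have hd : HasDerivAt (fun t : ℝ => t * D + K * t ^ 2) D 0 := by
    refine (((hasDerivAt_id' (0 : ℝ)).mul_const D).add
      (((hasDerivAt_id' (0 : ℝ)).pow 2).const_mul K)).congr_deriv ?_
    simp
  exact hloc.hasDerivAt_eq_zero hd

end Functional

/-! ### Convergence of the gradient descent -/

section Descent

variable {n p : ℕ} {R r b ε₀ lam β η κ L M : ℝ} {F : E n → ℝ → E n → ℝ}

theorem two_mul_le_lipConst {C A Λ : ℝ} (hε : 0 ≤ ε₀) (hC : 0 ≤ C) (hA : 0 ≤ A) (hΛ : 0 ≤ Λ) :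
    2 * η ≤ lipConst n R ε₀ C A Λ lam η := by
  unfold lipConst
  have : 0 ≤ 2 * (Real.exp (2 * lam) * (((ε₀ + 2 * Λ) * C) * ((ε₀ + 2 * Λ) * C) +
    (ε₀ * A + Λ) * (Λ * (2 * C) * (2 * C))) * volume.real (cube n R)) := by positivity
  linarith

/-- One step of the gradient descent contracts the distance to a critical point. -/
theorem norm_gradient_step_le {u v G : Hp n p R} (hκ : 0 ≤ κ) (hη : 0 ≤ η)
    (hκL : κ * L ^ 2 ≤ η) (hG : IsRieszGradient r b ε₀ F lam β η u G)
    (huv : u - v ∈ bdrySet n p R 0 0)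
    (hv : ∀ h ∈ bdrySet n p R 0 0, DJ r b ε₀ F lam β η v h = 0)
    (hmono : 2 * η * ‖u - v‖ ^ 2 ≤
      DJ r b ε₀ F lam β η u (u - v) - DJ r b ε₀ F lam β η v (u - v))
    (hlip : |DJ r b ε₀ F lam β η u G - DJ r b ε₀ F lam β η v G| ≤ L * ‖u - v‖ * ‖G‖)
    (hL : 0 ≤ L) :
    ‖u - κ • G - v‖ ^ 2 ≤ (1 - κ * η) * ‖u - v‖ ^ 2 := by
  -- Criticality of v turns differences of `DJ` into inner products with G: u − v is tested for
  -- monotonicity, G itself for the bound on ‖G‖.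
  rw [hv _ huv, sub_zero, ← hG.2 _ huv] at hmono
  rw [hv _ hG.1, sub_zero, ← hG.2 _ hG.1, real_inner_self_eq_norm_sq, abs_of_nonneg (sq_nonneg _),
    sq] at hlip
  have hle : ‖G‖ ≤ L * ‖u - v‖ := by
    rcases (norm_nonneg G).eq_or_lt with h | h
    · rw [← h]; positivity
    · exact le_of_mul_le_mul_right hlip h
  rw [sub_right_comm]
  exact norm_sub_smul_le_of_monotone hκ hmono hle hκL hη

theorem norm_gradient_descent_le (hp : ⌈((n : ℝ) + 1) / 2⌉₊ + 2 < p) (hR : 0 < R) (hκ : 0 ≤ κ)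
    (hη : 0 ≤ η) (hL : 0 ≤ L) (hκL : κ * L ^ 2 ≤ η) (hκη : κ * η ≤ 1)
    (hG : ∀ u : Hp n p R, IsRieszGradient r b ε₀ F lam β η u (gradJ r b ε₀ F lam β η u))
    (hmono : ∀ u v : Hp n p R, ‖u‖ ≤ M → ‖v‖ ≤ M → u - v ∈ H0 hp hR → 2 * η * ‖u - v‖ ^ 2 ≤
      DJ r b ε₀ F lam β η u (u - v) - DJ r b ε₀ F lam β η v (u - v))
    (hlip : ∀ u v h : Hp n p R, ‖u‖ ≤ M → ‖v‖ ≤ M →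
      |DJ r b ε₀ F lam β η u h - DJ r b ε₀ F lam β η v h| ≤ L * ‖u - v‖ * ‖h‖)
    {f g : E n → ℝ} {v : Hp n p R} (hv : v ∈ bdrySet n p R f g) (hvM : ‖v‖ < M / 3)
    (hcrit : ∀ h ∈ bdrySet n p R 0 0, DJ r b ε₀ F lam β η v h = 0)
    {u : ℕ → Hp n p R} (hu : u 0 ∈ bdrySet n p R f g) (huM : ‖u 0‖ < M / 3)
    (hstep : ∀ k, u (k + 1) = u k - κ • gradJ r b ε₀ F lam β η (u k)) (k : ℕ) :
    u k ∈ bdrySet n p R f g ∧ ‖u k - v‖ ^ 2 ≤ (1 - κ * η) ^ k * ‖u 0 - v‖ ^ 2 := by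
  have hθ : 0 ≤ 1 - κ * η := by linarith
  induction k with
  | zero => simp [hu]
  | succ k ih =>
    obtain ⟨hk, hle⟩ := ih
    have hsub : u k - v ∈ H0 hp hR := sub_mem_H0 hp hR hk hv
    have hle' : ‖u k - v‖ ≤ ‖u 0 - v‖ := by
      refine le_of_sq_le_sq ?_ (norm_nonneg _)
      refine hle.trans (mul_le_of_le_one_left (sq_nonneg _) (pow_le_one₀ hθ ?_))
      linarith [mul_nonneg hκ hη]
    -- Where M/3 is used: ‖u_k‖ ≤ ‖u₀ − v‖ + ‖v‖ ≤ ‖u₀‖ + 2‖v‖ < M.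
    have hukM : ‖u k‖ ≤ M := by
      have h1 : ‖u k‖ ≤ ‖u k - v‖ + ‖v‖ := norm_le_norm_sub_add _ _
      have h2 : ‖u 0 - v‖ ≤ ‖u 0‖ + ‖v‖ := norm_sub_le _ _
      linarith
    have hvM' : ‖v‖ ≤ M := by linarith [norm_nonneg v]
    rw [hstep k]
    constructor
    · rw [sub_eq_add_neg, ← smul_neg]
      exact add_mem_bdrySet hp hR hk ((H0 hp hR).smul_mem κ ((H0 hp hR).neg_mem (hG (u k)).1))
    · calc _ ≤ (1 - κ * η) * ‖u k - v‖ ^ 2 := norm_gradient_step_le hκ hη hκL (hG (u k)) hsub hcrit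
            (hmono _ _ hukM hvM' hsub) (hlip _ _ _ hukM hvM') hL
        _ ≤ (1 - κ * η) * ((1 - κ * η) ^ k * ‖u 0 - v‖ ^ 2) := by gcongr
        _ = _ := by ring

theorem le_rpow_half_mul {a c θ : ℝ} (hc : 0 ≤ c) (hθ : 0 ≤ θ) {k : ℕ}
    (h : a ^ 2 ≤ θ ^ k * c ^ 2) : a ≤ θ ^ ((k : ℝ) / 2) * c := by
  refine le_of_sq_le_sq ?_ (mul_nonneg (Real.rpow_nonneg hθ _) hc)
  rw [mul_pow, ← Real.rpow_natCast (θ ^ ((k : ℝ) / 2)), ← Real.rpow_mul hθ]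
  simpa using h

end Descent

end Convexification

end
-- Choice of the constants and conclusion.
theorem theorem4p2 (n p : ℕ) (hp : ⌈((n : ℝ) + 1) / 2⌉₊ + 2 < p)
    (R r b ε₀ M β : ℝ) (hR : 0 < R) (hr : R + 1 < r) (hb : R + r < b)
    (hε₀ : 0 < ε₀) (hM : 0 < M) (hβ : 1 < β) :
    ∃ (lam₀ : (Convexification.E n → ℝ → Convexification.E n → ℝ) → ℝ) (κ₀ : ℝ → ℝ → ℝ),
      ∀ F : Convexification.E n → ℝ → Convexification.E n → ℝ, Convexification.IsC2 R F →
        1 < lam₀ F ∧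
        ∀ lam : ℝ, lam₀ F < lam → ∀ η : ℝ, 0 < η →
          -- the gradient is well defined
          (∀ u : Convexification.Hp n p R,
            ∃! G, Convexification.IsRieszGradient r b ε₀ F lam β η u G) ∧
          0 < κ₀ lam η ∧ κ₀ lam η < 1 ∧
          ∀ κ : ℝ, 0 < κ → κ < κ₀ lam η →
            ∃ θ : ℝ, 0 < θ ∧ θ < 1 ∧
              ∀ (f g : Convexification.E n → ℝ) (umin : Convexification.Hp n p R),
                umin ∈ Convexification.bdrySet n p R f g ∩ Metric.ball 0 (M / 3) →
                IsMinOn (Convexification.J r b ε₀ F lam β η)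
                  (Convexification.bdrySet n p R f g ∩ Metric.closedBall 0 M) umin →
                ∀ u : ℕ → Convexification.Hp n p R,
                  u 0 ∈ Convexification.bdrySet n p R f g ∩ Metric.ball 0 (M / 3) →
                  (∀ k, u (k + 1)
                    = u k - κ • Convexification.gradJ r b ε₀ F lam β η (u k)) →
                  ∀ k : ℕ, ‖u k - umin‖ ≤ θ ^ ((k : ℝ) / 2) * ‖u 0 - umin‖ := by
  obtain ⟨C, hC⟩ : ∃ C, Convexification.IsEmbeddingConst n p R C :=
    Convexification.exists_jet_bounds hp hR
  obtain ⟨ψ₁, ψ₂, ψ₃, l, B, hψ⟩ := Convexification.exists_isWeightProfile hR hr hb hβ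
  obtain ⟨c, lam₁, hc, -, hcar⟩ := Convexification.exists_carleman hp hR hψ
  have hC0 := hC.1
  set A := C * M
  have hA : 0 ≤ A := by positivity
  choose! Λ hΛ0 hΛ using fun (F : Convexification.E n → ℝ → Convexification.E n → ℝ)
    (hF : Convexification.IsC2 R F) => hF.exists_isC2Bound hR A
  refine ⟨fun F => max (max 2 (Λ F)) (max lam₁
    (2 * (2 * (3 * Λ F ^ 2 + (ε₀ * A + Λ F) * Λ F)) / (ε₀ ^ 2 * c))),
    -- The Lipschitz constant is formed with λ in the place of Λ(F), so that κ₀ is free of F.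
    fun lam η => min (1 / 2) (η / Convexification.lipConst n R ε₀ C A lam lam η ^ 2),
    fun F hF => ⟨lt_max_of_lt_left (lt_max_of_lt_left one_lt_two), fun lam hlam η hη => ?_⟩⟩
  simp only [max_lt_iff] at hlam
  obtain ⟨⟨h2, hΛlam⟩, hlam₁, hlarge⟩ := hlam
  have hlam0 : 0 ≤ lam := by linarith
  rw [div_lt_iff₀ (by positivity)] at hlarge
  have hunique := Convexification.existsUnique_isRieszGradient (η := η) hp hR hr hb hβ hε₀ hlam0 hF
  have hL := Convexification.two_mul_le_lipConst (n := n) (R := R) (lam := lam) (η := η) hε₀.le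
    hC0.le hA hlam0
  set L := Convexification.lipConst n R ε₀ C A lam lam η
  have hL0 : 0 < L := by linarith
  refine ⟨hunique, by positivity, (min_le_left _ _).trans_lt (by norm_num), fun κ hκ hκ₀ => ?_⟩
  have hκL : κ * L ^ 2 ≤ η := by
    rw [← le_div_iff₀ (by positivity)]
    exact hκ₀.le.trans (min_le_right _ _)
  -- As η < 2η ≤ L, one has κη² < κL² ≤ η; this gives θ > 0.
  have hκη : κ * η < 1 := by
    have h1 : κ * η * η < 1 * η := by
      have h2 : η ^ 2 < L ^ 2 := by gcongr; linarith
      nlinarith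
    exact lt_of_mul_lt_mul_right h1 hη.le
  refine ⟨1 - κ * η, by linarith, by linarith [mul_pos hκ hη],
    fun f g v hv hmin u hu hstep k => ?_⟩
  have hvM := mem_ball_zero_iff.1 hv.2
  have hcrit : ∀ h ∈ Convexification.bdrySet n p R 0 0,
      Convexification.DJ r b ε₀ F lam β η v h = 0 := fun h hh =>
    Convexification.DJ_eq_zero_of_isMinOn hp hR hr hb hβ hε₀ hlam0 hF hv.1 (by linarith) hmin hh
  refine Convexification.le_rpow_half_mul (norm_nonneg _) (by linarith)
    (Convexification.norm_gradient_descent_le hp hR hκ.le hη.le hL0.le hκL hκη.le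
      (fun u => Convexification.isRieszGradient_gradJ (hunique u)) ?_ ?_ hv.1 hvM hcrit hu.1
      (mem_ball_zero_iff.1 hu.2) hstep k).2
  -- Monotonicity uses the bound Λ(F) itself, whereas the Lipschitz estimate below uses the larger
  -- bound λ.
  · exact fun u v hu hv huv => Convexification.le_DJ_sub_DJ hp hR hr hb hβ hε₀ hF (hΛ0 F hF) hC
      (hΛ F hF _ le_rfl) (mul_le_mul_of_nonneg_left hu hC0.le)
      (mul_le_mul_of_nonneg_left hv hC0.le) (hcar lam hlam₁.le _ huv) (by linarith)
  · exact fun u v h hu hv => Convexification.abs_DJ_sub_DJ_le hp hR hr hb hβ hε₀ hlam0 hη.le hF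
      hlam0 hC (hΛ F hF _ hΛlam.le) (mul_le_mul_of_nonneg_left hu hC0.le)
      (mul_le_mul_of_nonneg_left hv hC0.le) h
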